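/- Let $\omega$ be the exponent of matrix multiplication over an arbitrary field $K$, i.e. the infimum of all real $\tau$ such that the tensor rank over $K$ of $n\times n$ matrix multiplication is $O(n^\tau)$. Algorithms are programs for a randomized random access machine (registers and memory cells hold natural numbers; operations $+$, truncated $-$, $\times$, rounded-down division, indirect addressing, fair coin tosses) whose running time is counted by the logarithmic cost criterion: each step costs one plus the bit lengths of the numbers and addresses it acts on. The input is a directed graph $G$ on $n\ge 1$ vertices (an undirected graph is treated as the directed graph with both orientations of each edge), with integer edge weights in $[0,M]$ given as a weighted adjacency matrix, an integer $k\ge 1$, and a real bound $B\ge 0$, of which the algorithm is given $\lfloor B\rfloor$. A $k$-path is a simple path in $G$ that visits exactly $k$ vertices; its weight is the sum of the weights of its $k-1$ edges. A correct answer is: a $k$-path whose weight is minimum among all $k$-paths in $G$, if this minimum weight is at most $B$; the answer "none", if $G$ has no $k$-path of weight at most $B$. Proposition. There is a constant $a$ such that for every $c\in\mathbb{N}$ there are a randomized program $P$ and a constant $C$ such that for all $n,k\ge 1$, $M$, $B$ and $G$ as above: 1. for every outcome of the coin tosses, $P$ halts after a time $t$ with $$t\le C\,2^k\,k^a\,\max(1,B)\;n^\omega\,\log^a(n+M+2)\quad\text{and}\quad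 t\le C\,2^k\max(1,B)\,\bigl(n\,k\,\log(M+2)\bigr)^a,$$ that is, in time $\tilde O(2^k\,\mathrm{poly}(k)\,B\,n^\omega)=O^*(2^kB)$; 2. the probability that the answer of $P$ is not correct is at most $n^{-c}$. -/

import Mathlib

open MeasureTheory

/-! ### A randomized random access machine with logarithmic cost -/

namespace RAM

/-- Arithmetic operations on natural numbers: subtraction is truncated, division rounds down. -/
inductive Op where
  | add
  | sub
  | mul
  | div

/-- The value of an arithmetic operation. -/
def Op.eval : Op → ℕ → ℕ → ℕ
  | .add, x, y => x + y
  | .sub, x, y => x - y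
  | .mul, x, y => x * y
  | .div, x, y => x / y

/-- Programs of the machine, in structured form. The machine has registers (named by constants
in the program) and an unbounded memory (addressed by the contents of registers); each register
and each memory cell holds a natural number. -/
inductive Prog where
  /-- do nothing -/
  | skip : Prog
  /-- `const d v`: register `d` receives the constant `v` -/
  | const (d v : ℕ) : Prog
  /-- `op o d x y`: register `d` receives the result of `o` on the contents of `x` and `y` -/
  | op (o : Op) (d x y : ℕ) : Prog
  /-- `load d x`: register `d` receives the memory cell whose address is in register `x` -/
  | load (d x : ℕ) : Prog
  /-- `store x y`: the memory cell whose address is in register `x` receives register `y` -/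
  | store (x y : ℕ) : Prog
  /-- `coin d`: register `d` receives a fresh fair random bit -/
  | coin (d : ℕ) : Prog
  /-- sequential composition -/
  | seq (p q : Prog) : Prog
  /-- `branch x p q`: run `p` if register `x` is nonzero, otherwise `q` -/
  | branch (x : ℕ) (p q : Prog) : Prog
  /-- `loop x p`: run `p` as long as register `x` is nonzero -/
  | loop (x : ℕ) (p : Prog) : Prog

/-- A state of the machine: registers, memory, and the number of random bits drawn so far. -/
structure State where
  reg : ℕ → ℕ
  mem : ℕ → ℕ
  drawn : ℕ

/-- Writing `v` into register `d`. -/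
def State.setReg (s : State) (d v : ℕ) : State :=
  { s with reg := Function.update s.reg d v }

/-- Writing `v` into the memory cell with address `x`. -/
def State.setMem (s : State) (x v : ℕ) : State :=
  { s with mem := Function.update s.mem x v }

/-- `Exec coins p s t s'`: with the sequence `coins` of random bits, the program `p`, started in
the state `s`, halts in the state `s'` after time `t`. Time is counted by the logarithmic cost
criterion: an instruction costs one plus the binary lengths (`Nat.size`) of the numbers it acts on,
including the memory addresses; each test of a `branch` or a `loop` is charged in the same way. -/
inductive Exec (coins : ℕ → Bool) : Prog → State → ℕ → State → Prop
  | skip (s : State) : Exec coins .skip s 1 s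
  | const (s : State) (d v : ℕ) :
      Exec coins (.const d v) s (1 + v.size) (s.setReg d v)
  | op (s : State) (o : Op) (d x y : ℕ) :
      Exec coins (.op o d x y) s (1 + (s.reg x).size + (s.reg y).size)
        (s.setReg d (o.eval (s.reg x) (s.reg y)))
  | load (s : State) (d x : ℕ) :
      Exec coins (.load d x) s (1 + (s.reg x).size + (s.mem (s.reg x)).size)
        (s.setReg d (s.mem (s.reg x)))
  | store (s : State) (x y : ℕ) :
      Exec coins (.store x y) s (1 + (s.reg x).size + (s.reg y).size)
        (s.setMem (s.reg x) (s.reg y))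
  | coin (s : State) (d : ℕ) :
      Exec coins (.coin d) s 1 { s.setReg d (coins s.drawn).toNat with drawn := s.drawn + 1 }
  | seq {p q : Prog} {s₁ s₂ s₃ : State} {t₁ t₂ : ℕ} :
      Exec coins p s₁ t₁ s₂ → Exec coins q s₂ t₂ s₃ →
      Exec coins (.seq p q) s₁ (t₁ + t₂) s₃
  | branch_true {x : ℕ} {p q : Prog} {s s' : State} {t : ℕ} :
      s.reg x ≠ 0 → Exec coins p s t s' →
      Exec coins (.branch x p q) s (1 + (s.reg x).size + t) s'
  | branch_false {x : ℕ} {p q : Prog} {s s' : State} {t : ℕ} :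
      s.reg x = 0 → Exec coins q s t s' →
      Exec coins (.branch x p q) s (1 + (s.reg x).size + t) s'
  | loop_true {x : ℕ} {p : Prog} {s₁ s₂ s₃ : State} {t₁ t₂ : ℕ} :
      s₁.reg x ≠ 0 → Exec coins p s₁ t₁ s₂ → Exec coins (.loop x p) s₂ t₂ s₃ →
      Exec coins (.loop x p) s₁ (1 + (s₁.reg x).size + t₁ + t₂) s₃
  | loop_false {x : ℕ} {p : Prog} {s : State} :
      s.reg x = 0 → Exec coins (.loop x p) s (1 + (s.reg x).size) s

/-- The law of a sequence of independent fair random bits. -/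
noncomputable def coinMeasure : Measure (ℕ → Bool) :=
  Measure.infinitePi fun _ : ℕ => (PMF.uniformOfFintype Bool).toMeasure

end RAM

/-! ### The exponent of matrix multiplication -/

/-- Products of `n × n` matrices over `K` can be computed by a bilinear algorithm with `r`
multiplications of scalars, i.e. the rank of the tensor `⟨n, n, n⟩` over `K` is at most `r`. -/
def HasBilinearMatMul (K : Type*) [Field K] (n r : ℕ) : Prop :=
  ∃ α β γ : Fin r → Matrix (Fin n) (Fin n) K, ∀ X Y : Matrix (Fin n) (Fin n) K,
    X * Y = ∑ t, ((∑ i, ∑ j, α t i j * X i j) * (∑ i, ∑ j, β t i j * Y i j)) • γ t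

/-- The exponent `ω` of matrix multiplication over the field `K`: the infimum of all real `τ` such
that the rank of `⟨n, n, n⟩` is `O(n ^ τ)`. -/
noncomputable def matMulExponent (K : Type*) [Field K] : ℝ :=
  sInf {τ : ℝ | ∃ C : ℝ, ∀ n : ℕ, 1 ≤ n → ∃ r : ℕ, (r : ℝ) ≤ C * (n : ℝ) ^ τ ∧
    HasBilinearMatMul K n r}

/-! ### Minimum-weight `k`-paths -/

namespace KPath

variable {n : ℕ}

/-- A `k`-path of `G`: a simple path that visits `k` vertices, given as the list of its vertices.
An undirected graph is treated as the digraph with both orientations of every edge. -/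
def IsKPath (G : Digraph (Fin n)) (k : ℕ) (p : List (Fin n)) : Prop :=
  p.length = k ∧ p.Nodup ∧ p.IsChain G.Adj

/-- The weight of a path: the sum of the weights of its edges. -/
def weight (w : Fin n → Fin n → ℕ) (p : List (Fin n)) : ℕ :=
  ((p.zip p.tail).map fun e => w e.1 e.2).sum

/-- `out` is a right answer for the minimum-weight `k`-path problem with the bound `B`: a `k`-path
of minimum weight among all `k`-paths if this weight is at most `B`, and the answer
"there is none" (`none`) if no `k`-path has weight at most `B`. -/
def IsAnswer (G : Digraph (Fin n)) (w : Fin n → Fin n → ℕ) (k : ℕ) (B : ℝ) :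
    Option (List ℕ) → Prop
  | none => ¬ ∃ p, IsKPath G k p ∧ (weight w p : ℝ) ≤ B
  | some l => ∃ p : List (Fin n), p.map Fin.val = l ∧ IsKPath G k p ∧ (weight w p : ℝ) ≤ B ∧
      ∀ q, IsKPath G k q → weight w p ≤ weight w q

open Classical in
/-- The initial state: `n`, `k` and `⌊B⌋` are in the registers `0`, `1`, `2`, and the memory cell
`i * n + j` holds `0` if `(i, j)` is not an edge, and one plus its weight if it is one. Everything
else is zero. -/
noncomputable def input (G : Digraph (Fin n)) (w : Fin n → Fin n → ℕ) (k : ℕ) (B : ℝ) :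
    RAM.State where
  reg x := if x = 0 then n else if x = 1 then k else if x = 2 then ⌊B⌋₊ else 0
  mem x := if h : x < n * n then
      let i : Fin n := ⟨x / n, Nat.div_lt_of_lt_mul h⟩
      let j : Fin n := ⟨x % n, Nat.mod_lt x (Nat.pos_of_ne_zero fun h0 => by simp [h0] at h)⟩
      if G.Adj i j then w i j + 1 else 0
    else 0
  drawn := 0

/-- The answer in a final state: "there is none" if register `0` holds `0`, and otherwise the list
of the first `k` memory cells. -/
def output (k : ℕ) (s : RAM.State) : Option (List ℕ) :=
  if s.reg 0 = 0 then none else some ((List.range k).map s.mem)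

end KPath

/-! Attach to vertex `u` the vector `(1, u, u², …, u^(k-1))`, and add a source joined to every
vertex by an edge of weight zero. Sum over all walks with `k` edges from the source of total weight
`β` the exterior product of the vectors of the visited vertices, times a product of labels, one for
each triple (level, tail, head). The top coefficient of this sum is a polynomial in the labels,
homogeneous of degree `k`. A walk that repeats a vertex contributes nothing, because the square of a
vector vanishes (`nodup_of_wedges_ne_zero`). A `k`-path contributes its monomial times a Vandermonde
determinant, which is nonzero over `ℤ` (`wedges_powers_ne_zero`). So the polynomial is nonzero as
soon as there is a `k`-path of weight `β` (`walkSum_walkVar_ne_zero`).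

The labels are random numbers of `b = (c + 1) ⌈log₂ n⌉` bits. By Schwartz–Zippel a nonzero
polynomial vanishes at them with probability at most `k / 2 ^ b ≤ n ^ (-c)`, where `k ≤ n` because a
path exists. The arithmetic is done modulo a number larger than every possible absolute value of the
coefficient, so nothing is lost by reduction (`walkSum_eq_zero_of_modulus`).

A nonzero coefficient is traced back to a path without further randomness. Exterior multiplication
has an adjoint, the contraction, so a functional on arrays of length `2 ^ k` records the vertices
chosen so far. A nonzero pairing with the sum of the remaining walks has a nonzero summand, which
gives the next vertex (`exists_of_pair_walkSum_ne_zero`). At the end the chosen vertices must be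
distinct. Hence every path returned is genuine, and an error occurs only if the coefficient at the
minimum weight vanishes (`KPath.isAnswer_output`).

The dynamic program over (level, vertex, weight, subset) takes `O(2 ^ k k² B n²)` steps. No fast
matrix multiplication is needed: the tensor rank is at least `n²`, so `ω ≥ 2` over every field
(`two_le_matMulExponent`). To keep the length of the numbers free of `log B`, the bound `B` is first
replaced by its minimum with `k` times the greatest matrix entry.

The program is written in a small structured language with weakest preconditions. `Cmd.exec_comp`
turns a verified command into a machine run and converts each counted step into logarithmic cost. -/

/-! ### A language with expressions, local environments and bounded loops -/

namespace RAM

/-- Expressions over an environment of registers and the memory. -/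
inductive Ex where
  | var (i : ℕ) : Ex
  | cst (v : ℕ) : Ex
  | bin (o : Op) (a b : Ex) : Ex
  | ld (a : Ex) : Ex

namespace Ex

/-- The value of an expression. -/
def eval (ρ : List ℕ) (mem : ℕ → ℕ) : Ex → ℕ
  | var i => ρ.getD i 0
  | cst v => v
  | bin o a b => o.eval (a.eval ρ mem) (b.eval ρ mem)
  | ld a => mem (a.eval ρ mem)

/-- The number of nodes of an expression. -/
def sz : Ex → ℕ
  | var _ => 1
  | cst _ => 1
  | bin _ a b => a.sz + b.sz + 1
  | ld a => a.sz + 1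

/-- The variables of the expression are below `d`, and its constants are at most `V`. -/
def Wf (d V : ℕ) : Ex → Prop
  | var i => i < d
  | cst v => v ≤ V
  | bin _ a b => a.Wf d V ∧ b.Wf d V
  | ld a => a.Wf d V

/-- Code that computes the value of an expression into register `d`, using only registers from
`d` on as temporaries. -/
def comp (d : ℕ) : Ex → Prog
  | var i => .seq (.const d 0) (.op .add d d i)
  | cst v => .const d v
  | bin o a b => .seq (a.comp d) (.seq (b.comp (d + 1)) (.op o d d (d + 1)))
  | ld a => .seq (a.comp d) (.load d d)

theorem sz_pos (e : Ex) : 1 ≤ e.sz := by cases e <;> simp [sz]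

end Ex

theorem size_le_of_le_pow {x V s : ℕ} (h : x ≤ V ^ s) (hs : 1 ≤ s) : x.size ≤ s * V.size := by
  rw [Nat.size_le]
  calc x ≤ V ^ s := h
    _ < (2 ^ V.size) ^ s := Nat.pow_lt_pow_left (Nat.lt_size_self V) (by omega)
    _ = 2 ^ (s * V.size) := by rw [← pow_mul, Nat.mul_comm]

theorem add_le_pow_add {a b V s t : ℕ} (hV : 2 ≤ V) (hs : 1 ≤ s) (ht : 1 ≤ t) (ha : a ≤ V ^ s)
    (hb : b ≤ V ^ t) : a + b ≤ V ^ (s + t) := by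
  have h1 : V ≤ V ^ s := Nat.le_self_pow (by omega) V
  have h2 : V ≤ V ^ t := Nat.le_self_pow (by omega) V
  rw [pow_add]
  nlinarith

/-- The exponents add up like node counts, so an expression over numbers up to `V` has value at most
`V` to the number of its nodes, hence length linear in `V.size`. -/
theorem Op.eval_le_pow (o : Op) {a b V s t : ℕ} (hV : 2 ≤ V) (hs : 1 ≤ s) (ht : 1 ≤ t)
    (ha : a ≤ V ^ s) (hb : b ≤ V ^ t) : o.eval a b ≤ V ^ (s + t + 1) := by
  have h0 : V ^ (s + t) ≤ V ^ (s + t + 1) := Nat.pow_le_pow_right (by omega) (by omega)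
  have h1 : V ^ s ≤ V ^ (s + t) := Nat.pow_le_pow_right (by omega) (by omega)
  cases o
  · exact (add_le_pow_add hV hs ht ha hb).trans h0
  · exact ((Nat.sub_le a b).trans ha).trans (h1.trans h0)
  · refine le_trans ?_ h0
    rw [pow_add]
    exact Nat.mul_le_mul ha hb
  · exact ((Nat.div_le_self a b).trans ha).trans (h1.trans h0)

/-- The registers below the length of `ρ` hold the entries of `ρ`. -/
def State.Holds (s : State) (ρ : List ℕ) : Prop :=
  ∀ i < ρ.length, s.reg i = ρ.getD i 0

/-- Two states that differ at most in the registers from `d` on. -/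
structure State.Below (d : ℕ) (s s' : State) : Prop where
  reg : ∀ i < d, s'.reg i = s.reg i
  mem : s'.mem = s.mem
  drawn : s'.drawn = s.drawn

theorem State.Below.trans {d : ℕ} {s s' s'' : State} (h : State.Below d s s')
    (h' : State.Below d s' s'') : State.Below d s s'' :=
  ⟨fun i hi => (h'.reg i hi).trans (h.reg i hi), h'.mem.trans h.mem, h'.drawn.trans h.drawn⟩

theorem State.Below.mono {d e : ℕ} {s s' : State} (h : State.Below d s s') (he : e ≤ d) :
    State.Below e s s' :=
  ⟨fun i hi => h.reg i (hi.trans_le he), h.mem, h.drawn⟩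

theorem State.below_setReg (s : State) {d e : ℕ} (v : ℕ) (h : e ≤ d) :
    State.Below e s (s.setReg d v) :=
  ⟨fun i hi => by simp [State.setReg, Function.update_of_ne (show i ≠ d by omega)], rfl, rfl⟩

theorem State.Holds.below {s s' : State} {ρ : List ℕ} {d : ℕ} (h : s.Holds ρ)
    (hb : State.Below d s s') (hd : ρ.length ≤ d) : s'.Holds ρ :=
  fun i hi => (hb.reg i (hi.trans_le hd)).trans (h i hi)

/-- Correctness and cost of compiled expressions. The second operand is evaluated one register
higher, so the first survives. The cost is quadratic in the size of the expression: linearly many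
instructions, each on numbers of at most `e.sz * V.size` bits. -/
theorem Ex.exec_comp (coins : ℕ → Bool) {V : ℕ} (hV : 2 ≤ V) {ρ : List ℕ} (hρ : ∀ x ∈ ρ, x ≤ V) :
    ∀ (e : Ex) (d : ℕ) (s : State), ρ.length ≤ d → e.Wf ρ.length V → s.Holds ρ →
      (∀ a, s.mem a ≤ V) →
      e.eval ρ s.mem ≤ V ^ e.sz ∧ ∃ (t : ℕ) (s' : State), Exec coins (e.comp d) s t s' ∧
        t ≤ 8 * e.sz ^ 2 * (V.size + 1) ∧ s'.reg d = e.eval ρ s.mem ∧ State.Below d s s' := by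
  intro e
  induction e with
  | var i =>
    intro d s hd hw hs hm
    have hi : ρ.getD i 0 ≤ V := by
      rw [List.getD_eq_getElem _ _ hw]; exact hρ _ (List.getElem_mem _)
    refine ⟨by simpa [sz, eval] using hi, _, _, .seq (.const _ _ _) (.op _ _ _ _ _), ?_, ?_, ?_⟩
    · have hid : i ≠ d := by simp only [Wf] at hw; omega
      have h1 : (s.reg i).size ≤ V.size := Nat.size_le_size (by rw [hs i hw]; exact hi)
      simp [State.setReg, Function.update_of_ne hid, sz]
      omega
    · have hid : i ≠ d := by simp only [Wf] at hw; omega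
      simp only [State.setReg, Function.update_of_ne hid, Op.eval, Function.update_self, eval]
      rw [hs i hw]; simp
    · exact (s.below_setReg _ le_rfl).trans (State.below_setReg _ _ le_rfl)
  | cst v =>
    intro d s hd hw hs hm
    refine ⟨by simpa [sz, eval, Wf] using hw, _, _, .const _ _ _, ?_, by simp [State.setReg, eval],
      s.below_setReg _ le_rfl⟩
    have := Nat.size_le_size (show v ≤ V from hw)
    simp [sz]; omega
  | bin o a b iha ihb =>
    intro d s hd hw hs hm
    obtain ⟨va, ta, s1, e1, c1, r1, b1⟩ := iha d s hd hw.1 hs hm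
    obtain ⟨vb, tb, s2, e2, c2, r2, b2⟩ := ihb (d + 1) s1 (by omega) hw.2 (hs.below b1 hd)
      (by rw [b1.mem]; exact hm)
    rw [b1.mem] at vb r2
    have pa := a.sz_pos
    have pb := b.sz_pos
    have r1' : s2.reg d = a.eval ρ s.mem := by rw [b2.reg d (by omega), r1]
    refine ⟨o.eval_le_pow hV pa pb va vb, _, _, .seq e1 (.seq e2 (.op _ o d d (d + 1))), ?_, ?_, ?_⟩
    · rw [r1', r2]
      have h1 := size_le_of_le_pow va pa
      have h2 := size_le_of_le_pow vb pb
      simp only [sz]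
      nlinarith [Nat.zero_le (a.sz * b.sz * (V.size + 1)), Nat.zero_le (a.sz * (V.size + 1)),
        Nat.zero_le (b.sz * (V.size + 1))]
    · simp [State.setReg, r1', r2, eval]
    · exact b1.trans ((b2.mono (by omega)).trans (State.below_setReg _ _ le_rfl))
  | ld a iha =>
    intro d s hd hw hs hm
    obtain ⟨va, ta, s1, e1, c1, r1, b1⟩ := iha d s hd hw hs hm
    have pa := a.sz_pos
    -- A loaded value is at most `V` outright; only its address can be longer.
    refine ⟨(hm _).trans (Nat.le_self_pow (by simp [sz]) V), _, _, .seq e1 (.load _ d d), ?_, ?_,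
        ?_⟩
    · have h1 := size_le_of_le_pow va pa
      have h2 : (s.mem (a.eval ρ s.mem)).size ≤ V.size := Nat.size_le_size (hm _)
      rw [r1, b1.mem]
      simp only [sz]
      nlinarith [Nat.zero_le (a.sz * (V.size + 1))]
    · simp [State.setReg, r1, b1.mem, eval]
    · exact b1.trans (State.below_setReg _ _ le_rfl)

end RAM

/-! ### Commands with counted loops, their compilation and their preconditions -/

namespace RAM

/-- Commands over an environment of registers. The loop `rep e b` runs `b` as often as the value of
`e` says; in `b` the environment is extended by the number of the iterations still to come and by
the number of those completed. -/
inductive Cmd where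
  | skip : Cmd
  | set (i : ℕ) (e : Ex) : Cmd
  | put (a b : Ex) : Cmd
  | flip (i : ℕ) : Cmd
  | seq (p q : Cmd) : Cmd
  | ite (e : Ex) (p q : Cmd) : Cmd
  | rep (e : Ex) (b : Cmd) : Cmd

/-- An environment with the memory, the number of coins drawn and a step counter. -/
structure St where
  ρ : List ℕ
  mem : ℕ → ℕ
  dr : ℕ
  tm : ℕ

namespace Cmd

/-- Variables are in scope, constants are at most `V`, expressions have at most `W` nodes. -/
def Wf (V W : ℕ) : ℕ → Cmd → Prop
  | _, skip => True
  | d, set i e => i < d ∧ e.Wf d V ∧ e.sz ≤ W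
  | d, put a b => (a.Wf d V ∧ a.sz ≤ W) ∧ b.Wf d V ∧ b.sz ≤ W
  | d, flip i => i < d
  | d, seq p q => p.Wf V W d ∧ q.Wf V W d
  | d, ite e p q => (e.Wf d V ∧ e.sz ≤ W) ∧ p.Wf V W d ∧ q.Wf V W d
  | d, rep e b => (e.Wf d V ∧ e.sz ≤ W) ∧ b.Wf V W (d + 2)

/-- Compilation of a command in an environment of `d` registers. -/
def comp : ℕ → Cmd → Prog
  | _, skip => .skip
  | d, set i e => .seq (e.comp d) (.seq (.const i 0) (.op .add i i d))
  | d, put a b => .seq (a.comp d) (.seq (b.comp (d + 1)) (.store d (d + 1)))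
  | _, flip i => .coin i
  | d, seq p q => .seq (p.comp d) (q.comp d)
  | d, ite e p q => .seq (e.comp d) (.branch d (p.comp d) (q.comp d))
  | d, rep e b => .seq (e.comp d) (.seq (.const (d + 1) 0) (.loop d
      (.seq (.seq (.const (d + 2) 1) (.op .sub d d (d + 2)))
        (.seq (b.comp (d + 2))
          (.seq (.const (d + 2) 1) (.op .add (d + 1) (d + 1) (d + 2)))))))

/-- A sufficient condition for a command to end in a state with the property `Q`, with all values
assigned bounded by `V`. -/
def wp (coins : ℕ → Bool) (V : ℕ) : Cmd → (St → Prop) → St → Prop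
  | skip, Q, s => Q ⟨s.ρ, s.mem, s.dr, s.tm + 1⟩
  | set i e, Q, s => e.eval s.ρ s.mem ≤ V ∧
      Q ⟨s.ρ.set i (e.eval s.ρ s.mem), s.mem, s.dr, s.tm + 1⟩
  | put a b, Q, s => a.eval s.ρ s.mem ≤ V ∧ b.eval s.ρ s.mem ≤ V ∧
      Q ⟨s.ρ, Function.update s.mem (a.eval s.ρ s.mem) (b.eval s.ρ s.mem), s.dr, s.tm + 1⟩
  | flip i, Q, s => Q ⟨s.ρ.set i (coins s.dr).toNat, s.mem, s.dr + 1, s.tm + 1⟩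
  | seq p q, Q, s => p.wp coins V (q.wp coins V Q) s
  | ite e p q, Q, s =>
      (e.eval s.ρ s.mem ≠ 0 → p.wp coins V Q ⟨s.ρ, s.mem, s.dr, s.tm + 1⟩) ∧
      (e.eval s.ρ s.mem = 0 → q.wp coins V Q ⟨s.ρ, s.mem, s.dr, s.tm + 1⟩)
  | rep e b, Q, s => e.eval s.ρ s.mem ≤ V ∧ ∃ I : ℕ → St → Prop, I 0 s ∧
      (∀ t < e.eval s.ρ s.mem, ∀ s', I t s' →
        b.wp coins V (fun s'' => ∃ ρ', s''.ρ = ρ' ++ [e.eval s.ρ s.mem - 1 - t, t] ∧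
          I (t + 1) ⟨ρ', s''.mem, s''.dr, s''.tm + 1⟩)
          ⟨s'.ρ ++ [e.eval s.ρ s.mem - 1 - t, t], s'.mem, s'.dr, s'.tm⟩) ∧
      ∀ s', I (e.eval s.ρ s.mem) s' → Q ⟨s'.ρ, s'.mem, s'.dr, s'.tm + 1⟩

end Cmd

/-- All entries of the environment and all memory cells are at most `V`. -/
structure St.Bdd (V : ℕ) (st : St) : Prop where
  env : ∀ x ∈ st.ρ, x ≤ V
  mem : ∀ a, st.mem a ≤ V

/-- A machine state represents an environment. -/
structure State.Rep (s : State) (st : St) : Prop where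
  reg : s.Holds st.ρ
  mem : s.mem = st.mem
  dr : s.drawn = st.dr

theorem State.Rep.tm {s : State} {st : St} (h : s.Rep st) (t : ℕ) :
    s.Rep ⟨st.ρ, st.mem, st.dr, t⟩ := ⟨h.1, h.2, h.3⟩

theorem State.Rep.below {s s' : State} {st : St} {d : ℕ} (h : s.Rep st)
    (hb : State.Below d s s') (hd : st.ρ.length ≤ d) : s'.Rep st :=
  ⟨h.reg.below hb hd, hb.mem.trans h.mem, hb.drawn.trans h.dr⟩

theorem State.Holds.setReg {s : State} {ρ : List ℕ} (h : s.Holds ρ) (i v : ℕ) :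
    (s.setReg i v).Holds (ρ.set i v) := by
  intro j hj
  rw [List.length_set] at hj
  by_cases hij : j = i
  · subst hij
    simp [State.setReg, hj]
  · simp only [State.setReg, Function.update_of_ne hij]
    rw [h j hj]
    simp [List.getElem?_set_ne (Ne.symm hij)]

theorem mem_set_le {ρ : List ℕ} {V i v : ℕ} (h : ∀ x ∈ ρ, x ≤ V) (hv : v ≤ V) :
    ∀ x ∈ ρ.set i v, x ≤ V := by
  intro x hx
  rcases List.mem_or_eq_of_mem_set hx with h1 | h1
  · exact h x h1
  · exact h1 ▸ hv

theorem State.Holds.append_iff {s : State} {ρ : List ℕ} {a b : ℕ} :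
    s.Holds (ρ ++ [a, b]) ↔ s.Holds ρ ∧ s.reg ρ.length = a ∧ s.reg (ρ.length + 1) = b := by
  constructor
  · intro h
    refine ⟨fun i hi => ?_, ?_, ?_⟩
    · rw [h i (by simp; omega), List.getD_append _ _ _ _ hi]
    · rw [h _ (by simp), List.getD_append_right _ _ _ _ le_rfl]; simp
    · rw [h _ (by simp), List.getD_append_right _ _ _ _ (by omega)]; simp
  · rintro ⟨h, ha, hb⟩ i hi
    simp only [List.length_append, List.length_cons, List.length_nil] at hi
    rcases Nat.lt_trichotomy i ρ.length with h1 | h1 | h1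
    · rw [h i h1, List.getD_append _ _ _ _ h1]
    · subst h1
      rw [ha, List.getD_append_right _ _ _ _ le_rfl]; simp
    · obtain rfl : i = ρ.length + 1 := by omega
      rw [hb, List.getD_append_right _ _ _ _ (by omega)]; simp

/-- The time charged for one step of a command. -/
def stepCost (V W : ℕ) : ℕ := 20 * W ^ 2 * (V.size + 1)

theorem exprCost_le {V W z : ℕ} (h : z ≤ W) :
    8 * z ^ 2 * (V.size + 1) ≤ 8 * (W ^ 2 * (V.size + 1)) := by
  have : z ^ 2 ≤ W ^ 2 := Nat.pow_le_pow_left h 2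
  rw [← mul_assoc]
  gcongr

theorem size_add_one_le_cost {V W : ℕ} (hW : 1 ≤ W) : V.size + 1 ≤ W ^ 2 * (V.size + 1) :=
  Nat.le_mul_of_pos_left _ (by positivity)

theorem stepCost_eq (V W : ℕ) : stepCost V W = 20 * (W ^ 2 * (V.size + 1)) := by
  rw [stepCost, mul_assoc]

/-- Soundness of the compiler: whatever `wp` guarantees for a command holds for the machine run, and
each tick of the step counter pays for `stepCost V W` units of time. From here on only `wp` and
ticks have to be considered. -/
theorem Cmd.exec_comp (coins : ℕ → Bool) {V W : ℕ} (hV : 2 ≤ V) (hW : 1 ≤ W) :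
    ∀ (c : Cmd) (Q : St → Prop) (st : St) (s : State), c.Wf V W st.ρ.length → st.Bdd V →
      s.Rep st → c.wp coins V Q st →
      ∃ (t : ℕ) (s' : State) (st' : St), Exec coins (c.comp st.ρ.length) s t s' ∧ s'.Rep st' ∧
        st'.ρ.length = st.ρ.length ∧ st'.Bdd V ∧ Q st' ∧
        t + stepCost V W * st.tm ≤ stepCost V W * st'.tm := by
  have hc := size_add_one_le_cost (V := V) hW
  have hK := stepCost_eq V W
  intro c
  induction c with
  | skip =>
    intro Q st s _ hb hr hQ
    refine ⟨_, _, ⟨st.ρ, st.mem, st.dr, st.tm + 1⟩, .skip _, hr.tm _, rfl, ⟨hb.1, hb.2⟩, hQ, ?_⟩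
    simp only [mul_add_one]
    omega
  | set i e =>
    intro Q st s hw hb hr hQ
    obtain ⟨_, t1, s1, e1, c1, r1, b1⟩ := e.exec_comp coins hV hb.env st.ρ.length s le_rfl
      hw.2.1 hr.reg (by rw [hr.mem]; exact hb.mem)
    rw [hr.mem] at r1
    have hr1 := hr.below b1 le_rfl
    have hid : st.ρ.length ≠ i := by have := hw.1; omega
    have hcst : s1.reg st.ρ.length ≤ V := r1 ▸ hQ.1
    have hsz := Nat.size_le_size hcst
    refine ⟨_, _, _, .seq e1 (.seq (.const _ _ _) (.op _ _ _ _ _)), ?_, ?_, ?_, hQ.2, ?_⟩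
    · refine ⟨?_, hr1.mem, hr1.dr⟩
      have hv : Op.add.eval ((s1.setReg i 0).reg i) ((s1.setReg i 0).reg st.ρ.length) =
          e.eval st.ρ st.mem := by
        simp [State.setReg, Function.update_of_ne hid, r1, Op.eval]
      rw [hv]
      have := (hr1.reg.setReg i 0).setReg i (e.eval st.ρ st.mem)
      rwa [List.set_set] at this
    · simp
    · exact ⟨mem_set_le hb.env hQ.1, hb.mem⟩
    · have := exprCost_le (V := V) hw.2.2
      simp only [mul_add_one, State.setReg, Function.update_of_ne hid,
        Function.update_self, Nat.size_zero]
      omega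
  | put a b =>
    intro Q st s hw hb hr hQ
    obtain ⟨_, t1, s1, e1, c1, r1, b1⟩ := a.exec_comp coins hV hb.env st.ρ.length s le_rfl
      hw.1.1 hr.reg (by rw [hr.mem]; exact hb.mem)
    rw [hr.mem] at r1
    have hr1 := hr.below b1 le_rfl
    obtain ⟨_, t2, s2, e2, c2, r2, b2⟩ := b.exec_comp coins hV hb.env (st.ρ.length + 1) s1
      (by omega) hw.2.1 hr1.reg (by rw [hr1.mem]; exact hb.mem)
    rw [hr1.mem] at r2
    have hr2 := hr1.below b2 (by omega)
    have r1' : s2.reg st.ρ.length = a.eval st.ρ st.mem := by rw [b2.reg _ (by omega), r1]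
    refine ⟨_, _, _, .seq e1 (.seq e2 (.store _ _ _)), ?_, ?_, ?_, hQ.2.2, ?_⟩
    · exact ⟨hr2.reg, by simp only [State.setMem, r1', r2, hr2.mem], hr2.dr⟩
    · rfl
    · refine ⟨hb.env, fun x => ?_⟩
      by_cases hx : x = a.eval st.ρ st.mem
      · subst hx; simpa using hQ.2.1
      · simpa [Function.update_of_ne hx] using hb.mem x
    · have h1 := exprCost_le (V := V) hw.1.2
      have h2 := exprCost_le (V := V) hw.2.2
      have h3 := Nat.size_le_size hQ.1
      have h4 := Nat.size_le_size hQ.2.1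
      simp only [mul_add_one, r1', r2]
      omega
  | flip i =>
    intro Q st s hw hb hr hQ
    refine ⟨_, _, _, .coin _ _, ?_, ?_, ?_, hQ, ?_⟩
    · refine ⟨?_, hr.mem, by simp [hr.dr]⟩
      rw [hr.dr]
      exact hr.reg.setReg i _
    · simp
    · exact ⟨mem_set_le hb.env ((Bool.toNat_le _).trans (by omega)), hb.mem⟩
    · simp only [mul_add_one]; omega
  | seq p q ihp ihq =>
    intro Q st s hw hb hr hQ
    obtain ⟨t1, s1, st1, e1, r1, l1, b1, q1, c1⟩ := ihp _ st s hw.1 hb hr hQ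
    obtain ⟨t2, s2, st2, e2, r2, l2, b2, q2, c2⟩ := ihq _ st1 s1 (l1 ▸ hw.2) b1 r1 q1
    refine ⟨_, _, _, .seq e1 (l1 ▸ e2), r2, l2.trans l1, b2, q2, ?_⟩
    omega
  | ite e p q ihp ihq =>
    intro Q st s hw hb hr hQ
    obtain ⟨ve, t1, s1, e1, c1, r1, b1⟩ := e.exec_comp coins hV hb.env st.ρ.length s le_rfl
      hw.1.1 hr.reg (by rw [hr.mem]; exact hb.mem)
    have hsz := size_le_of_le_pow ve e.sz_pos
    rw [← r1] at hsz
    rw [hr.mem] at r1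
    have hr1 := (hr.below b1 le_rfl).tm (st.tm + 1)
    have hcost := exprCost_le (V := V) hw.1.2
    -- The tested value is not required to be at most `V`, so the test itself is charged by the
    -- length that its expression allows.
    have hzw : e.sz * V.size ≤ W ^ 2 * (V.size + 1) :=
      Nat.mul_le_mul (hw.1.2.trans (Nat.le_self_pow (by norm_num) W)) (Nat.le_succ _)
    by_cases h0 : e.eval st.ρ st.mem = 0
    · obtain ⟨t2, s2, st2, e2, r2, l2, b2, q2, c2⟩ :=
        ihq Q ⟨st.ρ, st.mem, st.dr, st.tm + 1⟩ s1 hw.2.2 ⟨hb.1, hb.2⟩ hr1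
        (hQ.2 h0)
      refine ⟨_, _, _, .seq e1 (.branch_false (by rw [r1, h0]) e2), r2, l2, b2, q2, ?_⟩
      simp only [mul_add_one] at c2 ⊢
      omega
    · obtain ⟨t2, s2, st2, e2, r2, l2, b2, q2, c2⟩ :=
        ihp Q ⟨st.ρ, st.mem, st.dr, st.tm + 1⟩ s1 hw.2.1 ⟨hb.1, hb.2⟩ hr1
        (hQ.1 h0)
      refine ⟨_, _, _, .seq e1 (.branch_true (by rwa [r1]) e2), r2, l2, b2, q2, ?_⟩
      simp only [mul_add_one] at c2 ⊢
      omega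
  | rep e b ih =>
    intro Q st s hw hb hr hQ
    obtain ⟨_, t1, s1, e1, c1, r1, b1⟩ := e.exec_comp coins hV hb.env st.ρ.length s le_rfl
      hw.1.1 hr.reg (by rw [hr.mem]; exact hb.mem)
    rw [hr.mem] at r1
    obtain ⟨hN, I, hI0, hI1, hI2⟩ := hQ
    have hcost := exprCost_le (V := V) hw.1.2
    generalize hNe : e.eval st.ρ st.mem = N at *
    set d := st.ρ.length with hd
    -- Induction on the number `r` of iterations still to come, which is the content of the counter
    -- register. The surplus `1` is the failed test at the end; the tick of the `rep` itself absorbs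
    -- it.
    have key : ∀ (r t : ℕ), r + t = N → ∀ (st' : St) (s' : State), st'.ρ.length = d → st'.Bdd V →
        s'.Rep st' → s'.reg d = r → s'.reg (d + 1) = t → I t st' →
        ∃ (tt : ℕ) (s'' : State) (st'' : St), Exec coins (.loop d
          (.seq (.seq (.const (d + 2) 1) (.op .sub d d (d + 2)))
            (.seq (b.comp (d + 2))
              (.seq (.const (d + 2) 1) (.op .add (d + 1) (d + 1) (d + 2)))))) s' tt s'' ∧
          s''.Rep st'' ∧ st''.ρ.length = d ∧ st''.Bdd V ∧ I N st'' ∧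
          tt + stepCost V W * st'.tm ≤ stepCost V W * st''.tm + 1 := by
      intro r
      induction r with
      | zero =>
        intro t ht st' s' hl hb' hr' hrem hidx hI
        obtain rfl : t = N := by omega
        refine ⟨_, _, _, .loop_false hrem, hr', hl, hb', hI, ?_⟩
        rw [hrem, Nat.size_zero]
        omega
      | succ r ihr =>
        intro t ht st' s' hl hb' hr' hrem hidx hI
        have hm1 : (s'.reg d).size ≤ V.size := Nat.size_le_size (by omega)
        have hlt : t < N := by omega
        -- The counter is lowered before the body runs, so the body sees `N - 1 - t`.
        set s2 := (s'.setReg (d + 2) 1).setReg d r with hs2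
        have ex2 : Exec coins (.seq (.const (d + 2) 1) (.op .sub d d (d + 2))) s'
            (1 + Nat.size 1 + (1 + (s'.reg d).size + Nat.size 1)) s2 := by
          have h := Exec.seq (coins := coins) (.const s' (d + 2) 1)
            (.op (s'.setReg (d + 2) 1) .sub d d (d + 2))
          simpa [State.setReg, hrem, Op.eval, hs2] using h
        have hr2 : s2.Rep ⟨st'.ρ ++ [N - 1 - t, t], st'.mem, st'.dr, st'.tm⟩ := by
          refine ⟨State.Holds.append_iff.2 ⟨?_, ?_, ?_⟩, hr'.mem, hr'.dr⟩
          · intro i hi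
            have hi' : i < d := by rw [← hl]; exact hi
            simp only [hs2, State.setReg]
            rw [Function.update_of_ne (by omega), Function.update_of_ne (by omega)]
            exact hr'.reg i hi
          · simp only [hl, hs2, State.setReg, Function.update_self]
            omega
          · simp only [hl, hs2, State.setReg]
            rw [Function.update_of_ne (by omega), Function.update_of_ne (by omega)]
            exact hidx
        have hb2 : St.Bdd V ⟨st'.ρ ++ [N - 1 - t, t], st'.mem, st'.dr, st'.tm⟩ := by
          refine ⟨fun x hx => ?_, hb'.mem⟩
          simp only [List.mem_append, List.mem_cons, List.not_mem_nil, or_false] at hx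
          rcases hx with hx | hx | hx
          · exact hb'.env x hx
          · omega
          · omega
        have hl2 : (st'.ρ ++ [N - 1 - t, t]).length = d + 2 := by simp [hl]
        obtain ⟨t3, s3, st3, e3, r3, l3, b3, q3, c3⟩ := ih _ ⟨st'.ρ ++ [N - 1 - t, t], st'.mem,
          st'.dr, st'.tm⟩ s2 (by simp only [hl2]; exact hw.2) hb2 hr2 (hI1 t hlt st' hI)
        simp only [hl2] at e3 l3
        -- The postcondition of the body demands that both loop registers are left as they were
        -- found.
        obtain ⟨ρ', hρ', hI'⟩ := q3
        have hl' : ρ'.length = d := by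
          have := congrArg List.length hρ'
          simp [l3] at this
          omega
        have r3' := r3.reg
        rw [hρ', State.Holds.append_iff, hl'] at r3'
        obtain ⟨r3a, r3b, r3c⟩ := r3'
        have ex4 : Exec coins (.seq (.const (d + 2) 1) (.op .add (d + 1) (d + 1) (d + 2))) s3
            (1 + Nat.size 1 + (1 + (s3.reg (d + 1)).size + Nat.size 1))
            ((s3.setReg (d + 2) 1).setReg (d + 1) (t + 1)) := by
          have h := Exec.seq (coins := coins) (.const s3 (d + 2) 1)
            (.op (s3.setReg (d + 2) 1) .add (d + 1) (d + 1) (d + 2))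
          simpa [State.setReg, r3c, Op.eval] using h
        have hbel : State.Below d s3 ((s3.setReg (d + 2) 1).setReg (d + 1) (t + 1)) :=
          (s3.below_setReg _ (by omega)).trans (State.below_setReg _ _ (by omega))
        obtain ⟨t5, s5, st5, e5, r5, l5, b5, q5, c5⟩ := ihr (t + 1) (by omega)
          ⟨ρ', st3.mem, st3.dr, st3.tm + 1⟩
          ((s3.setReg (d + 2) 1).setReg (d + 1) (t + 1)) hl'
          ⟨fun x hx => b3.env x (by rw [hρ']; simp [hx]), b3.mem⟩
          ⟨r3a.below hbel hl'.le, r3.mem, r3.dr⟩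
          (by
            simp only [State.setReg]
            rw [Function.update_of_ne (by omega), Function.update_of_ne (by omega), r3b]
            omega)
          (by simp [State.setReg]) hI'
        have hm2 : (s3.reg (d + 1)).size ≤ V.size := Nat.size_le_size (by omega)
        refine ⟨_, s5, st5, .loop_true (by omega) (.seq ex2 (.seq e3 ex4)) e5, r5, l5, b5, q5, ?_⟩
        simp only [mul_add_one, Nat.size_one] at c3 c5 ⊢
        omega
    obtain ⟨t2, s2, st2, e2, r2, l2, b2, q2, c2⟩ := key N 0 (by omega) st (s1.setReg (d + 1) 0)
      hd.symm hb (hr.below (b1.trans (s1.below_setReg 0 (by omega))) le_rfl)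
      (by simp only [State.setReg]; rw [Function.update_of_ne (by omega), r1])
      (by simp [State.setReg]) hI0
    refine ⟨_, _, ⟨st2.ρ, st2.mem, st2.dr, st2.tm + 1⟩, .seq e1 (.seq (.const _ _ _) e2),
      r2.tm _, l2, ⟨b2.1, b2.2⟩, hI2 _ q2, ?_⟩
    simp only [mul_add_one, Nat.size_zero] at c2 ⊢
    omega

end RAM

/-! ### Exterior multiplication on arrays indexed by bit masks -/

namespace BitExterior

/-- Adding `2 ^ j` to a mask without the bit `j` causes no carry, so it inserts an element into a
set. -/
theorem testBit_add_two_pow {S j : ℕ} (h : S.testBit j = false) (i : ℕ) :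
    (S + 2 ^ j).testBit i = (S.testBit i || decide (i = j)) := by
  induction j generalizing S i with
  | zero =>
    have h0 : S % 2 = 0 := by simpa [Nat.testBit_zero] using h
    cases i with
    | zero => simp [Nat.testBit_zero]; omega
    | succ i =>
      rw [Nat.testBit_succ, Nat.testBit_succ, show (S + 2 ^ 0) / 2 = S / 2 by simp; omega]
      simp
  | succ j ih =>
    have h' : (S / 2).testBit j = false := by rwa [Nat.testBit_succ] at h
    cases i with
    | zero => simp [Nat.testBit_zero, pow_succ]
    | succ i =>
      rw [Nat.testBit_succ, Nat.testBit_succ, show (S + 2 ^ (j + 1)) / 2 = S / 2 + 2 ^ j by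
        rw [pow_succ]; omega, ih h' i]
      simp

theorem sub_add_two_pow {S j : ℕ} (h : S.testBit j = true) : S - 2 ^ j + 2 ^ j = S :=
  Nat.sub_add_cancel (Nat.ge_two_pow_of_testBit h)

theorem testBit_sub_two_pow_self {S j : ℕ} (h : S.testBit j = true) :
    (S - 2 ^ j).testBit j = false := by
  have h1 := Nat.testBit_two_pow_add_eq (S - 2 ^ j) j
  rw [add_comm, sub_add_two_pow h, h] at h1
  simpa using h1.symm

theorem testBit_sub_two_pow {S j : ℕ} (h : S.testBit j = true) {i : ℕ} (hi : i ≠ j) :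
    (S - 2 ^ j).testBit i = S.testBit i := by
  have h1 := testBit_add_two_pow (testBit_sub_two_pow_self h) i
  rw [sub_add_two_pow h] at h1
  simpa [hi] using h1.symm

theorem add_two_pow_lt {S j k : ℕ} (hS : S < 2 ^ k) (hj : j < k) (h : S.testBit j = false) :
    S + 2 ^ j < 2 ^ k := by
  refine Nat.lt_pow_two_of_testBit _ fun i hi => ?_
  rw [testBit_add_two_pow h, Nat.testBit_lt_two_pow (hS.trans_le (Nat.pow_le_pow_right two_pos hi))]
  simp; omega

variable {R : Type*} [CommRing R]

/-- The sign of the position of `j` in the bit mask `S`. -/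
def sgn (R : Type*) [CommRing R] (S j : ℕ) : R :=
  ∏ i ∈ Finset.range j, if S.testBit i then -1 else 1

/-- Exterior multiplication by the vector `ξ`. -/
def wedge (k : ℕ) (ξ f : ℕ → R) (S : ℕ) : R :=
  ∑ j ∈ Finset.range k, if S.testBit j then sgn R S j * ξ j * f (S - 2 ^ j) else 0

/-- The adjoint of exterior multiplication by the vector `ξ`. -/
def contract (k : ℕ) (ξ f : ℕ → R) (S : ℕ) : R :=
  ∑ j ∈ Finset.range k, if S.testBit j then 0 else sgn R S j * ξ j * f (S + 2 ^ j)

theorem sgn_sq (S j : ℕ) : sgn R S j * sgn R S j = 1 := by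
  rw [sgn, ← Finset.prod_mul_distrib]
  exact Finset.prod_eq_one fun i _ => by split <;> simp

theorem sgn_congr {S T j : ℕ} (h : ∀ i < j, S.testBit i = T.testBit i) :
    sgn R S j = sgn R T j :=
  Finset.prod_congr rfl fun i hi => by rw [h i (Finset.mem_range.1 hi)]

theorem sgn_sub_of_le {S i j : ℕ} (h : S.testBit j = true) (hij : i ≤ j) :
    sgn R (S - 2 ^ j) i = sgn R S i :=
  sgn_congr fun l hl => testBit_sub_two_pow h (by omega)

/-- Deleting the lower element `i` removes exactly one factor `-1`. Together with `sgn_sub_of_le`,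
where nothing changes, this asymmetry produces the anticommutativity. -/
theorem sgn_sub_of_lt {S i j : ℕ} (h : S.testBit i = true) (hij : i < j) :
    sgn R (S - 2 ^ i) j = - sgn R S j := by
  have hi : i ∈ Finset.range j := Finset.mem_range.2 hij
  rw [sgn, sgn, ← Finset.mul_prod_erase _ _ hi, ← Finset.mul_prod_erase _ _ hi, h,
    testBit_sub_two_pow_self h]
  have : ∀ l ∈ (Finset.range j).erase i, (if (S - 2 ^ i).testBit l then (-1 : R) else 1) =
      if S.testBit l then -1 else 1 := fun l hl => by
    rw [testBit_sub_two_pow h (Finset.ne_of_mem_erase hl)]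
  rw [Finset.prod_congr rfl this]
  simp

theorem wedge_add_left (k : ℕ) (ξ η f : ℕ → R) :
    wedge k (ξ + η) f = wedge k ξ f + wedge k η f := by
  ext S
  simp only [wedge, Pi.add_apply, ← Finset.sum_add_distrib]
  refine Finset.sum_congr rfl fun j _ => ?_
  split <;> ring

theorem wedge_smul_left (k : ℕ) (c : R) (ξ f : ℕ → R) : wedge k (c • ξ) f = c • wedge k ξ f := by
  ext S
  simp only [wedge, Pi.smul_apply, smul_eq_mul, Finset.mul_sum]
  refine Finset.sum_congr rfl fun j _ => ?_
  split <;> ring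

theorem wedge_add_right (k : ℕ) (ξ f g : ℕ → R) :
    wedge k ξ (f + g) = wedge k ξ f + wedge k ξ g := by
  ext S
  simp only [wedge, Pi.add_apply, ← Finset.sum_add_distrib]
  refine Finset.sum_congr rfl fun j _ => ?_
  split <;> ring

theorem wedge_smul_right (k : ℕ) (c : R) (ξ f : ℕ → R) : wedge k ξ (c • f) = c • wedge k ξ f := by
  ext S
  simp only [wedge, Pi.smul_apply, smul_eq_mul, Finset.mul_sum]
  refine Finset.sum_congr rfl fun j _ => ?_
  split <;> ring

theorem wedge_zero_right (k : ℕ) (ξ : ℕ → R) : wedge k ξ 0 = 0 := by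
  ext S; simp [wedge]

/-- In the double sum over the two deleted bits, the terms for `(j, i)` and `(i, j)` cancel:
deleting the lower bit first flips the sign of the upper one, the other order does not. A bit cannot
be deleted twice, so the diagonal is zero. -/
theorem wedge_self (k : ℕ) (ξ f : ℕ → R) : wedge k ξ (wedge k ξ f) = 0 := by
  ext S
  simp only [wedge, Pi.zero_apply]
  have h1 : ∀ j ∈ Finset.range k, (if S.testBit j then sgn R S j * ξ j *
      (∑ i ∈ Finset.range k, if (S - 2 ^ j).testBit i then
        sgn R (S - 2 ^ j) i * ξ i * f (S - 2 ^ j - 2 ^ i) else 0) else 0) =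
      ∑ i ∈ Finset.range k, if S.testBit j ∧ (S - 2 ^ j).testBit i then
        sgn R S j * ξ j * (sgn R (S - 2 ^ j) i * ξ i * f (S - 2 ^ j - 2 ^ i)) else 0 := by
    intro j _
    split
    · rename_i h
      rw [Finset.mul_sum]
      refine Finset.sum_congr rfl fun i _ => ?_
      simp [h]
    · rename_i h
      simp [h]
  rw [Finset.sum_congr rfl h1, ← Finset.sum_product']
  have key : ∀ i j : ℕ, i < j → S.testBit i = true → S.testBit j = true →
      sgn R S j * ξ j * (sgn R (S - 2 ^ j) i * ξ i * f (S - 2 ^ j - 2 ^ i)) +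
      sgn R S i * ξ i * (sgn R (S - 2 ^ i) j * ξ j * f (S - 2 ^ i - 2 ^ j)) = 0 := by
    intro i j hij hi hj
    rw [sgn_sub_of_le hj hij.le, sgn_sub_of_lt hi hij, Nat.sub_right_comm]
    ring
  have bits : ∀ i j : ℕ, (S.testBit j = true ∧ (S - 2 ^ j).testBit i = true) ↔
      i ≠ j ∧ S.testBit i = true ∧ S.testBit j = true := by
    intro i j
    constructor
    · rintro ⟨h1, h2⟩
      have hij : i ≠ j := by
        rintro rfl
        rw [testBit_sub_two_pow_self h1] at h2
        exact absurd h2 (by simp)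
      exact ⟨hij, by rwa [testBit_sub_two_pow h1 hij] at h2, h1⟩
    · rintro ⟨h1, h2, h3⟩
      exact ⟨h3, by rwa [testBit_sub_two_pow h3 h1]⟩
  refine Finset.sum_involution (fun p _ => (p.2, p.1)) ?_ ?_ ?_ ?_
  · rintro ⟨j, i⟩ _
    simp only [bits]
    by_cases hb : i ≠ j ∧ S.testBit i = true ∧ S.testBit j = true
    · rw [if_pos hb, if_pos ⟨hb.1.symm, hb.2.2, hb.2.1⟩]
      rcases Nat.lt_or_gt_of_ne hb.1 with h | h
      · exact key i j h hb.2.1 hb.2.2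
      · rw [add_comm]; exact key j i h hb.2.2 hb.2.1
    · rw [if_neg hb, if_neg (fun h => hb ⟨h.1.symm, h.2.2, h.2.1⟩), add_zero]
  · rintro ⟨j, i⟩ _ hne heq
    simp only [bits] at hne
    have hij : i = j := congrArg Prod.fst heq
    simp [hij] at hne
  · rintro ⟨j, i⟩ h
    simp only [Finset.mem_product] at h ⊢
    exact ⟨h.2, h.1⟩
  · rintro ⟨j, i⟩ _
    rfl

/-- Polarisation of `wedge_self` at `ξ + η`. -/
theorem wedge_anticomm (k : ℕ) (ξ η f : ℕ → R) :
    wedge k ξ (wedge k η f) = - wedge k η (wedge k ξ f) := by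
  have h := wedge_self k (ξ + η) f
  simp only [wedge_add_left, wedge_add_right, wedge_self] at h
  rw [zero_add, add_zero] at h
  exact eq_neg_of_add_eq_zero_left ((add_comm _ _).trans h)

/-- The exterior product of a list of vectors with `f`. -/
def wedges (k : ℕ) (f : ℕ → R) (l : List (ℕ → R)) : ℕ → R := l.foldr (wedge k) f

theorem wedge_wedges_of_mem (k : ℕ) (f : ℕ → R) (l : List (ℕ → R)) (ξ : ℕ → R) (h : ξ ∈ l) :
    wedge k ξ (wedges k f l) = 0 := by
  induction l with
  | nil => simp at h
  | cons η l ih =>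
    rw [wedges, List.foldr_cons]
    rcases List.mem_cons.1 h with rfl | h
    · exact wedge_self _ _ _
    · rw [wedge_anticomm]
      have := ih h
      rw [wedges] at this
      rw [this, wedge_zero_right, neg_zero]

/-- A repeated vector can be moved by anticommutation next to its equal, where the product dies. The
argument works over every commutative ring, so also modulo a composite number, which is what the
traceback needs. -/
theorem nodup_of_wedges_ne_zero {k : ℕ} {f : ℕ → R} {l : List (ℕ → R)} (h : wedges k f l ≠ 0) :
    l.Nodup := by
  induction l with
  | nil => exact List.nodup_nil
  | cons ξ l ih =>
    rw [wedges, List.foldr_cons] at h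
    refine List.nodup_cons.2 ⟨fun hm => h (wedge_wedges_of_mem k f l ξ hm), ih fun h0 => h ?_⟩
    rw [wedges] at h0
    rw [h0, wedge_zero_right]

/-- Deleting and inserting the bit `j` are inverse bijections between the masks with and without
`j`, and the sign of `j` sees only the lower bits. -/
theorem sum_mul_wedge (k : ℕ) (ξ φ f : ℕ → R) :
    ∑ S ∈ Finset.range (2 ^ k), φ S * wedge k ξ f S =
      ∑ S ∈ Finset.range (2 ^ k), contract k ξ φ S * f S := by
  simp only [wedge, contract, Finset.mul_sum, Finset.sum_mul]
  rw [Finset.sum_comm, Finset.sum_comm (s := Finset.range (2 ^ k))]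
  refine Finset.sum_congr rfl fun j hj => ?_
  rw [Finset.mem_range] at hj
  simp only [mul_ite, mul_zero, ite_mul, zero_mul]
  have hneg : ∀ S ∈ Finset.range (2 ^ k), (if S.testBit j = true then 0 else
      sgn R S j * ξ j * φ (S + 2 ^ j) * f S) = if ¬ S.testBit j = true then
      sgn R S j * ξ j * φ (S + 2 ^ j) * f S else 0 := fun S _ => by split <;> simp_all
  rw [Finset.sum_congr rfl hneg, ← Finset.sum_filter, ← Finset.sum_filter]
  refine Finset.sum_bij' (fun S _ => S - 2 ^ j) (fun S _ => S + 2 ^ j) ?_ ?_ ?_ ?_ ?_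
  · intro S hS
    simp only [Finset.mem_filter, Finset.mem_range] at hS ⊢
    exact ⟨(Nat.sub_le _ _).trans_lt hS.1, by simp [testBit_sub_two_pow_self hS.2]⟩
  · intro S hS
    simp only [Finset.mem_filter, Finset.mem_range, Bool.not_eq_true] at hS ⊢
    exact ⟨add_two_pow_lt hS.1 hj hS.2, by simp [testBit_add_two_pow hS.2]⟩
  · intro S hS
    simp only [Finset.mem_filter, Finset.mem_range] at hS
    exact sub_add_two_pow hS.2
  · intro S hS
    exact Nat.add_sub_cancel _ _
  · intro S hS
    simp only [Finset.mem_filter, Finset.mem_range] at hS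
    rw [sgn_sub_of_le hS.2 le_rfl, sub_add_two_pow hS.2]
    ring

/-! #### Nonvanishing for independent vectors -/

/-- The unit of the exterior algebra. -/
def one (R : Type*) [CommRing R] (S : ℕ) : R := if S = 0 then 1 else 0

/-- A vector indexed by `Fin k`, continued by zero. -/
def extend {k : ℕ} (v : Fin k → R) (j : ℕ) : R := if h : j < k then v ⟨j, h⟩ else 0

theorem extend_add {k : ℕ} (v w : Fin k → R) : extend (v + w) = extend v + extend w := by
  ext j; simp only [extend, Pi.add_apply]; split <;> simp

theorem extend_smul {k : ℕ} (c : R) (v : Fin k → R) : extend (c • v) = c • extend v := by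
  ext j; simp only [extend, Pi.smul_apply]; split <;> simp

theorem wedge_congr_left {k : ℕ} {ξ η : ℕ → R} (h : ∀ j < k, ξ j = η j) (f : ℕ → R) :
    wedge k ξ f = wedge k η f := by
  ext S
  exact Finset.sum_congr rfl fun j hj => by rw [h j (Finset.mem_range.1 hj)]

/-- The exterior product of a finite family of vectors. -/
def wedgeFin (k : ℕ) : (m : ℕ) → (Fin m → Fin k → R) → ℕ → R
  | 0, _ => one R
  | m + 1, v => wedge k (extend (v 0)) (wedgeFin k m (Fin.tail v))

theorem wedgeFin_eq_wedges (k m : ℕ) (v : Fin m → Fin k → R) :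
    wedgeFin k m v = wedges k (one R) (List.ofFn fun i => extend (v i)) := by
  induction m with
  | zero => simp [wedgeFin, wedges]
  | succ m ih => rw [wedgeFin, ih, List.ofFn_succ]; rfl

theorem wedgeFin_update_add (k m : ℕ) (v : Fin m → Fin k → R) (i : Fin m) (x y : Fin k → R) :
    wedgeFin k m (Function.update v i (x + y)) =
      wedgeFin k m (Function.update v i x) + wedgeFin k m (Function.update v i y) := by
  induction m with
  | zero => exact i.elim0
  | succ m ih =>
    refine Fin.cases ?_ (fun i => ?_) i
    · simp only [wedgeFin, Function.update_self, Fin.tail_update_zero, extend_add, wedge_add_left]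
    · simp only [wedgeFin, Fin.tail_update_succ, ih, wedge_add_right,
        Function.update_of_ne (Fin.succ_ne_zero i).symm]

theorem wedgeFin_update_smul (k m : ℕ) (v : Fin m → Fin k → R) (i : Fin m) (c : R)
    (x : Fin k → R) : wedgeFin k m (Function.update v i (c • x)) =
      c • wedgeFin k m (Function.update v i x) := by
  induction m with
  | zero => exact i.elim0
  | succ m ih =>
    refine Fin.cases ?_ (fun i => ?_) i
    · simp only [wedgeFin, Function.update_self, Fin.tail_update_zero, extend_smul,
        wedge_smul_left]
    · simp only [wedgeFin, Fin.tail_update_succ, ih, wedge_smul_right,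
        Function.update_of_ne (Fin.succ_ne_zero i).symm]

/-- The top coefficient of the exterior product of `k` vectors of length `k`. -/
def topCoeff (k : ℕ) : (Fin k → R) [⋀^Fin k]→ₗ[R] R where
  toFun v := wedgeFin k k v (2 ^ k - 1)
  map_update_add' v i x y := by
    classical
    have h := congrFun (wedgeFin_update_add k k v i x y) (2 ^ k - 1)
    rw [Pi.add_apply] at h
    convert h
  map_update_smul' v i c x := by
    classical
    have h := congrFun (wedgeFin_update_smul k k v i c x) (2 ^ k - 1)
    rw [Pi.smul_apply] at h
    convert h
  map_eq_zero_of_eq' v i j hij hne := by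
    by_contra h
    have h0 : wedges k (one R) (List.ofFn fun i => extend (v i)) ≠ 0 := by
      intro h1
      apply h
      rw [wedgeFin_eq_wedges, h1]
      rfl
    have := List.nodup_ofFn.1 (nodup_of_wedges_ne_zero h0)
    exact hne (this (by simp only [hij]))

theorem wedge_single (k j : ℕ) (hj : j < k) (f : ℕ → R) (S : ℕ) :
    wedge k (fun i => if i = j then 1 else 0) f S =
      if S.testBit j then sgn R S j * f (S - 2 ^ j) else 0 := by
  rw [wedge, Finset.sum_eq_single j]
  · simp
  · intro i _ hi
    simp [hi]
  · intro h
    exact absurd (Finset.mem_range.2 hj) h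

theorem testBit_two_pow_mul_ones (k i j : ℕ) :
    (2 ^ i * (2 ^ k - 1)).testBit j = (decide (i ≤ j) && decide (j - i < k)) := by
  rw [Nat.testBit_two_pow_mul, Nat.testBit_two_pow_sub_one]

/-- The mask consists of the bits `i, …, i + m - 1`. Basis vectors are split off from the lowest bit
upwards, so no set bit lies below the deleted one and every sign is `1`. -/
theorem wedges_basis (k m i : ℕ) (h : i + m = k) :
    wedges k (one R) ((List.range' i m).map fun j l => if l = j then 1 else 0)
      (2 ^ i * (2 ^ m - 1)) = 1 := by
  induction m generalizing i with
  | zero => simp [wedges, one]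
  | succ m ih =>
    rw [List.range'_succ, List.map_cons, wedges, List.foldr_cons, wedge_single _ _ (by omega),
      testBit_two_pow_mul_ones]
    have h1 : sgn R (2 ^ i * (2 ^ (m + 1) - 1)) i = 1 := by
      refine Finset.prod_eq_one fun l hl => ?_
      rw [testBit_two_pow_mul_ones]
      simp [Finset.mem_range.1 hl]
    have h2 : 2 ^ i * (2 ^ (m + 1) - 1) - 2 ^ i = 2 ^ (i + 1) * (2 ^ m - 1) := by
      have := Nat.one_le_two_pow (n := m)
      zify [Nat.one_le_two_pow (n := m), Nat.one_le_two_pow (n := m + 1)]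
      rw [Nat.cast_sub (Nat.le_mul_of_pos_right _ (by
        have := Nat.one_lt_two_pow (n := m + 1) (by omega); omega))]
      push_cast [Nat.one_le_two_pow (n := m + 1)]
      ring
    rw [h1, h2]
    simpa [wedges] using ih (i + 1) (by omega)

/-- The vector of the powers of a natural number. -/
def powers (R : Type*) [CommRing R] (u j : ℕ) : R := (u : R) ^ j

theorem topCoeff_basis (k : ℕ) : topCoeff k (Pi.basisFun R (Fin k)) = 1 := by
  change wedgeFin k k _ _ = 1
  rw [wedgeFin_eq_wedges]
  have h := wedges_basis (R := R) k k 0 (by simp)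
  rw [pow_zero, one_mul] at h
  rw [← h]
  congr 2
  apply List.ext_getElem
  · simp
  · intro i h1 h2
    simp only [List.length_ofFn] at h1
    ext l
    simp only [List.getElem_ofFn, List.getElem_map, List.getElem_range', extend,
      Pi.basisFun_apply, Pi.single_apply, Fin.ext_iff]
    split
    · simp
    · rw [if_neg (by omega)]

/-- The top coefficient is an alternating form with value `1` on the standard basis, so it is the
determinant. On vectors of powers this is a Vandermonde determinant, nonzero over `ℤ` for distinct
numbers. -/
theorem wedges_powers_ne_zero {k : ℕ} {l : List ℕ} (hl : l.length = k) (hn : l.Nodup) :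
    wedges k (one ℤ) (l.map (powers ℤ)) (2 ^ k - 1) ≠ 0 := by
  subst hl
  set v : Fin l.length → Fin l.length → ℤ := fun i j => (l[i] : ℤ) ^ (j : ℕ) with hv
  have h1 : wedges l.length (one ℤ) (l.map (powers ℤ)) (2 ^ l.length - 1) =
      topCoeff l.length v := by
    change _ = wedgeFin _ _ _ _
    rw [wedgeFin_eq_wedges]
    -- The list is varied while the dimension stays `l.length`; otherwise the induction would change
    -- both.
    have : ∀ (l' : List ℕ), wedges l.length (one ℤ) (l'.map (powers ℤ)) =
        wedges l.length (one ℤ) (List.ofFn fun i : Fin l'.length => extend (k := l.length)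
          fun j => (l'[i] : ℤ) ^ (j : ℕ)) := by
      intro l'
      induction l' with
      | nil => simp [wedges]
      | cons a l' ih =>
        simp only [List.length_cons, List.ofFn_succ, List.map_cons, wedges, List.foldr_cons]
        simp only [wedges] at ih
        rw [ih]
        refine wedge_congr_left (fun j hj => ?_) _
        simp [extend, hj, powers]
    rw [this l]
  have h2 : (Matrix.vandermonde fun i : Fin l.length => (l[i] : ℤ)).det ≠ 0 :=
    Matrix.det_vandermonde_ne_zero_iff.2 fun i j hij =>
      Fin.ext (hn.getElem_inj_iff.1 (Int.ofNat_inj.1 hij))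
  rw [h1, AlternatingMap.eq_smul_basis_det (Pi.basisFun ℤ (Fin l.length)) (topCoeff l.length),
    topCoeff_basis, one_smul, Pi.basisFun_det]
  exact h2

end BitExterior

/-! ### The weighted walk sum in the exterior algebra -/

namespace BitExterior

variable {R : Type*} [CommRing R]

/-- The sum over all walks with `i` edges of weight `β` from `v`, where `A v u` is one plus the
weight of the edge from `v` to `u` and zero if there is no such edge. -/
def walkSum (n k : ℕ) (A : ℕ → ℕ → ℕ) (Y : ℕ → R) : ℕ → ℕ → ℕ → ℕ → R
  | 0, _, β, S => if β = 0 then one R S else 0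
  | i + 1, v, β, S => ∑ u ∈ Finset.range n, if A v u ≠ 0 ∧ A v u ≤ β + 1 then
      Y ((i * (n + 1) + v) * n + u) *
        wedge k (powers R u) (walkSum n k A Y i u (β + 1 - A v u)) S else 0

/-- The list `p` continues `v` to a walk of weight `β`. -/
def IsWalk (A : ℕ → ℕ → ℕ) : ℕ → List ℕ → ℕ → Prop
  | _, [], β => β = 0
  | v, u :: p, β => A v u ≠ 0 ∧ A v u ≤ β + 1 ∧ IsWalk A u p (β + 1 - A v u)

theorem map_sgn {R' : Type*} [CommRing R'] (f : R →+* R') (S j : ℕ) :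
    f (sgn R S j) = sgn R' S j := by
  simp only [sgn, map_prod]
  refine Finset.prod_congr rfl fun i _ => ?_
  split <;> simp

theorem map_wedge {R' : Type*} [CommRing R'] (f : R →+* R') (k : ℕ) (ξ g : ℕ → R) (S : ℕ) :
    f (wedge k ξ g S) = wedge k (f ∘ ξ) (f ∘ g) S := by
  simp only [wedge, map_sum]
  refine Finset.sum_congr rfl fun j _ => ?_
  split <;> simp [map_sgn]

/-- The sum is needed over three rings: over polynomials for Schwartz–Zippel, over `ℤ` for the size
bound, and over residues for the computation. Ring homomorphisms connect them. -/
theorem map_walkSum {R' : Type*} [CommRing R'] (f : R →+* R') (n k : ℕ) (A : ℕ → ℕ → ℕ)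
    (Y : ℕ → R) (i v β S : ℕ) :
    f (walkSum n k A Y i v β S) = walkSum n k A (f ∘ Y) i v β S := by
  induction i generalizing v β S with
  | zero => simp only [walkSum, one]; split <;> simp
  | succ i ih =>
    simp only [walkSum, map_sum]
    refine Finset.sum_congr rfl fun u _ => ?_
    split
    · rw [map_mul, map_wedge]
      congr 2
      · ext j; simp [powers]
      · ext T; exact ih _ _ _
    · simp

theorem walkSum_congr {n k : ℕ} {A : ℕ → ℕ → ℕ} {Y Y' : ℕ → R} (i : ℕ)
    (h : ∀ e < i * ((n + 1) * n), Y e = Y' e) (v β : ℕ) (hv : v ≤ n) :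
    walkSum n k A Y i v β = walkSum n k A Y' i v β := by
  induction i generalizing v β with
  | zero => rfl
  | succ i ih =>
    ext S
    simp only [walkSum]
    refine Finset.sum_congr rfl fun u hu => ?_
    rw [Finset.mem_range] at hu
    rw [ih (fun e he => h e (by rw [add_mul]; omega)) u _ hu.le, h]
    calc (i * (n + 1) + v) * n + u < (i * (n + 1) + v) * n + n := by omega
      _ = (i * (n + 1) + v + 1) * n := by ring
      _ ≤ (i * (n + 1) + n + 1) * n := Nat.mul_le_mul_right _ (by omega)
      _ = (i + 1) * ((n + 1) * n) := by ring

theorem index_mod {n i v u : ℕ} (hu : u < n) : ((i * (n + 1) + v) * n + u) % n = u := by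
  rw [mul_comm, Nat.mul_add_mod, Nat.mod_eq_of_lt hu]

theorem index_div {n i v u : ℕ} (hu : u < n) (hv : v ≤ n) :
    ((i * (n + 1) + v) * n + u) / n / (n + 1) = i := by
  have hn : 0 < n := by omega
  rw [mul_comm, Nat.mul_add_div hn, Nat.div_eq_of_lt hu, add_zero, mul_comm,
    Nat.mul_add_div (by omega), Nat.div_eq_of_lt (by omega), add_zero]

/-- The indicator of the levels and heads of the edges of a walk. -/
def walkIndicator (R : Type*) [CommRing R] (n : ℕ) (p : List ℕ) (e : ℕ) : R :=
  if p.reverse[e / n / (n + 1)]? = some (e % n) then 1 else 0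

/-- With labels `1` exactly where the head is the vertex that `p` has at that level, only the walk
`p` survives. The tail needs no test, since it is the head of the level before. Levels count from
the end of the walk, so the induction runs over suffixes `q` of `p`. -/
theorem walkSum_walkIndicator {n k : ℕ} {A : ℕ → ℕ → ℕ} (p : List ℕ) (hp : ∀ x ∈ p, x < n)
    (q r : List ℕ) (hpq : p = r ++ q) (v β : ℕ) (hv : v ≤ n) (hq : IsWalk A v q β) :
    walkSum n k A (walkIndicator R n p) q.length v β =
      wedges k (one R) (q.map (powers R)) := by
  induction q generalizing r v β with
  | nil =>
    simp only [IsWalk] at hq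
    ext S
    simp [walkSum, hq, wedges]
  | cons u q ih =>
    have hu : u < n := hp u (by simp [hpq])
    ext S
    simp only [List.length_cons, walkSum]
    have hY : ∀ u' < n, walkIndicator R n p ((q.length * (n + 1) + v) * n + u') =
        if u' = u then 1 else 0 := by
      intro u' hu'
      rw [walkIndicator, index_mod hu', index_div hu' hv, hpq]
      simp only [List.reverse_append, List.reverse_cons, List.append_assoc]
      rw [List.getElem?_append_right (by simp)]
      simp [eq_comm]
    rw [Finset.sum_eq_single u]
    · rw [if_pos ⟨hq.1, hq.2.1⟩, hY u hu, if_pos rfl, one_mul,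
        ih (r ++ [u]) (by simp [hpq]) u _ hu.le hq.2.2]
      rfl
    · intro u' hu' hne
      rw [hY u' (Finset.mem_range.1 hu'), if_neg hne]
      simp
    · intro h
      exact absurd (Finset.mem_range.2 hu) h

theorem abs_sgn (S j : ℕ) : |sgn ℤ S j| = 1 := by
  have h := sgn_sq (R := ℤ) S j
  rcases mul_self_eq_one_iff.1 h with h | h <;> simp [h]

theorem abs_wedge_le {n k u : ℕ} (hu : u < n) {f : ℕ → ℤ} {b : ℤ} (hb : 0 ≤ b)
    (hf : ∀ S, |f S| ≤ b) (S : ℕ) : |wedge k (powers ℤ u) f S| ≤ k * (n : ℤ) ^ k * b := by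
  have h1 : ∀ j ∈ Finset.range k, |if S.testBit j then sgn ℤ S j * powers ℤ u j * f (S - 2 ^ j)
      else 0| ≤ (n : ℤ) ^ k * b := by
    intro j hj
    split
    · rw [abs_mul, abs_mul, abs_sgn, one_mul]
      refine mul_le_mul ?_ (hf _) (abs_nonneg _) (by positivity)
      rw [powers, abs_of_nonneg (by positivity)]
      calc (u : ℤ) ^ j ≤ (n : ℤ) ^ j := pow_le_pow_left₀ (by positivity) (by exact_mod_cast hu.le) j
        _ ≤ (n : ℤ) ^ k := pow_le_pow_right₀ (by exact_mod_cast (by omega : 1 ≤ n))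
          (Finset.mem_range.1 hj).le
    · simp; positivity
  calc |wedge k (powers ℤ u) f S| ≤ ∑ j ∈ Finset.range k, |_| := Finset.abs_sum_le_sum_abs _ _
    _ ≤ ∑ j ∈ Finset.range k, (n : ℤ) ^ k * b := Finset.sum_le_sum h1
    _ = k * (n : ℤ) ^ k * b := by simp [mul_assoc]

/-- Each level costs a factor `n` for the heads, `y` for the label, and `k * n ^ k` for the exterior
multiplication. -/
theorem abs_walkSum_le {n k : ℕ} {A : ℕ → ℕ → ℕ} {Y : ℕ → ℤ} {y : ℤ} (hy : 0 ≤ y)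
    (hY : ∀ e, |Y e| ≤ y) (i v β S : ℕ) :
    |walkSum n k A Y i v β S| ≤ (n * y * (k * (n : ℤ) ^ k)) ^ i := by
  induction i generalizing v β S with
  | zero => simp only [walkSum, one, pow_zero]; split <;> [split; skip] <;> simp
  | succ i ih =>
    set Z := (n * y * (k * (n : ℤ) ^ k)) with hZ
    have hZ0 : 0 ≤ Z := by positivity
    have h1 : ∀ u ∈ Finset.range n, |if A v u ≠ 0 ∧ A v u ≤ β + 1 then
        Y ((i * (n + 1) + v) * n + u) *
        wedge k (powers ℤ u) (walkSum n k A Y i u (β + 1 - A v u)) S else 0| ≤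
        y * (k * (n : ℤ) ^ k * Z ^ i) := by
      intro u hu
      split
      · rw [abs_mul]
        exact mul_le_mul (hY _) (abs_wedge_le (Finset.mem_range.1 hu) (by positivity)
          (fun T => ih _ _ _) S) (abs_nonneg _) hy
      · simp only [abs_zero]; positivity
    calc |walkSum n k A Y (i + 1) v β S| ≤ ∑ u ∈ Finset.range n, |_| :=
          Finset.abs_sum_le_sum_abs _ _
      _ ≤ ∑ u ∈ Finset.range n, y * (k * (n : ℤ) ^ k * Z ^ i) := Finset.sum_le_sum h1
      _ = Z ^ (i + 1) := by
        rw [Finset.sum_const, Finset.card_range, nsmul_eq_mul, pow_succ, hZ]; ring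

theorem totalDegree_wedge_le {σ : Type*} (k u d : ℕ) (f : ℕ → MvPolynomial σ ℤ)
    (hf : ∀ S, (f S).totalDegree ≤ d) (S : ℕ) :
    (wedge k (powers (MvPolynomial σ ℤ) u) f S).totalDegree ≤ d := by
  refine MvPolynomial.totalDegree_finsetSum_le fun j _ => ?_
  split
  · have hs : sgn (MvPolynomial σ ℤ) S j = MvPolynomial.C (sgn ℤ S j) :=
      (map_sgn (MvPolynomial.C (σ := σ)) S j).symm
    have hp : powers (MvPolynomial σ ℤ) u j = MvPolynomial.C ((u : ℤ) ^ j) := by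
      simp [powers]
    rw [hs, hp, ← map_mul]
    refine (MvPolynomial.totalDegree_mul _ _).trans ?_
    rw [MvPolynomial.totalDegree_C, zero_add]
    exact hf _
  · simp

/-- The vectors and signs are constants, so each level raises the degree by the one label only. -/
theorem totalDegree_walkSum_le {σ : Type*} (n k : ℕ) (A : ℕ → ℕ → ℕ)
    (Y : ℕ → MvPolynomial σ ℤ) (hY : ∀ e, (Y e).totalDegree ≤ 1) (i v β S : ℕ) :
    (walkSum n k A Y i v β S).totalDegree ≤ i := by
  induction i generalizing v β S with
  | zero => simp only [walkSum, one]; split <;> [split; skip] <;> simp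
  | succ i ih =>
    refine MvPolynomial.totalDegree_finsetSum_le fun u _ => ?_
    split
    · refine (MvPolynomial.totalDegree_mul _ _).trans ?_
      rw [add_comm]
      exact add_le_add (totalDegree_wedge_le k u i _ (fun T => ih _ _ _) S) (hY _)
    · simp

/-- The variables of the walk polynomial. -/
noncomputable def walkVar (N e : ℕ) : MvPolynomial (Fin N) ℤ :=
  if h : e < N then MvPolynomial.X ⟨e, h⟩ else 0

theorem totalDegree_walkVar_le (N e : ℕ) : (walkVar N e).totalDegree ≤ 1 := by
  rw [walkVar]; split
  · exact (MvPolynomial.totalDegree_X _).le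
  · simp

theorem eval_walkSum {n k i v β S N : ℕ} {A : ℕ → ℕ → ℕ} (hv : v ≤ n)
    (hN : i * ((n + 1) * n) ≤ N) (Y : ℕ → ℤ) :
    MvPolynomial.eval (fun e : Fin N => Y e) (walkSum n k A (walkVar N) i v β S) =
      walkSum n k A Y i v β S := by
  rw [map_walkSum]
  refine congrFun (walkSum_congr i (fun e he => ?_) v β hv) S
  simp [walkVar, he.trans_le hN]

/-- Evaluated at the indicator of the path, the polynomial becomes the Vandermonde determinant of
the path. No cancellation between different paths has to be considered. -/
theorem walkSum_walkVar_ne_zero {n k β N : ℕ} {A : ℕ → ℕ → ℕ} {p : List ℕ} (hl : p.length = k)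
    (hn : p.Nodup) (hp : ∀ x ∈ p, x < n) (hN : k * ((n + 1) * n) ≤ N) {v : ℕ} (hv : v ≤ n)
    (hw : IsWalk A v p β) : walkSum n k A (walkVar N) k v β (2 ^ k - 1) ≠ 0 := by
  intro h0
  have h1 := eval_walkSum (k := k) (β := β) (S := 2 ^ k - 1) (A := A) hv hN (walkIndicator ℤ n p)
  rw [h0, map_zero] at h1
  have h2 := walkSum_walkIndicator (R := ℤ) (k := k) p hp p [] rfl v β hv hw
  rw [hl] at h2
  rw [h2] at h1
  exact wedges_powers_ne_zero hl hn h1.symm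

/-! #### Tracing back a nonzero coefficient -/

/-- The pairing of two arrays indexed by bit masks. -/
def pair (k : ℕ) (φ f : ℕ → R) : R := ∑ S ∈ Finset.range (2 ^ k), φ S * f S

theorem pair_wedge (k : ℕ) (ξ φ f : ℕ → R) : pair k φ (wedge k ξ f) = pair k (contract k ξ φ) f :=
  sum_mul_wedge k ξ φ f

/-- The functional that takes the top coefficient. -/
def top (R : Type*) [CommRing R] (k S : ℕ) : R := if S = 2 ^ k - 1 then 1 else 0

theorem pair_top (k : ℕ) (f : ℕ → R) : pair k (top R k) f = f (2 ^ k - 1) := by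
  have := Nat.two_pow_pos k
  rw [pair, Finset.sum_eq_single (2 ^ k - 1)]
  · simp [top]
  · intro S _ hS; simp [top, hS]
  · intro h; exact absurd (Finset.mem_range.2 (by omega)) h

/-- The functional left after a list of vertices has been chosen. -/
def residual (R : Type*) [CommRing R] (k : ℕ) (l : List ℕ) : ℕ → R :=
  l.foldl (fun φ u => contract k (powers R u) φ) (top R k)

theorem residual_append (k : ℕ) (l : List ℕ) (u : ℕ) :
    residual R k (l ++ [u]) = contract k (powers R u) (residual R k l) := by
  simp [residual]

/-- Adjointness, applied once for each vertex of the list: contracting the functional replaces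
multiplying the array. -/
theorem pair_residual (k : ℕ) (l : List ℕ) (f : ℕ → R) :
    pair k (residual R k l) f = wedges k f (l.map (powers R)) (2 ^ k - 1) := by
  rw [← pair_top k (wedges k f (l.map (powers R))), residual]
  generalize top R k = φ
  induction l generalizing φ with
  | nil => rfl
  | cons u l ih =>
    rw [List.foldl_cons, ih, ← pair_wedge]
    rfl

/-- A nonzero sum has a nonzero summand, and the label is a scalar factor that can be dropped. This
is one step of the traceback; it needs no assumption on the labels. -/
theorem exists_of_pair_walkSum_ne_zero {n k i v β : ℕ} {A : ℕ → ℕ → ℕ} {Y φ : ℕ → R}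
    (h : pair k φ (walkSum n k A Y (i + 1) v β) ≠ 0) :
    ∃ u < n, (A v u ≠ 0 ∧ A v u ≤ β + 1) ∧
      pair k φ (wedge k (powers R u) (walkSum n k A Y i u (β + 1 - A v u))) ≠ 0 := by
  by_contra hcon
  push Not at hcon
  apply h
  simp only [pair, walkSum, Finset.mul_sum]
  rw [Finset.sum_comm]
  refine Finset.sum_eq_zero fun u hu => ?_
  by_cases hA : A v u ≠ 0 ∧ A v u ≤ β + 1
  · simp only [if_pos hA]
    have := hcon u (Finset.mem_range.1 hu) hA
    simp only [pair] at this
    calc _ = Y ((i * (n + 1) + v) * n + u) * ∑ S ∈ Finset.range (2 ^ k),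
          φ S * wedge k (powers R u) (walkSum n k A Y i u (β + 1 - A v u)) S := by
          rw [Finset.mul_sum]
          exact Finset.sum_congr rfl fun S _ => by ring
      _ = 0 := by rw [this, mul_zero]
  · simp only [if_neg hA, mul_zero, Finset.sum_const_zero]

/-- The end of the traceback: a nonzero pairing at level zero certifies both that the weight is used
up and that no vertex was chosen twice. -/
theorem of_pair_residual_ne_zero {n k v β : ℕ} {A : ℕ → ℕ → ℕ} {Y : ℕ → R} {l : List ℕ}
    (h : pair k (residual R k l) (walkSum n k A Y 0 v β) ≠ 0) : β = 0 ∧ l.Nodup := by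
  have hβ : β = 0 := by
    by_contra hβ
    apply h
    simp [pair, walkSum, hβ]
  refine ⟨hβ, List.Nodup.of_map (powers R) (nodup_of_wedges_ne_zero (k := k)
    (f := walkSum n k A Y 0 v β) fun h0 => h ?_)⟩
  rw [pair_residual, h0]
  rfl

theorem IsWalk.append {A : ℕ → ℕ → ℕ} {l q : List ℕ} {v β γ : ℕ} (hl : IsWalk A v l β)
    (hq : IsWalk A (l.getLast?.getD v) q γ) : IsWalk A v (l ++ q) (β + γ) := by
  induction l generalizing v β with
  | nil =>
    simp only [IsWalk] at hl
    simpa [hl] using hq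
  | cons u l ih =>
    obtain ⟨h1, h2, h3⟩ := hl
    refine ⟨h1, by omega, ?_⟩
    have h4 : β + γ + 1 - A v u = β + 1 - A v u + γ := by omega
    rw [h4]
    refine ih h3 ?_
    cases l with
    | nil => simpa using hq
    | cons x l =>
      rw [List.getLast?_cons_cons] at hq
      simpa [List.getLast?_cons] using hq

end BitExterior

/-! ### Random numbers from coin tosses -/

namespace RAM

/-- The number whose binary digits are the first `j` bits of `f`. -/
def ofBits (f : ℕ → Bool) : ℕ → ℕ
  | 0 => 0
  | j + 1 => 2 * ofBits f j + (f j).toNat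

/-- The `e`-th random number of `b` bits. -/
def draw (coins : ℕ → Bool) (b e : ℕ) : ℕ := ofBits (fun j => coins (e * b + j)) b

theorem ofBits_lt (f : ℕ → Bool) (j : ℕ) : ofBits f j < 2 ^ j := by
  induction j with
  | zero => simp [ofBits]
  | succ j ih =>
    have := Bool.toNat_le (f j)
    rw [ofBits, pow_succ]
    omega

theorem ofBits_inj {f g : ℕ → Bool} {b : ℕ} (h : ofBits f b = ofBits g b) :
    ∀ j < b, f j = g j := by
  induction b with
  | zero => intro j hj; omega
  | succ b ih =>
    intro j hj
    simp only [ofBits] at h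
    have h1 := Bool.toNat_le (f b)
    have h2 := Bool.toNat_le (g b)
    rcases Nat.lt_succ_iff_lt_or_eq.1 hj with h3 | rfl
    · exact ih (by omega) j h3
    · have : (f j).toNat = (g j).toNat := by omega
      cases hf : f j <;> cases hg : g j <;> simp_all

theorem coinMeasure_prefix (c : ℕ → Bool) (N : ℕ) :
    coinMeasure {coins | ∀ i < N, coins i = c i} = (2 ^ N)⁻¹ := by
  have h : {coins : ℕ → Bool | ∀ i < N, coins i = c i} =
      Set.pi (Finset.range N : Finset ℕ) fun i => {c i} := by
    ext coins; simp
  rw [h, coinMeasure, Measure.infinitePi_pi]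
  · simp [ENNReal.inv_pow]
  · intro i _; exact MeasurableSet.singleton _

/-- The `N` draws use disjoint blocks that fill the first `b * N` coins, and their values determine
all these coins. -/
theorem coinMeasure_draws_le (b N : ℕ) (g : Fin N → ℕ) :
    coinMeasure {coins | ∀ e : Fin N, draw coins b e = g e} ≤ (2 ^ (b * N))⁻¹ := by
  by_cases h : ∃ c : ℕ → Bool, ∀ e : Fin N, draw c b e = g e
  · obtain ⟨c, hc⟩ := h
    rw [← coinMeasure_prefix c]
    refine measure_mono fun coins hcoins i hi => ?_
    have hb : 0 < b := Nat.pos_of_ne_zero fun h0 => by simp [h0] at hi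
    have hN : i / b < N := Nat.div_lt_of_lt_mul hi
    have h1 : draw coins b (i / b) = draw c b (i / b) :=
      (hcoins ⟨i / b, hN⟩).trans (hc ⟨i / b, hN⟩).symm
    have h2 := ofBits_inj h1 (i % b) (Nat.mod_lt _ hb)
    rwa [Nat.div_add_mod'] at h2
  · have : {coins | ∀ e : Fin N, draw coins b e = g e} = ∅ := by
      ext coins
      simp only [Set.mem_ofPred_eq, Set.mem_empty_iff_false, iff_false]
      exact fun hc => h ⟨coins, hc⟩
    rw [this]; simp

/-- Schwartz–Zippel bounds the number of zeros on the grid of `b`-bit numbers; a union bound over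
them, each of probability at most `2 ^ (-b N)`, finishes. -/
theorem coinMeasure_eval_eq_zero_le {N d b : ℕ} {p : MvPolynomial (Fin N) ℤ} (hp : p ≠ 0)
    (hd : p.totalDegree ≤ d) :
    coinMeasure {coins | MvPolynomial.eval (fun e : Fin N => (draw coins b e : ℤ)) p = 0} ≤
      ENNReal.ofReal (d / 2 ^ b) := by
  classical
  set S : Finset ℤ := (Finset.range (2 ^ b)).image Nat.cast with hS
  have hcard : S.card = 2 ^ b := by
    rw [hS, Finset.card_image_of_injective _ Nat.cast_injective, Finset.card_range]
  set bad := (Fintype.piFinset fun _ : Fin N => S).filter fun f => MvPolynomial.eval f p = 0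
  have hsz := MvPolynomial.schwartz_zippel_totalDegree hp S
  rw [hcard] at hsz
  change (bad.card : ℚ≥0) / _ ≤ _ at hsz
  have hsub : {coins | MvPolynomial.eval (fun e : Fin N => (draw coins b e : ℤ)) p = 0} ⊆
      ⋃ f ∈ bad, {coins | ∀ e : Fin N, draw coins b e = (f e).toNat} := by
    intro coins hcoins
    simp only [Set.mem_iUnion]
    refine ⟨fun e => (draw coins b e : ℤ), ?_, fun e => by simp⟩
    refine Finset.mem_filter.2 ⟨Fintype.mem_piFinset.2 fun e => ?_, hcoins⟩
    exact Finset.mem_image.2 ⟨_, Finset.mem_range.2 (ofBits_lt _ _), rfl⟩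
  calc coinMeasure _ ≤ coinMeasure (⋃ f ∈ bad, {coins | ∀ e : Fin N, draw coins b e =
        (f e).toNat}) := measure_mono hsub
    _ ≤ ∑ f ∈ bad, coinMeasure {coins | ∀ e : Fin N, draw coins b e = (f e).toNat} :=
        measure_biUnion_finset_le _ _
    _ ≤ ∑ f ∈ bad, (2 ^ (b * N))⁻¹ := Finset.sum_le_sum fun f _ => coinMeasure_draws_le b N _
    _ = ENNReal.ofReal (bad.card / 2 ^ (b * N)) := by
        rw [Finset.sum_const, nsmul_eq_mul, ENNReal.ofReal_div_of_pos (by positivity),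
          ENNReal.ofReal_natCast, ENNReal.ofReal_pow (by norm_num), ENNReal.ofReal_ofNat,
          div_eq_mul_inv]
    _ ≤ ENNReal.ofReal (d / 2 ^ b) := by
        refine ENNReal.ofReal_le_ofReal ?_
        have h1 : ((bad.card : ℚ≥0) / ((2 ^ b : ℕ) : ℚ≥0) ^ N) ≤ (d : ℚ≥0) / ((2 ^ b : ℕ) : ℚ≥0) :=
          hsz.trans (by gcongr)
        have h2 : (((bad.card : ℚ≥0) / ((2 ^ b : ℕ) : ℚ≥0) ^ N : ℚ≥0) : ℝ) ≤
            (((d : ℚ≥0) / ((2 ^ b : ℕ) : ℚ≥0) : ℚ≥0) : ℝ) := by exact_mod_cast h1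
        push_cast at h2
        rwa [← pow_mul] at h2

end RAM

/-! ### A lower bound for the exponent of matrix multiplication -/

/-- Multiplying by the identity shows that every matrix is a combination of the `r` output matrices,
so these span a space of dimension `n ^ 2`. -/
theorem HasBilinearMatMul.sq_le {K : Type*} [Field K] {n r : ℕ} (h : HasBilinearMatMul K n r) :
    n ^ 2 ≤ r := by
  obtain ⟨α, β, γ, h⟩ := h
  have hspan : Submodule.span K (Set.range γ) = ⊤ := by
    rw [eq_top_iff]
    intro X _
    rw [← mul_one X, h X 1]
    exact Submodule.sum_mem _ fun t _ =>
      Submodule.smul_mem _ _ (Submodule.subset_span (Set.mem_range_self t))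
  have h1 := finrank_range_le_card (R := K) γ
  rw [Set.finrank, hspan, finrank_top, Module.finrank_matrix] at h1
  simpa [sq] using h1

/-- The schoolbook algorithm. It makes the set of exponents nonempty; the infimum of the empty set
would be `0`. -/
theorem hasBilinearMatMul_cube (K : Type*) [Field K] (n : ℕ) : HasBilinearMatMul K n (n ^ 3) := by
  classical
  have e : Fin (n ^ 3) ≃ Fin n × Fin n × Fin n :=
    Fintype.equivOfCardEq (by simp [pow_succ, mul_assoc])
  refine ⟨fun t => Matrix.single (e t).1 (e t).2.1 1, fun t => Matrix.single (e t).2.1 (e t).2.2 1,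
    fun t => Matrix.single (e t).1 (e t).2.2 1, fun X Y => ?_⟩
  have hs : ∀ (a b : Fin n) (X : Matrix (Fin n) (Fin n) K),
      ∑ i, ∑ j, Matrix.single a b (1 : K) i j * X i j = X a b := by
    intro a b X
    simp [Matrix.single_apply, ite_and]
  simp only [hs]
  rw [e.sum_comp (fun x : Fin n × Fin n × Fin n => (X x.1 x.2.1 * Y x.2.1 x.2.2) •
    (Matrix.single x.1 x.2.2 1 : Matrix (Fin n) (Fin n) K))]
  ext i j
  simp only [Fintype.sum_prod_type, Matrix.sum_apply, Matrix.smul_apply, Matrix.single_apply,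
    Matrix.mul_apply, smul_eq_mul, ite_and]
  simp

/-- For an admissible `τ < 2` the rank bound would keep `n ^ (2 - τ)` bounded. -/
theorem two_le_matMulExponent (K : Type*) [Field K] : 2 ≤ matMulExponent K := by
  refine le_csInf ⟨3, 1, fun n _ => ⟨n ^ 3, ?_, hasBilinearMatMul_cube K n⟩⟩ ?_
  · rw [one_mul, Nat.cast_pow, ← Real.rpow_natCast]; norm_num
  · rintro τ ⟨C, hC⟩
    by_contra! hτ
    have h1 : ∀ n : ℕ, 1 ≤ n → (n : ℝ) ^ (2 - τ) ≤ C := by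
      intro n hn
      obtain ⟨r, hr, hb⟩ := hC n hn
      have h2 : ((n : ℝ)) ^ (2 : ℝ) ≤ C * (n : ℝ) ^ τ := by
        refine le_trans ?_ hr
        rw [show (2 : ℝ) = ((2 : ℕ) : ℝ) by norm_num, Real.rpow_natCast]
        exact_mod_cast hb.sq_le
      have hn0 : (0 : ℝ) < n := by exact_mod_cast hn
      rw [Real.rpow_sub hn0, div_le_iff₀ (Real.rpow_pos_of_pos hn0 _)]
      exact h2
    have h3 := (tendsto_rpow_atTop (show 0 < 2 - τ by linarith)).comp tendsto_natCast_atTop_atTop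
    obtain ⟨n, hn⟩ := ((h3.eventually_gt_atTop C).and (Filter.eventually_ge_atTop 1)).exists
    exact absurd (h1 n hn.2) (not_le.2 hn.1)

/-- The only fact about `ω` that the running time uses. -/
theorem sq_le_rpow_matMulExponent (K : Type*) [Field K] {n : ℕ} (hn : 1 ≤ n) :
    (n : ℝ) ^ 2 ≤ (n : ℝ) ^ matMulExponent K := by
  rw [← Real.rpow_natCast]
  exact Real.rpow_le_rpow_of_exponent_le (by exact_mod_cast hn)
    (by exact_mod_cast two_le_matMulExponent K)

/-! ### Exterior multiplication as a program -/

namespace RAM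

namespace Ex

instance : Add Ex := ⟨bin .add⟩
instance : Sub Ex := ⟨bin .sub⟩
instance : Mul Ex := ⟨bin .mul⟩
instance : Div Ex := ⟨bin .div⟩

variable (ρ : List ℕ) (mem : ℕ → ℕ) (d V : ℕ)

theorem eval_var (i : ℕ) : (var i).eval ρ mem = ρ.getD i 0 := rfl
theorem eval_cst (v : ℕ) : (cst v).eval ρ mem = v := rfl
theorem eval_ld (a : Ex) : (ld a).eval ρ mem = mem (a.eval ρ mem) := rfl
theorem eval_add (a b : Ex) : (a + b).eval ρ mem = a.eval ρ mem + b.eval ρ mem := rfl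
theorem eval_sub (a b : Ex) : (a - b).eval ρ mem = a.eval ρ mem - b.eval ρ mem := rfl
theorem eval_mul (a b : Ex) : (a * b).eval ρ mem = a.eval ρ mem * b.eval ρ mem := rfl
theorem eval_div (a b : Ex) : (a / b).eval ρ mem = a.eval ρ mem / b.eval ρ mem := rfl
theorem wf_var (i : ℕ) : (var i).Wf d V ↔ i < d := Iff.rfl
theorem wf_cst (v : ℕ) : (cst v).Wf d V ↔ v ≤ V := Iff.rfl
theorem wf_ld (a : Ex) : (ld a).Wf d V ↔ a.Wf d V := Iff.rfl
theorem wf_add (a b : Ex) : (a + b).Wf d V ↔ a.Wf d V ∧ b.Wf d V := Iff.rfl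
theorem wf_sub (a b : Ex) : (a - b).Wf d V ↔ a.Wf d V ∧ b.Wf d V := Iff.rfl
theorem wf_mul (a b : Ex) : (a * b).Wf d V ↔ a.Wf d V ∧ b.Wf d V := Iff.rfl
theorem wf_div (a b : Ex) : (a / b).Wf d V ↔ a.Wf d V ∧ b.Wf d V := Iff.rfl
theorem sz_sub (a b : Ex) : (a - b).sz = a.sz + b.sz + 1 := rfl
theorem sz_mul (a b : Ex) : (a * b).sz = a.sz + b.sz + 1 := rfl
theorem sz_div (a b : Ex) : (a / b).sz = a.sz + b.sz + 1 := rfl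

/-- The remainder of a division. -/
def mod (a b : Ex) : Ex := a - a / b * b

theorem eval_mod (a b : Ex) : (mod a b).eval ρ mem = a.eval ρ mem % b.eval ρ mem := by
  rw [mod, eval_sub, eval_mul, eval_div, Nat.mod_eq_sub_div_mul]

theorem wf_mod (a b : Ex) : (mod a b).Wf d V ↔ a.Wf d V ∧ b.Wf d V := by
  simp only [mod, wf_sub, wf_mul, wf_div]; tauto

theorem sz_mod (a b : Ex) : (mod a b).sz = 2 * a.sz + 2 * b.sz + 3 := by
  simp only [mod, sz_sub, sz_mul, sz_div]; ring

end Ex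

namespace Cmd

open Ex

instance : AndThen Cmd := ⟨fun p q => seq p (q ())⟩

theorem wp_andThen (coins : ℕ → Bool) (V : ℕ) (p q : Cmd) (Q : St → Prop) (s : St) :
    (p >> q).wp coins V Q s = p.wp coins V (q.wp coins V Q) s := rfl

theorem wf_andThen (V W d : ℕ) (p q : Cmd) : (p >> q).Wf V W d ↔ p.Wf V W d ∧ q.Wf V W d := Iff.rfl

/-- A coefficient of the exterior product of the array at the address in register `14` with the
powers of the number in register `12`. -/
def wedgeCmd : Cmd :=
  set 15 (cst 0) >> set 16 (cst 1) >> set 17 (cst 1) >> set 18 (cst 1) >>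
  rep (var 1)
    (set 19 (mod (var 13 / var 16) (cst 2)) >>
    ite (var 19)
      (set 15 (mod (var 15 + var 18 * var 17 * ld (var 14 + (var 13 - var 16))) (var 5)) >>
        set 18 (var 5 - var 18))
      skip >>
    set 16 (cst 2 * var 16) >> set 17 (var 17 * var 12))

/-- A coefficient of the contraction of the array at the address in register `14` with the
powers of the number in register `12`. -/
def contractCmd : Cmd :=
  set 15 (cst 0) >> set 16 (cst 1) >> set 17 (cst 1) >> set 18 (cst 1) >>
  rep (var 1)
    (set 19 (mod (var 13 / var 16) (cst 2)) >>
    ite (var 19)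
      (set 18 (var 5 - var 18))
      (set 15 (mod (var 15 + var 18 * var 17 * ld (var 14 + (var 13 + var 16))) (var 5))) >>
    set 16 (cst 2 * var 16) >> set 17 (var 17 * var 12))

end Cmd

open Cmd Ex BitExterior

/-- Signs are stored as residues, so subtracting from the modulus flips them. -/
theorem cast_sub_eq_neg {m s : ℕ} (h : s ≤ m) : ((m - s : ℕ) : ZMod m) = -(s : ZMod m) := by
  rw [Nat.cast_sub h, ZMod.natCast_self, zero_sub]

theorem wp_wedgeCmd {coins : ℕ → Bool} {V : ℕ} {Q : St → Prop}
    {n k B D E m b N yb bs ph pt u S src acc pj uj sg bit : ℕ} {rest : List ℕ} {mem : ℕ → ℕ}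
    {dr tm : ℕ} (hm : 2 ≤ m) (hmV : m ≤ V) (hEV : 2 ^ k ≤ V) (hu : ∀ t ≤ k, u ^ t ≤ V)
    (f : ℕ → ZMod m) (hS : S < 2 ^ k) (hf : ∀ T < 2 ^ k, (mem (src + T) : ZMod m) = f T)
    (hQ : ∀ acc' pj' uj' sg' bit' tm', acc' < m →
      (acc' : ZMod m) = wedge k (powers (ZMod m) u) f S → tm' ≤ tm + (7 * k + 5) →
      Q ⟨n :: k :: B :: D :: E :: m :: b :: N :: yb :: bs :: ph :: pt :: u :: S :: src :: acc' ::
        pj' :: uj' :: sg' :: bit' :: rest, mem, dr, tm'⟩) :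
    wedgeCmd.wp coins V Q ⟨n :: k :: B :: D :: E :: m :: b :: N :: yb :: bs :: ph :: pt :: u ::
      S :: src :: acc :: pj :: uj :: sg :: bit :: rest, mem, dr, tm⟩ := by
  have hkV : k ≤ V := (Nat.lt_two_pow_self).le.trans hEV
  simp only [wedgeCmd, wp_andThen, wp, eval_var, eval_cst, eval_mod, eval_add, eval_sub, eval_mul,
    eval_div, eval_ld, List.getD_cons_succ, List.getD_cons_zero, List.set_cons_succ,
    List.set_cons_zero]
  -- After `t` iterations the accumulator holds the product formed with the first `t` coordinates
  -- only, that is `wedge` with `t` in place of `k`. The power `u ^ t` is kept unreduced.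
  refine ⟨by omega, by omega, by omega, by omega, hkV, fun t st => ∃ acc sg bit, st.ρ =
    n :: k :: B :: D :: E :: m :: b :: N :: yb :: bs :: ph :: pt :: u :: S :: src :: acc ::
        2 ^ t :: u ^ t :: sg :: bit :: rest ∧ st.mem = mem ∧ st.dr = dr ∧ acc < m ∧
        (acc : ZMod m) = wedge t (powers (ZMod m) u) f S ∧ sg ≤ m ∧ (sg : ZMod m) = sgn _ S t ∧
        st.tm ≤ tm + (7 * t + 4), ?_, ?_, ?_⟩
  · exact ⟨0, 1, bit, rfl, rfl, rfl, by omega, by simp [wedge], by omega, by simp [sgn], le_rfl⟩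
  · rintro t ht ⟨ρ, mem', dr', tm'⟩ ⟨acc, sg, bit, h1, h2, h3, hacc, hacc', hsg, hsg', htm⟩
    simp only at h1 h2 h3 htm
    subst h1 h2 h3
    simp only [List.cons_append, List.getD_cons_succ, List.getD_cons_zero, List.set_cons_succ,
      List.set_cons_zero]
    have hbit : S / 2 ^ t % 2 < 2 := Nat.mod_lt _ (by norm_num)
    have htb : S.testBit t = decide (S / 2 ^ t % 2 = 1) := Nat.testBit_eq_decide_div_mod_eq
    have hmod : ∀ x, x % m < m := fun x => Nat.mod_lt _ (by omega)
    have hp2 : 2 * 2 ^ t ≤ V :=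
      le_trans (by rw [← pow_succ']; exact Nat.pow_le_pow_right (by norm_num) ht) hEV
    have hpu : u ^ t * u ≤ V := by rw [← pow_succ]; exact hu _ ht
    refine ⟨by omega, fun h0 => ⟨(hmod _).le.trans hmV, by omega, hp2, hpu, _,
      (by simp only [← List.cons_append]; exact rfl), ?_⟩,
      fun h0 => ⟨hp2, hpu, _, (by simp only [← List.cons_append]; exact rfl), ?_⟩⟩
    · have h1 : S.testBit t = true := by rw [htb]; simp; omega
      refine ⟨_, _, _, by rw [pow_succ', pow_succ], trivial, trivial, hmod _, ?_, by omega, ?_, by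
          omega⟩
      · rw [wedge, Finset.sum_range_succ, ← wedge, if_pos h1, ZMod.natCast_mod]
        push_cast
        rw [hacc', hsg', hf _ ((Nat.sub_le _ _).trans_lt hS)]
        rfl
      · rw [cast_sub_eq_neg hsg, hsg', sgn, sgn, Finset.prod_range_succ, if_pos h1]
        ring
    · have h1 : S.testBit t = false := by rw [htb]; simp; omega
      refine ⟨_, _, _, by rw [pow_succ', pow_succ], trivial, trivial, hacc, ?_, hsg, ?_, by omega⟩
      · rw [wedge, Finset.sum_range_succ, ← wedge, hacc', h1]
        simp
      · rw [hsg', sgn, sgn, Finset.prod_range_succ, h1]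
        simp
  · rintro ⟨ρ, mem', dr', tm'⟩ ⟨acc, sg, bit, h1, h2, h3, hacc, hacc', hsg, hsg', htm⟩
    simp only at h1 h2 h3 htm
    subst h1 h2 h3
    exact hQ _ _ _ _ _ (tm' + 1) hacc hacc' (by omega)

theorem wp_contractCmd {coins : ℕ → Bool} {V : ℕ} {Q : St → Prop}
    {n k B D E m b N yb bs ph pt u S src acc pj uj sg bit : ℕ} {rest : List ℕ} {mem : ℕ → ℕ}
    {dr tm : ℕ} (hm : 2 ≤ m) (hmV : m ≤ V) (hEV : 2 ^ k ≤ V) (hu : ∀ t ≤ k, u ^ t ≤ V)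
    (f : ℕ → ZMod m) (hS : S < 2 ^ k) (hf : ∀ T < 2 ^ k, (mem (src + T) : ZMod m) = f T)
    (hQ : ∀ acc' pj' uj' sg' bit' tm', acc' < m →
      (acc' : ZMod m) = contract k (powers (ZMod m) u) f S → tm' ≤ tm + (7 * k + 5) →
      Q ⟨n :: k :: B :: D :: E :: m :: b :: N :: yb :: bs :: ph :: pt :: u :: S :: src :: acc' ::
        pj' :: uj' :: sg' :: bit' :: rest, mem, dr, tm'⟩) :
    contractCmd.wp coins V Q ⟨n :: k :: B :: D :: E :: m :: b :: N :: yb :: bs :: ph :: pt :: u ::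
      S :: src :: acc :: pj :: uj :: sg :: bit :: rest, mem, dr, tm⟩ := by
  have hkV : k ≤ V := (Nat.lt_two_pow_self).le.trans hEV
  simp only [contractCmd, wp_andThen, wp, eval_var, eval_cst, eval_mod, eval_add, eval_sub,
      eval_mul,
    eval_div, eval_ld, List.getD_cons_succ, List.getD_cons_zero, List.set_cons_succ,
    List.set_cons_zero]
  refine ⟨by omega, by omega, by omega, by omega, hkV, fun t st => ∃ acc sg bit, st.ρ =
    n :: k :: B :: D :: E :: m :: b :: N :: yb :: bs :: ph :: pt :: u :: S :: src :: acc ::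
        2 ^ t :: u ^ t :: sg :: bit :: rest ∧ st.mem = mem ∧ st.dr = dr ∧ acc < m ∧
        (acc : ZMod m) = contract t (powers (ZMod m) u) f S ∧ sg ≤ m ∧ (sg : ZMod m) = sgn _ S t ∧
        st.tm ≤ tm + (7 * t + 4), ?_, ?_, ?_⟩
  · exact ⟨0, 1, bit, rfl, rfl, rfl, by omega, by simp [contract], by omega, by simp [sgn], le_rfl⟩
  · rintro t ht ⟨ρ, mem', dr', tm'⟩ ⟨acc, sg, bit, h1, h2, h3, hacc, hacc', hsg, hsg', htm⟩
    simp only at h1 h2 h3 htm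
    subst h1 h2 h3
    simp only [List.cons_append, List.getD_cons_succ, List.getD_cons_zero, List.set_cons_succ,
      List.set_cons_zero]
    have hbit : S / 2 ^ t % 2 < 2 := Nat.mod_lt _ (by norm_num)
    have htb : S.testBit t = decide (S / 2 ^ t % 2 = 1) := Nat.testBit_eq_decide_div_mod_eq
    have hmod : ∀ x, x % m < m := fun x => Nat.mod_lt _ (by omega)
    have hp2 : 2 * 2 ^ t ≤ V :=
      le_trans (by rw [← pow_succ']; exact Nat.pow_le_pow_right (by norm_num) ht) hEV
    have hpu : u ^ t * u ≤ V := by rw [← pow_succ]; exact hu _ ht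
    refine ⟨by omega, fun h0 => ⟨by omega, hp2, hpu, _,
      (by simp only [← List.cons_append]; exact rfl), ?_⟩,
      fun h0 => ⟨(hmod _).le.trans hmV, hp2, hpu, _, (by simp only [← List.cons_append]; exact
          rfl), ?_⟩⟩
    · have h1 : S.testBit t = true := by rw [htb]; simp; omega
      refine ⟨_, _, _, by rw [pow_succ', pow_succ], trivial, trivial, hacc, ?_, by omega, ?_, by
          omega⟩
      · rw [contract, Finset.sum_range_succ, ← contract, hacc', if_pos h1, add_zero]
      · rw [cast_sub_eq_neg hsg, hsg', sgn, sgn, Finset.prod_range_succ, if_pos h1]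
        ring
    · have h1 : S.testBit t = false := by rw [htb]; simp; omega
      refine ⟨_, _, _, by rw [pow_succ', pow_succ], trivial, trivial, hmod _, ?_, hsg, ?_, by omega⟩
      · rw [contract, Finset.sum_range_succ, ← contract, ZMod.natCast_mod]
        push_cast
        rw [hacc', hsg', hf _ (add_two_pow_lt hS ht h1), h1]
        simp [powers]
      · rw [hsg', sgn, sgn, Finset.prod_range_succ, h1]
        simp
  · rintro ⟨ρ, mem', dr', tm'⟩ ⟨acc, sg, bit, h1, h2, h3, hacc, hacc', hsg, hsg', htm⟩
    simp only at h1 h2 h3 htm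
    subst h1 h2 h3
    exact hQ _ _ _ _ _ (tm' + 1) hacc hacc' (by omega)

end RAM

/-! ### The table of walk sums -/

namespace RAM

open Cmd Ex BitExterior

/-- The position of an entry in the table of walk sums. -/
def code (n D E i v β S : ℕ) : ℕ := ((i * (n + 1) + v) * D + β) * E + S

theorem code_decode {n D E : ℕ} (t : ℕ) :
    code n D E (t / E / D / (n + 1)) (t / E / D % (n + 1)) (t / E % D) (t % E) = t := by
  simp only [code, Nat.div_add_mod']

theorem code_mod {n D E i v β S : ℕ} (hS : S < E) : code n D E i v β S % E = S := by
  rw [code, mul_comm, Nat.mul_add_mod, Nat.mod_eq_of_lt hS]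

theorem code_div {n D E i v β S : ℕ} (hS : S < E) :
    code n D E i v β S / E = (i * (n + 1) + v) * D + β := by
  rw [code, mul_comm, Nat.mul_add_div (by omega), Nat.div_eq_of_lt hS, add_zero]

theorem mul_add_mod_self {a b c : ℕ} (h : c < b) : (a * b + c) % b = c := by
  rw [mul_comm, Nat.mul_add_mod, Nat.mod_eq_of_lt h]

theorem mul_add_div_self {a b c : ℕ} (h : c < b) : (a * b + c) / b = a := by
  rw [mul_comm, Nat.mul_add_div (by omega), Nat.div_eq_of_lt h, add_zero]

theorem code_inj {n D E i v β S i' v' β' S' : ℕ} (hv : v ≤ n) (hβ : β < D) (hS : S < E)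
    (hv' : v' ≤ n) (hβ' : β' < D) (hS' : S' < E)
    (h : code n D E i v β S = code n D E i' v' β' S') : i = i' ∧ v = v' ∧ β = β' ∧ S = S' := by
  have h1 : S = S' := by rw [← code_mod (i := i) (v := v) (β := β) hS, h, code_mod hS']
  have h2 := congrArg (· / E) h
  simp only [code_div hS, code_div hS'] at h2
  have h3 := congrArg (· % D) h2
  have h4 := congrArg (· / D) h2
  simp only [mul_add_mod_self hβ, mul_add_mod_self hβ', mul_add_div_self hβ,
    mul_add_div_self hβ'] at h3 h4
  have h5 := congrArg (· % (n + 1)) h4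
  have h6 := congrArg (· / (n + 1)) h4
  simp only [mul_add_mod_self (Nat.lt_succ_of_le hv), mul_add_mod_self (Nat.lt_succ_of_le hv'),
    mul_add_div_self (Nat.lt_succ_of_le hv), mul_add_div_self (Nat.lt_succ_of_le hv')] at h5 h6
  exact ⟨h6, h5, h3, h1⟩

theorem code_lt {n D E i v β S : ℕ} (hv : v ≤ n) (hβ : β < D) (hS : S < E) :
    code n D E i v β S < (i + 1) * ((n + 1) * (D * E)) := by
  calc code n D E i v β S < ((i * (n + 1) + v) * D + β) * E + E := by rw [code]; omega
    _ = ((i * (n + 1) + v) * D + (β + 1)) * E := by ring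
    _ ≤ ((i * (n + 1) + v) * D + D) * E := Nat.mul_le_mul_right _ (by omega)
    _ = (i * (n + 1) + (v + 1)) * D * E := by ring
    _ ≤ (i * (n + 1) + (n + 1)) * D * E :=
      Nat.mul_le_mul_right _ (Nat.mul_le_mul_right _ (by omega))
    _ = (i + 1) * ((n + 1) * (D * E)) := by ring

theorem le_code {n D E i v β S : ℕ} : i * ((n + 1) * (D * E)) ≤ code n D E i v β S := by
  calc i * ((n + 1) * (D * E)) = i * (n + 1) * D * E := by ring
    _ ≤ ((i * (n + 1) + v) * D + β) * E :=
      Nat.mul_le_mul_right _ (le_trans (Nat.mul_le_mul_right _ (Nat.le_add_right _ _))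
        (Nat.le_add_right _ _))
    _ ≤ _ := Nat.le_add_right _ _

theorem code_lt_of_le {n D E i v β S k : ℕ} (hi : i ≤ k) (hv : v ≤ n) (hβ : β < D) (hS : S < E) :
    code n D E i v β S < (k + 1) * ((n + 1) * (D * E)) :=
  (code_lt hv hβ hS).trans_le (Nat.mul_le_mul_right _ (by omega))

/-- The values in the registers `0` to `11`: the parameters, the modulus `m`, the number `b` of
bits of a random number, the number `N` of random numbers, and the addresses of the random
numbers, of the table of walk sums, of the functionals and of the path. -/
structure Layout (V n k B D E m b N yb bs ph pt : ℕ) : Prop where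
  n_pos : 1 ≤ n
  k_pos : 1 ≤ k
  D_eq : D = B + 1
  E_eq : E = 2 ^ k
  two_le_m : 2 ≤ m
  m_le : m ≤ V
  b_le : b ≤ V
  pow_le : 2 ^ b ≤ V
  N_eq : N = k * ((n + 1) * n)
  yb_eq : yb = n * n + n
  bs_eq : bs = yb + N
  ph_eq : ph = bs + (k + 1) * ((n + 1) * (D * E))
  pt_eq : pt = ph + (k + 1) * E
  end_le : pt + k ≤ V
  npow_le : n ^ k ≤ V

section

variable {V n k B D E m b N yb bs ph pt : ℕ}

namespace Layout

variable (h : Layout V n k B D E m b N yb bs ph pt)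
include h

theorem E_pos : 0 < E := h.E_eq ▸ Nat.two_pow_pos k

theorem D_pos : 0 < D := h.D_eq ▸ Nat.succ_pos B

end Layout

end

end RAM

/-! ### Filling the table -/

namespace RAM

open Cmd Ex BitExterior

/-- Computes an entry of the table of walk sums in register `20`. -/
def rowCmd : Cmd :=
  set 20 (cst 0) >>
  rep (var 0)
    (set 12 (var 29) >> set 21 (ld (var 23 * var 0 + var 29)) >>
    ite (var 21 * (var 22 + cst 2 - var 21))
      (set 14 (var 9 + (((var 24 - cst 1) * (var 0 + cst 1) + var 12) * var 3 +
          (var 22 + cst 1 - var 21)) * var 4) >>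
        wedgeCmd >>
        set 20 (mod (var 20 + ld (var 8 + (((var 24 - cst 1) * (var 0 + cst 1) + var 23) * var 0 +
          var 12)) * var 15) (var 5)))
      skip)

/-- Computes the table of walk sums. -/
def tableCmd : Cmd :=
  rep ((var 1 + cst 1) * ((var 0 + cst 1) * (var 3 * var 4)))
    (set 13 (mod (var 27) (var 4)) >>
    set 22 (mod (var 27 / var 4) (var 3)) >>
    set 23 (mod (var 27 / var 4 / var 3) (var 0 + cst 1)) >>
    set 24 (var 27 / var 4 / var 3 / (var 0 + cst 1)) >>
    ite (var 24)
      (rowCmd >> put (var 9 + var 27) (var 20))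
      (put (var 9 + var 27) (cst 1 - mod (var 27) (var 3 * var 4))))

/-- Entries are one plus a weight, so this single product tests both that the edge exists and that
its weight is at most `β`; truncated subtraction makes it work. -/
theorem cond_ne_zero_iff {a β : ℕ} : a * (β + 2 - a) ≠ 0 ↔ a ≠ 0 ∧ a ≤ β + 1 := by
  rw [Nat.mul_ne_zero_iff]; omega

section

variable {coins : ℕ → Bool} {Q : St → Prop} {V n k B D E m b N yb bs ph pt : ℕ}
  (L : Layout V n k B D E m b N yb bs ph pt)
include L

namespace Layout

theorem ph_le : ph ≤ V := by have := L.pt_eq; have := L.end_le; omega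

theorem bs_add_code_lt {i v β S : ℕ} (hi : i ≤ k) (hv : v ≤ n) (hβ : β < D) (hS : S < E) :
    bs + code n D E i v β S < ph := by
  rw [L.ph_eq]; have := code_lt_of_le hi hv hβ hS; omega

theorem E_le : 2 ^ k ≤ V := by
  rw [← L.E_eq]
  have h1 := L.pt_eq
  have h2 : E ≤ (k + 1) * E := Nat.le_mul_of_pos_left _ (by omega)
  have := L.end_le
  omega

theorem n_le : n ≤ V := by
  have := L.yb_eq; have := L.bs_eq; have := L.ph_eq; have := L.pt_eq; have := L.end_le
  omega

theorem D_le : D ≤ V := by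
  have h : D ≤ (k + 1) * ((n + 1) * (D * E)) :=
    calc D ≤ D * E := Nat.le_mul_of_pos_right _ L.E_pos
      _ ≤ (n + 1) * (D * E) := Nat.le_mul_of_pos_left _ (by omega)
      _ ≤ (k + 1) * ((n + 1) * (D * E)) := Nat.le_mul_of_pos_left _ (by omega)
  have := L.ph_eq; have := L.ph_le
  omega

theorem powers_le {u : ℕ} (hu : u < n) : ∀ t ≤ k, u ^ t ≤ V := fun t ht =>
  (Nat.pow_le_pow_left hu.le t).trans ((Nat.pow_le_pow_right L.n_pos ht).trans L.npow_le)

end Layout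

/-- The loop adds the summands of the recursion head by head; the entries of level `i` that it reads
are assumed to be in place. -/
theorem wp_rowCmd {S src acc pj uj sg bit u x a β v i res r t : ℕ} {mem : ℕ → ℕ} {dr tm : ℕ}
    (hmem : ∀ a, mem a ≤ V) (A : ℕ → ℕ → ℕ) (Y : ℕ → ZMod m)
    (hA : ∀ v ≤ n, ∀ u < n, mem (v * n + u) = A v u)
    (hY : ∀ e < N, (mem (yb + e) : ZMod m) = Y e)
    (hi : i < k) (hv : v ≤ n) (hβ : β < D) (hS : S < E)
    (hG : ∀ u < n, ∀ γ < D, ∀ T < E, (mem (bs + code n D E i u γ T) : ZMod m) =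
      walkSum n k A Y i u γ T)
    (hQ : ∀ u' src' acc' pj' uj' sg' bit' x' a' tm', x' < m →
      (x' : ZMod m) = walkSum n k A Y (i + 1) v β S →
      tm' ≤ tm + (n * (7 * k + 11) + 2) →
      Q ⟨[n, k, B, D, E, m, b, N, yb, bs, ph, pt, u', S, src', acc', pj', uj', sg', bit', x', a', β,
        v, i + 1, res, r, t], mem, dr, tm'⟩) :
    rowCmd.wp coins V Q ⟨[n, k, B, D, E, m, b, N, yb, bs, ph, pt, u, S, src, acc, pj, uj, sg, bit,
      x, a, β, v, i + 1, res, r, t], mem, dr, tm⟩ := by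
  simp only [rowCmd, wp_andThen, wp, eval_var, eval_cst, eval_mod, eval_add, eval_sub, eval_mul,
    eval_ld, List.getD_cons_zero, List.set_cons_succ, List.set_cons_zero]
  have hm := L.two_le_m
  refine ⟨by omega, L.n_le, fun t' st => ∃ u src acc pj uj sg bit x a, st.ρ =
    [n, k, B, D, E, m, b, N, yb, bs, ph, pt, u, S, src, acc, pj, uj, sg, bit, x, a, β, v, i + 1,
      res, r, t] ∧ st.mem = mem ∧ st.dr = dr ∧ x < m ∧ (x : ZMod m) = ∑ u ∈ Finset.range t',
        (if A v u ≠ 0 ∧ A v u ≤ β + 1 then Y ((i * (n + 1) + v) * n + u) *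
          wedge k (powers (ZMod m) u) (walkSum n k A Y i u
            (β + 1 - A v u)) S else 0) ∧
      st.tm ≤ tm + (t' * (7 * k + 11) + 1), ?_, ?_, ?_⟩
  · exact ⟨u, src, acc, pj, uj, sg, bit, 0, a, rfl, rfl, rfl, by omega, by simp, by simp⟩
  · rintro t' ht ⟨ρ, mem', dr', tm'⟩ ⟨u, src, acc, pj, uj, sg, bit, x, a, h1, h2, h3, hx, hx', htm⟩
    simp only at h1 h2 h3 htm
    subst h1 h2 h3
    simp only [List.cons_append, List.nil_append, List.getD_cons_succ, List.getD_cons_zero,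
      List.set_cons_succ, List.set_cons_zero, Nat.add_sub_cancel]
    refine ⟨ht.le.trans L.n_le, hmem _, ?_, ?_⟩ <;> rw [hA v hv t' ht]
    · intro hc
      rw [cond_ne_zero_iff] at hc
      have hγ : β + 1 - A v t' < D := by omega
      refine ⟨?_, ?_⟩
      · have := L.bs_add_code_lt hi.le ht.le hγ L.E_pos
        simp only [code] at this
        have := L.ph_le
        omega
      · refine wp_wedgeCmd L.two_le_m L.m_le L.E_le (L.powers_le ht)
          (walkSum n k A Y i t' (β + 1 - A v t'))
          (L.E_eq ▸ hS) ?_ ?_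
        · intro T hT
          rw [← L.E_eq] at hT
          rw [← hG t' ht _ hγ T hT, code, add_assoc]
        · intro acc' pj' uj' sg' bit' tm'' _ hacc htm''
          simp only [List.getD_cons_succ, List.getD_cons_zero, List.set_cons_succ,
            List.set_cons_zero]
          refine ⟨(Nat.mod_lt _ (by omega)).le.trans L.m_le, _, rfl, _, _, _, _, _, _, _, _, _, rfl,
            trivial, trivial, Nat.mod_lt _ (by omega), ?_, ?_⟩
          · rw [Finset.sum_range_succ, if_pos hc, ← hx', ZMod.natCast_mod]
            push_cast
            rw [hacc, hY]
            rw [L.N_eq]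
            calc (i * (n + 1) + v) * n + t' < (i * (n + 1) + v) * n + n := by omega
              _ = (i * (n + 1) + (v + 1)) * n := by ring
              _ ≤ (i * (n + 1) + (n + 1)) * n := Nat.mul_le_mul_right _ (by omega)
              _ = (i + 1) * ((n + 1) * n) := by ring
              _ ≤ k * ((n + 1) * n) := Nat.mul_le_mul_right _ (by omega)
          · rw [Nat.succ_mul]; omega
    · intro hc
      have hc' := mt cond_ne_zero_iff.2 (not_not.2 hc)
      refine ⟨_, rfl, _, _, _, _, _, _, _, _, _, rfl, trivial, trivial, hx, ?_, ?_⟩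
      · rw [Finset.sum_range_succ, if_neg hc', add_zero, hx']
      · rw [Nat.succ_mul]; omega
  · rintro ⟨ρ, mem', dr', tm'⟩ ⟨u, src, acc, pj, uj, sg, bit, x, a, h1, h2, h3, hx, hx', htm⟩
    simp only at h1 h2 h3 htm
    subst h1 h2 h3
    exact hQ _ _ _ _ _ _ _ _ _ (tm' + 1) hx hx' (by omega)

/-- A single loop runs through all codes in increasing order and decodes each. The level is the
leading digit, so a level is complete before the next one begins. -/
theorem wp_tableCmd {u S src acc pj uj sg bit x a β v i res : ℕ} {mem : ℕ → ℕ} {dr tm : ℕ}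
    (hmem : ∀ a, mem a ≤ V) (A : ℕ → ℕ → ℕ) (Y : ℕ → ZMod m)
    (hA : ∀ v ≤ n, ∀ u < n, mem (v * n + u) = A v u)
    (hY : ∀ e < N, (mem (yb + e) : ZMod m) = Y e)
    (hQ : ∀ u' S' src' acc' pj' uj' sg' bit' x' a' β' v' i' mem' tm',
      (∀ i ≤ k, ∀ v ≤ n, ∀ β < D, ∀ S < E, mem' (bs + code n D E i v β S) < m ∧
        (mem' (bs + code n D E i v β S) : ZMod m) =
        walkSum n k A Y i v β S) →
      (∀ a, mem' a ≤ V) → (∀ a < bs, mem' a = mem a) →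
      tm' ≤ tm + ((k + 1) * ((n + 1) * (D * E)) * (n * (7 * k + 11) + 9) + 1) →
      Q ⟨[n, k, B, D, E, m, b, N, yb, bs, ph, pt, u', S', src', acc', pj', uj', sg', bit', x', a',
        β', v', i', res], mem', dr, tm'⟩) :
    tableCmd.wp coins V Q ⟨[n, k, B, D, E, m, b, N, yb, bs, ph, pt, u, S, src, acc, pj, uj, sg, bit,
      x, a, β, v, i, res], mem, dr, tm⟩ := by
  simp only [tableCmd, wp_andThen, wp, eval_var, eval_cst, eval_mod, eval_add, eval_sub, eval_mul,
    eval_div, List.getD_cons_succ, List.getD_cons_zero]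
  have hm := L.two_le_m
  have hV2 := L.m_le
  have hph := L.ph_le
  refine ⟨by have := L.ph_eq; omega, fun t st => ∃ u S src acc pj uj sg bit x a β v i, st.ρ =
    [n, k, B, D, E, m, b, N, yb, bs, ph, pt, u, S, src, acc, pj, uj, sg, bit, x, a, β, v, i,
      res] ∧ st.dr = dr ∧ (∀ a, st.mem a ≤ V) ∧ (∀ a < bs, st.mem a = mem a) ∧
      (∀ i ≤ k, ∀ v ≤ n, ∀ β < D, ∀ S < E, code n D E i v β S < t →
        st.mem (bs + code n D E i v β S) < m ∧ (st.mem (bs + code n D E i v β S) : ZMod m) =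
        walkSum n k A Y i v β S) ∧
      st.tm ≤ tm + (t * (n * (7 * k + 11) + 9)), ?_, ?_, ?_⟩
  · exact ⟨_, _, _, _, _, _, _, _, _, _, _, _, _, rfl, rfl, hmem, fun _ _ => rfl,
      fun _ _ _ _ _ _ _ _ h => absurd h (Nat.not_lt_zero _), by simp⟩
  · rintro t ht ⟨ρ, mem', dr', tm'⟩
      ⟨u, S, src, acc, pj, uj, sg, bit, x, a, β, v, i, h1, h2, hmem', hlow, hG, htm⟩
    simp only at h1 h2 hmem' hlow hG htm
    subst h1 h2
    simp only [List.cons_append, List.nil_append, List.getD_cons_succ, List.getD_cons_zero,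
      List.set_cons_succ, List.set_cons_zero]
    have hE := L.E_pos
    have hD := L.D_pos
    have hEV : E ≤ V := L.E_eq ▸ L.E_le
    have hcode := code_decode (n := n) (D := D) (E := E) t
    have hS : t % E < E := Nat.mod_lt _ hE
    have hβ : t / E % D < D := Nat.mod_lt _ hD
    have hv : t / E / D % (n + 1) ≤ n := Nat.lt_succ_iff.1 (Nat.mod_lt _ (Nat.succ_pos n))
    have htot : t / E / D / (n + 1) ≤ t :=
      (Nat.div_le_self _ _).trans ((Nat.div_le_self _ _).trans (Nat.div_le_self _ _))
    have hphe := L.ph_eq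
    have hi : t / E / D / (n + 1) ≤ k := by
      by_contra hcon
      have h1 := le_code (n := n) (D := D) (E := E) (i := t / E / D / (n + 1))
        (v := t / E / D % (n + 1)) (β := t / E % D) (S := t % E)
      rw [hcode] at h1
      have h2 := Nat.mul_le_mul_right ((n + 1) * (D * E)) (show k + 1 ≤ t / E / D / (n + 1) by
          omega)
      omega
    -- At level zero the entry is the indicator of `β = 0` and `S = 0`. Both hold exactly when the
    -- low part `β * E + S` of the code vanishes, which truncated subtraction from `1` detects.
    have hzero : t / E / D / (n + 1) = 0 → (1 - t % (D * E) = 1 ∧ t / E % D = 0 ∧ t % E = 0) ∨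
        (1 - t % (D * E) = 0 ∧ ¬ (t / E % D = 0 ∧ t % E = 0)) := by
      intro _
      have h1 : t % (D * E) = E * (t / E % D) + t % E := by
        rw [mul_comm D E, Nat.mod_mul, add_comm]
      rw [h1]
      by_cases h2 : t / E % D = 0 ∧ t % E = 0
      · left; simp [h2.1, h2.2]
      · right
        refine ⟨?_, h2⟩
        have : 0 < E * (t / E % D) + t % E := by
          rcases not_and_or.1 h2 with h3 | h3
          · exact Nat.add_pos_left (Nat.mul_pos hE (Nat.pos_of_ne_zero h3)) _
          · omega
        omega
    generalize t % E = S' at *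
    generalize t / E % D = β' at *
    generalize t / E / D % (n + 1) = v' at *
    generalize t / E / D / (n + 1) = i' at *
    have upd : ∀ x, x < m → (x : ZMod m) = walkSum n k A Y i' v' β' S' →
        (∀ a, Function.update mem' (bs + t) x a ≤ V) ∧
        (∀ a < bs, Function.update mem' (bs + t) x a = mem a) ∧
        (∀ i ≤ k, ∀ v ≤ n, ∀ β < D, ∀ S < E, code n D E i v β S < t + 1 →
          Function.update mem' (bs + t) x (bs + code n D E i v β S) < m ∧
          (Function.update mem' (bs + t) x (bs + code n D E i v β S) : ZMod m) =
            walkSum n k A Y i v β S) := by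
      intro x hx hx'
      refine ⟨fun a => ?_, fun a ha => ?_, ?_⟩
      · by_cases ha : a = bs + t
        · subst ha; rw [Function.update_self]; omega
        · rw [Function.update_of_ne ha]; exact hmem' a
      · rw [Function.update_of_ne (by omega)]; exact hlow a ha
      · intro i hi v hv β hβ S hS hlt
        by_cases heq : code n D E i v β S = t
        · obtain ⟨rfl, rfl, rfl, rfl⟩ := code_inj hv hβ hS ‹v' ≤ n› ‹β' < D› ‹S' < E›
            (heq.trans hcode.symm)
          rw [heq, Function.update_self]
          exact ⟨hx, hx'⟩
        · rw [Function.update_of_ne (by omega)]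
          exact hG i hi v hv β hβ S hS (by omega)
    refine ⟨by omega, by have := L.D_le; omega, by have := L.n_le; omega, by
      have := L.ph_eq; omega, ?_, ?_⟩
    · intro h0
      obtain ⟨j, rfl⟩ : ∃ j, i' = j + 1 := ⟨i' - 1, by omega⟩
      refine wp_rowCmd L hmem' A Y (fun v hv u hu => ?_) (fun e he => ?_) hi hv hβ hS
        (fun u hu γ hγ T hT => (hG j (by omega) u hu.le γ hγ T hT ?_).2) ?_
      · rw [← hA v hv u hu]
        refine hlow _ ?_
        have h1 := L.bs_eq
        have h2 := L.yb_eq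
        have h3 : v * n ≤ n * n := Nat.mul_le_mul_right n hv
        omega
      · rw [← hY e he, hlow _ (by have := L.bs_eq; omega)]
      -- Every code of level `j` is smaller than every code of level `j + 1`.
      · rw [← hcode]
        exact (code_lt hu.le hγ hT).trans_le le_code
      · intro u' src' acc' pj' uj' sg' bit' x' a' tm'' hx hx' htm''
        simp only [List.getD_cons_succ, List.getD_cons_zero]
        refine ⟨by omega, by omega, _, rfl, _, _, _, _, _, _, _, _, _, _, _, _, _, rfl, trivial, ?_⟩
        obtain ⟨u1, u2, u3⟩ := upd x' hx hx'
        exact ⟨u1, u2, u3, by rw [Nat.succ_mul]; omega⟩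
    · intro h0
      have hx : 1 - t % (D * E) < m := by omega
      refine ⟨by omega, by omega, _, rfl, _, _, _, _, _, _, _, _, _, _, _, _, _, rfl, trivial, ?_⟩
      obtain ⟨u1, u2, u3⟩ := upd _ hx (by
        rw [h0]
        simp only [walkSum, one]
        rcases hzero h0 with h1 | h1
        · simp [h1.1, h1.2.1, h1.2.2]
        · rw [h1.1]
          by_cases h2 : β' = 0
          · have h3 : S' ≠ 0 := fun h3 => h1.2 ⟨h2, h3⟩
            simp [h3]
          · simp [h2])
      exact ⟨u1, u2, u3, by rw [Nat.succ_mul]; omega⟩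
  · rintro ⟨ρ, mem', dr', tm'⟩
      ⟨u, S, src, acc, pj, uj, sg, bit, x, a, β, v, i, h1, h2, hmem', hlow, hG, htm⟩
    simp only at h1 h2 hmem' hlow hG htm
    subst h1 h2
    exact hQ _ _ _ _ _ _ _ _ _ _ _ _ _ mem' (tm' + 1)
      (fun i hi v hv β hβ S hS => hG i hi v hv β hβ S hS (code_lt_of_le hi hv hβ hS)) hmem' hlow
      (by omega)

end

end RAM

/-! ### Detecting the minimum weight and tracing back a path -/

namespace RAM

open Cmd Ex BitExterior

/-- Puts one plus the least weight with a nonzero top coefficient into register `25`. -/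
def detectCmd : Cmd :=
  set 25 (cst 0) >>
  rep (var 3)
    (ite (ld (var 9 + ((var 1 * (var 0 + cst 1) + var 0) * var 3 + (var 2 - var 27)) * var 4 +
        (var 4 - cst 1)))
      (set 25 (var 2 - var 27 + cst 1))
      skip)

/-- Pairs the current functional with an exterior product. -/
def pairCmd : Cmd :=
  set 20 (cst 0) >>
  rep (var 4)
    (set 13 (var 31) >> wedgeCmd >>
    set 20 (mod (var 20 + ld (var 10 + var 27 * var 4 + var 31) * var 15) (var 5)))

/-- Finds a next vertex and puts one plus this vertex into register `24`. -/
def pickCmd : Cmd :=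
  set 24 (cst 0) >>
  rep (var 0)
    (set 12 (var 29) >> set 21 (ld (var 23 * var 0 + var 29)) >>
    ite (var 21 * (var 22 + cst 2 - var 21))
      (set 14 (var 9 + ((var 26 * (var 0 + cst 1) + var 12) * var 3 +
          (var 22 + cst 1 - var 21)) * var 4) >>
        pairCmd >>
        ite (var 20) (set 24 (var 29 + cst 1)) skip)
      skip)

/-- Contracts the current functional with the vector of the vertex in register `12`. -/
def residualCmd : Cmd :=
  set 14 (var 10 + var 27 * var 4) >>
  rep (var 4)
    (set 13 (var 29) >> contractCmd >>
    put (var 10 + (var 27 + cst 1) * var 4 + var 29) (var 15))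

section

variable {coins : ℕ → Bool} {Q : St → Prop} {V n k B D E m b N yb bs ph pt : ℕ}
  (L : Layout V n k B D E m b N yb bs ph pt)
include L

theorem Layout.functional_lt {t S : ℕ} (ht : t ≤ k) (hS : S < E) : ph + t * E + S < pt := by
  have h1 := L.pt_eq
  have h2 : t * E + E ≤ (k + 1) * E := by
    rw [← Nat.succ_mul]; exact Nat.mul_le_mul_right _ (by omega)
  omega

/-- Weights are tried from `B` downwards, so the last hit is the least. The row inspected is that of
the source `n`, and the offset `1` leaves `0` free to mean that there was no hit. -/
theorem wp_detectCmd {w : List ℕ} {res : ℕ} {mem : ℕ → ℕ} {dr tm : ℕ} (hw : w.length = 13)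
    (hQ : ∀ res' tm',
      (res' = 0 → ∀ β < D, mem (bs + code n D E k n β (E - 1)) = 0) →
      (res' ≠ 0 → res' - 1 < D ∧ mem (bs + code n D E k n (res' - 1) (E - 1)) ≠ 0 ∧
        ∀ β < res' - 1, mem (bs + code n D E k n β (E - 1)) = 0) →
      tm' ≤ tm + (4 * D + 2) →
      Q ⟨[n, k, B, D, E, m, b, N, yb, bs, ph, pt] ++ w ++ [res'], mem, dr, tm'⟩) :
    detectCmd.wp coins V Q ⟨[n, k, B, D, E, m, b, N, yb, bs, ph, pt] ++ w ++ [res], mem, dr,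
      tm⟩ := by
  have hset : ∀ x y : ℕ, ([n, k, B, D, E, m, b, N, yb, bs, ph, pt] ++ w ++ [x]).set 25 y =
      [n, k, B, D, E, m, b, N, yb, bs, ph, pt] ++ w ++ [y] := by
    intro x y
    rw [List.set_append_right _ _ (by simp [hw])]
    simp [hw]
  have hset' : ∀ (x y : ℕ) (l : List ℕ),
      ([n, k, B, D, E, m, b, N, yb, bs, ph, pt] ++ w ++ [x] ++ l).set 25 y =
      [n, k, B, D, E, m, b, N, yb, bs, ph, pt] ++ w ++ [y] ++ l := by
    intro x y l
    rw [List.set_append_left _ _ (by simp [hw]), hset]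
  have hget : ∀ (x r t : ℕ),
      ([n, k, B, D, E, m, b, N, yb, bs, ph, pt] ++ w ++ [x] ++ [r, t]).getD 27 0 = t := by
    intro x r t
    rw [List.getD_append_right _ _ _ _ (by simp [hw])]
    simp [hw]
  have hD := L.D_eq
  have hDV := L.D_le
  simp only [detectCmd, wp_andThen, wp, eval_var, eval_cst, eval_add, eval_sub, eval_mul,
    eval_ld, hset]
  simp only [List.cons_append, List.nil_append, List.getD_cons_succ, List.getD_cons_zero]
  refine ⟨by omega, by omega, fun t st => ∃ res', st.ρ =
    [n, k, B, D, E, m, b, N, yb, bs, ph, pt] ++ w ++ [res'] ∧ st.mem = mem ∧ st.dr = dr ∧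
    (∀ β ≤ B, B < β + t → mem (bs + code n D E k n β (E - 1)) ≠ 0 → res' ≠ 0 ∧ res' ≤ β + 1) ∧
    (res' ≠ 0 → res' - 1 < D ∧ mem (bs + code n D E k n (res' - 1) (E - 1)) ≠ 0) ∧
    st.tm ≤ tm + (4 * t + 1), ?_, ?_, ?_⟩
  · exact ⟨0, rfl, rfl, rfl, fun β h1 h2 => by omega, fun h => absurd rfl h, le_rfl⟩
  · rintro t ht ⟨ρ, mem', dr', tm'⟩ ⟨res', h1, h2, h3, h4, h5, htm⟩
    simp only at h1 h2 h3 htm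
    subst h1 h2 h3
    simp only [hset', hget]
    simp only [List.cons_append, List.nil_append, List.getD_cons_succ, List.getD_cons_zero]
    have hc : bs + ((k * (n + 1) + n) * D + (B - t)) * E + (E - 1) =
        bs + code n D E k n (B - t) (E - 1) := by rw [code, add_assoc]
    rw [hc]
    refine ⟨fun h0 => ⟨by omega, _, by simp only [← List.cons_append], B - t + 1, rfl,
      trivial, trivial, ?_, ?_, by omega⟩,
      fun h0 => ⟨_, by simp only [← List.cons_append], res', rfl, trivial, trivial,
      ?_, h5, by omega⟩⟩
    · intro β hβ hβt hne
      omega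
    · intro _
      rw [Nat.add_sub_cancel]
      exact ⟨by omega, h0⟩
    · intro β hβ hβt hne
      by_cases hlt : B < β + t
      · exact h4 β hβ hlt hne
      · obtain rfl : β = B - t := by omega
        exact absurd h0 hne
  · rintro ⟨ρ, mem', dr', tm'⟩ ⟨res', h1, h2, h3, h4, h5, htm⟩
    simp only at h1 h2 h3 htm
    subst h1 h2 h3
    refine hQ res' (tm' + 1) (fun h0 β hβ => ?_) (fun h0 => ⟨(h5 h0).1, (h5 h0).2,
      fun β hβ => ?_⟩) (by omega)
    · by_contra hne
      exact (h4 β (by omega) (by omega) hne).1 h0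
    · by_contra hne
      have h6 := (h4 β (by have := (h5 h0).1; omega) (by have := (h5 h0).1; omega) hne).2
      omega

theorem wp_pairCmd {u S src acc pj uj sg bit x a β v i res r t r' q : ℕ} {mem : ℕ → ℕ}
    {dr tm : ℕ} (hu : u < n) (φ f : ℕ → ZMod m)
    (hφ : ∀ S < E, (mem (ph + t * E + S) : ZMod m) = φ S)
    (hf : ∀ T < E, (mem (src + T) : ZMod m) = f T)
    (hQ : ∀ S' acc' pj' uj' sg' bit' x' tm', x' < m →
      (x' : ZMod m) = pair k φ (wedge k (powers (ZMod m) u) f) →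
      tm' ≤ tm + (E * (7 * k + 8) + 2) →
      Q ⟨[n, k, B, D, E, m, b, N, yb, bs, ph, pt, u, S', src, acc', pj', uj', sg', bit', x', a, β,
        v, i, res, r, t, r', q], mem, dr, tm'⟩) :
    pairCmd.wp coins V Q ⟨[n, k, B, D, E, m, b, N, yb, bs, ph, pt, u, S, src, acc, pj, uj, sg, bit,
      x, a, β, v, i, res, r, t, r', q], mem, dr, tm⟩ := by
  simp only [pairCmd, wp_andThen, wp, eval_var, eval_cst, eval_mod, eval_add, eval_mul,
    eval_ld, List.getD_cons_zero, List.getD_cons_succ, List.set_cons_succ, List.set_cons_zero]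
  have hm := L.two_le_m
  have hEV : E ≤ V := L.E_eq ▸ L.E_le
  refine ⟨by omega, hEV, fun t' st => ∃ S acc pj uj sg bit x, st.ρ =
    [n, k, B, D, E, m, b, N, yb, bs, ph, pt, u, S, src, acc, pj, uj, sg, bit, x, a, β, v, i,
      res, r, t, r', q] ∧ st.mem = mem ∧ st.dr = dr ∧ x < m ∧ (x : ZMod m) =
        ∑ S ∈ Finset.range t', φ S * wedge k (powers (ZMod m) u) f S ∧
      st.tm ≤ tm + (t' * (7 * k + 8) + 1), ?_, ?_, ?_⟩
  · exact ⟨S, acc, pj, uj, sg, bit, 0, rfl, rfl, rfl, by omega, by simp, by simp⟩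
  · rintro t' ht ⟨ρ, mem', dr', tm'⟩ ⟨S, acc, pj, uj, sg, bit, x, h1, h2, h3, hx, hx', htm⟩
    simp only at h1 h2 h3 htm
    subst h1 h2 h3
    simp only [List.cons_append, List.nil_append, List.getD_cons_succ, List.getD_cons_zero,
      List.set_cons_succ, List.set_cons_zero]
    refine ⟨by omega, wp_wedgeCmd L.two_le_m L.m_le L.E_le (L.powers_le hu) f (L.E_eq ▸ ht)
      (fun T hT => hf T (L.E_eq ▸ hT)) ?_⟩
    intro acc' pj' uj' sg' bit' tm'' _ hacc htm''
    simp only [List.getD_cons_succ, List.getD_cons_zero, List.set_cons_succ, List.set_cons_zero]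
    refine ⟨(Nat.mod_lt _ (by omega)).le.trans L.m_le, _, rfl, _, _, _, _, _, _, _, rfl,
      trivial, trivial, Nat.mod_lt _ (by omega), ?_, by rw [Nat.succ_mul]; omega⟩
    rw [Finset.sum_range_succ, ← hx', ZMod.natCast_mod]
    push_cast
    rw [hacc, hφ _ ht]
  · rintro ⟨ρ, mem', dr', tm'⟩ ⟨S, acc, pj, uj, sg, bit, x, h1, h2, h3, hx, hx', htm⟩
    simp only at h1 h2 h3 htm
    subst h1 h2 h3
    rw [L.E_eq] at hx'
    exact hQ _ _ _ _ _ _ _ (tm' + 1) hx hx' (by omega)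

/-- All heads are tried and the last one with a nonzero pairing is kept; the assumed existence
guarantees that there is one. -/
theorem wp_pickCmd {u S src acc pj uj sg bit x a β v i res r t : ℕ} {mem : ℕ → ℕ} {dr tm : ℕ}
    (hmem : ∀ a, mem a ≤ V) (A : ℕ → ℕ → ℕ) (Y φ : ℕ → ZMod m)
    (hA : ∀ v ≤ n, ∀ u < n, mem (v * n + u) = A v u)
    (hφ : ∀ S < E, (mem (ph + t * E + S) : ZMod m) = φ S)
    (hr : r ≤ k) (hv : v ≤ n) (hβ : β < D)
    (hG : ∀ u < n, ∀ γ < D, ∀ T < E, (mem (bs + code n D E r u γ T) : ZMod m) =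
      walkSum n k A Y r u γ T)
    (hex : ∃ u < n, (A v u ≠ 0 ∧ A v u ≤ β + 1) ∧
      pair k φ (wedge k (powers (ZMod m) u) (walkSum n k A Y r u (β + 1 - A v u))) ≠ 0)
    (hQ : ∀ u' S' src' acc' pj' uj' sg' bit' x' a' tm' y, y < n → A v y ≠ 0 → A v y ≤ β + 1 →
      pair k φ (wedge k (powers (ZMod m) y) (walkSum n k A Y r y (β + 1 - A v y))) ≠ 0 →
      tm' ≤ tm + (n * (E * (7 * k + 8) + 9) + 2) →
      Q ⟨[n, k, B, D, E, m, b, N, yb, bs, ph, pt, u', S', src', acc', pj', uj', sg', bit', x', a',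
        β, v, y + 1, res, r, t], mem, dr, tm'⟩) :
    pickCmd.wp coins V Q ⟨[n, k, B, D, E, m, b, N, yb, bs, ph, pt, u, S, src, acc, pj, uj, sg, bit,
      x, a, β, v, i, res, r, t], mem, dr, tm⟩ := by
  simp only [pickCmd, wp_andThen, wp, eval_var, eval_cst, eval_add, eval_sub, eval_mul,
    eval_ld, List.getD_cons_zero, List.set_cons_succ, List.set_cons_zero]
  have hm := L.two_le_m
  have hEV : E ≤ V := L.E_eq ▸ L.E_le
  have hnV := L.n_le
  set good : ℕ → Prop := fun u => (A v u ≠ 0 ∧ A v u ≤ β + 1) ∧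
      pair k φ (wedge k (powers (ZMod m) u) (walkSum n k A Y r u (β + 1 - A v u))) ≠ 0 with hgood
  refine ⟨by omega, hnV, fun t' st => ∃ u S src acc pj uj sg bit x a i, st.ρ =
    [n, k, B, D, E, m, b, N, yb, bs, ph, pt, u, S, src, acc, pj, uj, sg, bit, x, a, β, v, i,
      res, r, t] ∧ st.mem = mem ∧ st.dr = dr ∧ (i = 0 → ∀ y < t', ¬ good y) ∧
      (i ≠ 0 → i - 1 < n ∧ good (i - 1)) ∧
      st.tm ≤ tm + (t' * (E * (7 * k + 8) + 9) + 1), ?_, ?_, ?_⟩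
  · exact ⟨u, S, src, acc, pj, uj, sg, bit, x, a, 0, rfl, rfl, rfl, fun _ y h => by omega,
      fun h => absurd rfl h, by simp⟩
  · rintro t' ht ⟨ρ, mem', dr', tm'⟩
      ⟨u, S, src, acc, pj, uj, sg, bit, x, a, i, h1, h2, h3, hi0, hi1, htm⟩
    simp only at h1 h2 h3 htm
    subst h1 h2 h3
    simp only [List.cons_append, List.nil_append, List.getD_cons_succ, List.getD_cons_zero,
      List.set_cons_succ, List.set_cons_zero]
    refine ⟨by omega, hmem _, ?_, ?_⟩ <;> rw [hA v hv t' ht]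
    · intro hc
      rw [cond_ne_zero_iff] at hc
      have hγ : β + 1 - A v t' < D := by omega
      refine ⟨?_, ?_⟩
      · have := L.bs_add_code_lt hr ht.le hγ L.E_pos
        simp only [code] at this
        have := L.ph_le
        omega
      · refine wp_pairCmd L ht φ (walkSum n k A Y r t' (β + 1 - A v t')) hφ ?_ ?_
        · intro T hT
          rw [← hG t' ht _ hγ T hT, code, add_assoc]
        · intro S' acc' pj' uj' sg' bit' x' tm'' hx hx' htm''
          simp only [List.getD_cons_succ, List.getD_cons_zero, List.set_cons_succ,
            List.set_cons_zero]
          refine ⟨fun h0 => ⟨by omega, _, rfl, _, _, _, _, _, _, _, _, _, _, _, rfl, trivial,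
            trivial, fun h => absurd h (Nat.succ_ne_zero _), fun _ => ⟨ht, hc, ?_⟩, by
            rw [Nat.succ_mul]; omega⟩,
            fun h0 => ⟨_, rfl, _, _, _, _, _, _, _, _, _, _, _, rfl, trivial,
            trivial, fun h y hy => ?_, hi1, by
            rw [Nat.succ_mul]; omega⟩⟩
          -- The computed number is below `m`, so being nonzero as a number and as a residue are the
          -- same.
          · rw [Nat.succ_sub_one, ← hx']
            intro h1
            rw [ZMod.natCast_eq_zero_iff] at h1
            exact h0 (Nat.eq_zero_of_dvd_of_lt h1 hx)
          · rcases Nat.lt_succ_iff_lt_or_eq.1 hy with hy | rfl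
            · exact hi0 h y hy
            · intro hg
              apply hg.2
              rw [← hx', h0, Nat.cast_zero]
    · intro hc
      have hc' := mt cond_ne_zero_iff.2 (not_not.2 hc)
      refine ⟨_, rfl, _, _, _, _, _, _, _, _, _, _, _, rfl, trivial, trivial, fun h y hy => ?_, hi1,
        by rw [Nat.succ_mul]; omega⟩
      rcases Nat.lt_succ_iff_lt_or_eq.1 hy with hy | rfl
      · exact hi0 h y hy
      · exact fun hg => hc' hg.1
  · rintro ⟨ρ, mem', dr', tm'⟩
      ⟨u, S, src, acc, pj, uj, sg, bit, x, a, i, h1, h2, h3, hi0, hi1, htm⟩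
    simp only at h1 h2 h3 htm
    subst h1 h2 h3
    have hi : i ≠ 0 := fun h => by
      obtain ⟨y, hy, hg⟩ := hex
      exact hi0 h y hy hg
    obtain ⟨y, rfl⟩ : ∃ y, i = y + 1 := ⟨i - 1, by omega⟩
    obtain ⟨h1, h2⟩ := hi1 hi
    rw [Nat.add_sub_cancel] at h1 h2
    exact hQ _ _ _ _ _ _ _ _ _ _ (tm' + 1) y h1 h2.1.1 h2.1.2 h2.2 (by omega)

/-- Each step of the traceback writes its functional into a new row, so the row being contracted is
never overwritten. -/
theorem wp_residualCmd {u S src acc pj uj sg bit x a β v i res r t : ℕ} {mem : ℕ → ℕ} {dr tm : ℕ}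
    (hmem : ∀ a, mem a ≤ V) (φ : ℕ → ZMod m) (hu : u < n) (ht : t < k)
    (hφ : ∀ S < E, (mem (ph + t * E + S) : ZMod m) = φ S)
    (hQ : ∀ S' src' acc' pj' uj' sg' bit' mem' tm', (∀ a, mem' a ≤ V) →
      (∀ a, (a < ph + (t + 1) * E ∨ pt ≤ a) → mem' a = mem a) →
      (∀ S < E, (mem' (ph + (t + 1) * E + S) : ZMod m) = contract k (powers (ZMod m) u) φ S) →
      tm' ≤ tm + (E * (7 * k + 8) + 2) →
      Q ⟨[n, k, B, D, E, m, b, N, yb, bs, ph, pt, u, S', src', acc', pj', uj', sg', bit', x, a,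
        β, v, i, res, r, t], mem', dr, tm'⟩) :
    residualCmd.wp coins V Q ⟨[n, k, B, D, E, m, b, N, yb, bs, ph, pt, u, S, src, acc, pj, uj, sg,
      bit, x, a, β, v, i, res, r, t], mem, dr, tm⟩ := by
  simp only [residualCmd, wp_andThen, wp, eval_var, eval_cst, eval_add, eval_mul,
    List.getD_cons_zero, List.getD_cons_succ, List.set_cons_succ, List.set_cons_zero]
  have hm := L.two_le_m
  have hmV := L.m_le
  have hEV : E ≤ V := L.E_eq ▸ L.E_le
  have hend := L.end_le
  have hlt := fun S (hS : S < E) => L.functional_lt (t := t + 1) ht hS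
  have hlt0 := L.functional_lt ht.le L.E_pos
  have hsucc : (t + 1) * E = t * E + E := Nat.succ_mul _ _
  refine ⟨by omega, hEV, fun t' st => ∃ S acc pj uj sg bit, st.ρ =
    [n, k, B, D, E, m, b, N, yb, bs, ph, pt, u, S, ph + t * E, acc, pj, uj, sg, bit, x, a, β, v, i,
      res, r, t] ∧ st.dr = dr ∧ (∀ a, st.mem a ≤ V) ∧
      (∀ a, (a < ph + (t + 1) * E ∨ pt ≤ a) → st.mem a = mem a) ∧
      (∀ S < t', (st.mem (ph + (t + 1) * E + S) : ZMod m) = contract k (powers (ZMod m) u) φ S) ∧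
      st.tm ≤ tm + (t' * (7 * k + 8) + 1), ?_, ?_, ?_⟩
  · exact ⟨S, acc, pj, uj, sg, bit, rfl, rfl, hmem, fun _ _ => rfl, fun _ h => by omega, by simp⟩
  · rintro t' ht' ⟨ρ, mem', dr', tm'⟩
      ⟨S, acc, pj, uj, sg, bit, h1, h2, hV', hlow, hdone, htm⟩
    simp only at h1 h2 hV' hlow hdone htm
    subst h1 h2
    simp only [List.cons_append, List.nil_append, List.getD_cons_succ, List.getD_cons_zero,
      List.set_cons_succ, List.set_cons_zero]
    refine ⟨by omega, wp_contractCmd L.two_le_m L.m_le L.E_le (L.powers_le hu) φ (L.E_eq ▸ ht')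
      (fun T hT => ?_) ?_⟩
    · rw [← L.E_eq] at hT
      rw [← hφ T hT, hlow _ (Or.inl (by omega))]
    · intro acc' pj' uj' sg' bit' tm'' hacc hacc' htm''
      simp only [List.getD_cons_succ, List.getD_cons_zero]
      have := hlt t' ht'
      refine ⟨by omega, by omega, _, rfl, _, _, _, _, _, _, rfl, trivial, fun a => ?_,
        fun a ha => ?_, fun S hS => ?_, by rw [Nat.succ_mul]; omega⟩
      · by_cases ha : a = ph + (t + 1) * E + t'
        · subst ha; rw [Function.update_self]; omega
        · rw [Function.update_of_ne ha]; exact hV' a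
      · rw [Function.update_of_ne (by omega)]; exact hlow a ha
      · by_cases h : S = t'
        · subst h; rw [Function.update_self, hacc']
        · rw [Function.update_of_ne (by omega)]; exact hdone S (by omega)
  · rintro ⟨ρ, mem', dr', tm'⟩ ⟨S, acc, pj, uj, sg, bit, h1, h2, hV', hlow, hdone, htm⟩
    simp only at h1 h2 hV' hlow hdone htm
    subst h1 h2
    exact hQ _ _ _ _ _ _ _ mem' (tm' + 1) hV' hlow hdone (by omega)

end

end RAM

/-! ### The traceback loop -/

namespace RAM

open Cmd Ex BitExterior

/-- Traces back a path of the weight that is one less than the number in register `25`, and writes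
it into the first memory cells. -/
def traceCmd : Cmd :=
  set 22 (var 25 - cst 1) >> set 23 (var 0) >>
  rep (var 4) (put (var 10 + var 27) (var 27 + cst 2 - var 4)) >>
  rep (var 1)
    (pickCmd >> set 12 (var 24 - cst 1) >> residualCmd >>
    set 22 (var 22 + cst 1 - ld (var 23 * var 0 + var 12)) >> set 23 (var 12) >>
    put (var 11 + var 27) (var 12)) >>
  rep (var 1) (put (var 27) (ld (var 11 + var 27)))

section

variable {coins : ℕ → Bool} {Q : St → Prop} {V n k B D E m b N yb bs ph pt : ℕ}
  (L : Layout V n k B D E m b N yb bs ph pt)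
include L

/-- The source, top functional and detected weight start the descent. Distinctness of the vertices
is not maintained on the way; it is read off from the nonzero pairing at the end. -/
theorem wp_traceCmd {u S src acc pj uj sg bit x a β v i res : ℕ} {mem : ℕ → ℕ} {dr tm : ℕ}
    (hmem : ∀ a, mem a ≤ V) (A : ℕ → ℕ → ℕ) (Y : ℕ → ZMod m)
    (hA : ∀ v ≤ n, ∀ u < n, mem (v * n + u) = A v u)
    (hG : ∀ i ≤ k, ∀ v ≤ n, ∀ β < D, ∀ S < E, (mem (bs + code n D E i v β S) : ZMod m) =
      walkSum n k A Y i v β S)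
    (hres : res < D) (hne : walkSum n k A Y k n res (E - 1) ≠ 0)
    (hQ : ∀ w mem' tm' (xs : List ℕ), w.length = 13 → xs.length = k → xs.Nodup →
      (∀ x ∈ xs, x < n) → IsWalk A n xs res → (∀ j < k, mem' j = xs.getD j 0) →
      tm' ≤ tm + (k * ((n + 1) * (E * (7 * k + 8) + 9) + 9) + 2 * E + 2 * k + 6) →
      Q ⟨[n, k, B, D, E, m, b, N, yb, bs, ph, pt] ++ w ++ [res + 1], mem', dr, tm'⟩) :
    traceCmd.wp coins V Q ⟨[n, k, B, D, E, m, b, N, yb, bs, ph, pt, u, S, src, acc, pj, uj, sg,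
      bit, x, a, β, v, i, res + 1], mem, dr, tm⟩ := by
  have hm := L.two_le_m
  have hmV := L.m_le
  have hE0 := L.E_pos
  have hEV : E ≤ V := L.E_eq ▸ L.E_le
  have hnV := L.n_le
  have hDV := L.D_le
  have hend := L.end_le
  have hpt := L.pt_eq
  have hn := L.n_pos
  have hyb := L.yb_eq
  have hbs := L.bs_eq
  have hph := L.ph_eq
  have hphE := fun S (hS : S < E) => L.functional_lt (t := 0) (Nat.zero_le k) hS
  simp only [zero_mul, add_zero] at hphE
  simp only [traceCmd, wp_andThen, wp, eval_var, eval_cst, eval_add, eval_sub, eval_ld,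
    List.getD_cons_zero, List.getD_cons_succ, List.set_cons_succ, List.set_cons_zero,
    Nat.add_sub_cancel]
  refine ⟨by omega, by omega, hEV, fun t st => st.ρ =
    [n, k, B, D, E, m, b, N, yb, bs, ph, pt, u, S, src, acc, pj, uj, sg, bit, x, a, res, n, i,
      res + 1] ∧ st.dr = dr ∧ (∀ a, st.mem a ≤ V) ∧ (∀ a < ph, st.mem a = mem a) ∧
      (∀ S < t, (st.mem (ph + S) : ZMod m) = top (ZMod m) k S) ∧ st.tm ≤ tm + (2 * t + 2),
      ?_, ?_, ?_⟩
  · exact ⟨rfl, rfl, hmem, fun _ _ => rfl, fun _ h => by omega, le_rfl⟩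
  · rintro t ht ⟨ρ, mem', dr', tm'⟩ ⟨h1, h2, hV', hlow, hdone, htm⟩
    simp only at h1 h2 hV' hlow hdone htm
    subst h1 h2
    simp only [List.cons_append, List.nil_append, List.getD_cons_succ, List.getD_cons_zero]
    have := hphE t ht
    refine ⟨by omega, by omega, _, rfl, rfl, trivial, fun a => ?_, fun a ha => ?_, fun S hS => ?_,
      by omega⟩
    · by_cases ha : a = ph + t
      · subst ha; rw [Function.update_self]; omega
      · rw [Function.update_of_ne ha]; exact hV' a
    · rw [Function.update_of_ne (by omega)]; exact hlow a ha
    · by_cases h : S = t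
      · subst h
        rw [Function.update_self, top, ← L.E_eq]
        by_cases h1 : S = E - 1
        -- For `S < E` the truncated difference `S + 2 - E` is `1` at the full mask `E - 1` and `0`
        -- elsewhere.
        · rw [if_pos h1, show S + 2 - E = 1 by omega, Nat.cast_one]
        · rw [if_neg h1, show S + 2 - E = 0 by omega, Nat.cast_zero]
      · rw [Function.update_of_ne (by omega)]; exact hdone S (by omega)
  · rintro ⟨ρ, mem1, dr', tm1⟩ ⟨h1, h2, hV1, hlow1, htop, htm1⟩
    simp only at h1 h2 hV1 hlow1 htop htm1
    subst h1 h2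
    simp only [List.getD_cons_succ, List.getD_cons_zero]
    have hcodelt : ∀ i ≤ k, ∀ v ≤ n, ∀ β < D, ∀ S < E, bs + code n D E i v β S < ph :=
      fun i hi v hv β hβ S hS => L.bs_add_code_lt hi hv hβ hS
    have hmat : ∀ v ≤ n, ∀ u < n, v * n + u < ph := by
      intro v hv u hu
      have h3 : v * n ≤ n * n := Nat.mul_le_mul_right n hv
      omega
    -- Invariant: `xs` is a walk from the source to `v` of weight `γ`, the weight `β` with `γ + β =
    -- res` is left, and the functional of `xs` pairs nontrivially with the walk sum of the
    -- remaining `k - t` edges.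
    refine ⟨by omega, fun t st => ∃ u S src acc pj uj sg bit x a β v i, ∃ xs : List ℕ, st.ρ =
      [n, k, B, D, E, m, b, N, yb, bs, ph, pt, u, S, src, acc, pj, uj, sg, bit, x, a, β, v, i,
      res + 1] ∧ st.dr = dr' ∧ (∀ a, st.mem a ≤ V) ∧ (∀ a < ph, st.mem a = mem a) ∧
      xs.length = t ∧ (∀ x ∈ xs, x < n) ∧ (∃ γ, IsWalk A n xs γ ∧ γ + β = res) ∧
      v = xs.getLast?.getD n ∧ v ≤ n ∧
      (∀ S < E, (st.mem (ph + t * E + S) : ZMod m) = residual (ZMod m) k xs S) ∧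
      (∀ j < t, st.mem (pt + j) = xs.getD j 0) ∧
      pair k (residual (ZMod m) k xs) (walkSum n k A Y (k - t) v β) ≠ 0 ∧
      st.tm ≤ tm1 + 1 + t * ((n + 1) * (E * (7 * k + 8) + 9) + 9), ?_, ?_, ?_⟩
    · refine ⟨_, _, _, _, _, _, _, _, _, _, _, _, _, [], rfl, rfl, hV1, hlow1, rfl, by simp,
        ⟨0, rfl, Nat.zero_add _⟩, by simp, le_rfl, fun S hS => ?_, fun j hj => by omega, ?_,
        by change tm1 + 1 ≤ _; omega⟩
      · simpa [BitExterior.residual] using htop S hS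
      · rw [pair_residual]
        simpa [wedges, ← L.E_eq] using hne
    · rintro t ht ⟨ρ, mem2, dr2, tm2⟩ ⟨u, S, src, acc, pj, uj, sg, bit, x, a, β, v, i, xs, h1, h2,
        hV2, hlow2, hlen, hxs, ⟨γ, hwalk, hγ⟩, hv, hvn, hres2, hpath, hpair, htm2⟩
      simp only at h1 h2 hV2 hlow2 hres2 hpath htm2
      subst h1 h2
      simp only [List.cons_append, List.nil_append]
      have hkt : k - t = k - 1 - t + 1 := by omega
      rw [hkt] at hpair
      refine wp_pickCmd L hV2 A Y (residual (ZMod m) k xs)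
        (fun v hv u hu => by rw [hlow2 _ (hmat v hv u hu), hA v hv u hu]) hres2 (by omega) hvn
        (by omega) (fun u hu γ hγ T hT => ?_) (exists_of_pair_walkSum_ne_zero hpair) ?_
      · rw [hlow2 _ (hcodelt _ (by omega) u hu.le γ hγ T hT)]
        exact hG _ (by omega) u hu.le γ hγ T hT
      · intro u' S' src' acc' pj' uj' sg' bit' x' a' tm3 y hy hAy hAy' hpy htm3
        simp only [wp_andThen, wp, eval_var, eval_cst, eval_sub, List.getD_cons_succ,
          List.getD_cons_zero, List.set_cons_succ, List.set_cons_zero, Nat.add_sub_cancel]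
        refine ⟨by omega, wp_residualCmd L hV2 (residual (ZMod m) k xs) hy ht hres2 ?_⟩
        intro S'' src'' acc'' pj'' uj'' sg'' bit'' mem4 tm4 hV4 hlow4 hres4 htm4
        simp only [wp_andThen, wp, eval_var, eval_cst, eval_add, eval_sub, eval_mul, eval_ld,
          List.getD_cons_succ, List.getD_cons_zero, List.set_cons_succ,
          List.set_cons_zero]
        have hmemA : mem4 (v * n + y) = A v y := by
          rw [hlow4 _ (Or.inl (by have := hmat v hvn y hy; omega)), hlow2 _ (hmat v hvn y hy),
            hA v hvn y hy]
        rw [hmemA]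
        have hflt := fun S (hS : S < E) => L.functional_lt (t := t + 1) ht hS
        refine ⟨by omega, by omega, by omega, by omega, _, rfl, _, _, _, _, _, _, _, _, _, _, _, _,
          _, xs ++ [y], rfl, trivial, fun a => ?_, fun a ha => ?_, by simp [hlen], ?_,
          ⟨γ + (A v y - 1), ?_, by omega⟩, by simp, hy.le, fun S hS => ?_, fun j hj => ?_, ?_, ?_⟩
        · by_cases ha : a = pt + t
          · subst ha; rw [Function.update_self]; omega
          · rw [Function.update_of_ne ha]; exact hV4 a
        · rw [Function.update_of_ne (by omega), hlow4 _ (Or.inl (by omega)), hlow2 a ha]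
        · intro z hz
          rcases List.mem_append.1 hz with hz | hz
          · exact hxs z hz
          · rw [List.mem_singleton.1 hz]; exact hy
        · refine hwalk.append ?_
          rw [← hv]
          exact ⟨hAy, by omega, by simp only [IsWalk]; omega⟩
        · have := hflt S hS
          rw [Function.update_of_ne (by omega), hres4 S hS, residual_append]
        · by_cases h : j = t
          · subst h
            rw [Function.update_self, List.getD_append_right _ _ _ _ hlen.le]
            simp [hlen]
          · rw [Function.update_of_ne (by omega), List.getD_append _ _ _ _ (by omega),
              hlow4 _ (Or.inr (by omega)), hpath j (by omega)]
        · rw [residual_append, ← pair_wedge, show k - (t + 1) = k - 1 - t by omega]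
          exact hpy
        · have h9 := add_one_mul n (E * (7 * k + 8) + 9)
          rw [Nat.succ_mul t]
          omega
    · rintro ⟨ρ, mem2, dr2, tm2⟩ ⟨u, S, src, acc, pj, uj, sg, bit, x, a, β, v, i, xs, h1, h2,
        hV2, hlow2, hlen, hxs, ⟨γ, hwalk, hγ⟩, hv, hvn, hres2, hpath, hpair, htm2⟩
      simp only at h1 h2 hV2 hlow2 hres2 hpath htm2
      subst h1 h2
      rw [Nat.sub_self] at hpair
      obtain ⟨hβ, hnd⟩ := of_pair_residual_ne_zero hpair
      simp only [List.getD_cons_succ, List.getD_cons_zero]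
      -- The path goes over the matrix only now, when the matrix is no longer needed. Cells from `t`
      -- on are untouched, and `pt + t` is among them.
      refine ⟨by omega, fun t st => st.ρ =
        [n, k, B, D, E, m, b, N, yb, bs, ph, pt, u, S, src, acc, pj, uj, sg, bit, x, a, β, v, i,
        res + 1] ∧ st.dr = dr2 ∧ (∀ a, st.mem a ≤ V) ∧ (∀ a, t ≤ a → st.mem a = mem2 a) ∧
        (∀ j < t, st.mem j = xs.getD j 0) ∧ st.tm ≤ tm2 + 1 + 2 * t, ?_, ?_, ?_⟩
      · exact ⟨rfl, rfl, hV2, fun _ _ => rfl, fun _ h => by omega, le_rfl⟩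
      · rintro t ht ⟨ρ, mem3, dr3, tm3⟩ ⟨h1, h2, hV3, hhigh, hdone, htm⟩
        simp only at h1 h2 hV3 hhigh hdone htm
        subst h1 h2
        simp only [List.cons_append, List.nil_append, List.getD_cons_succ, List.getD_cons_zero]
        refine ⟨by omega, hV3 _, _, rfl, rfl, trivial, fun a => ?_, fun a ha => ?_, fun j hj => ?_,
          by omega⟩
        · by_cases ha : a = t
          · subst ha; rw [Function.update_self]; exact hV3 _
          · rw [Function.update_of_ne ha]; exact hV3 a
        · rw [Function.update_of_ne (by omega)]; exact hhigh a (by omega)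
        · by_cases h : j = t
          · subst h; rw [Function.update_self, hhigh _ (by omega), hpath j ht]
          · rw [Function.update_of_ne h]; exact hdone j (by omega)
      · rintro ⟨ρ, mem3, dr3, tm3⟩ ⟨h1, h2, hV3, hhigh, hdone, htm⟩
        simp only at h1 h2 hV3 hhigh hdone htm
        subst h1 h2
        refine hQ [u, S, src, acc, pj, uj, sg, bit, x, a, β, v, i] mem3 (tm3 + 1) xs rfl hlen hnd
            hxs
          ?_ hdone (by omega)
        rwa [show res = γ by omega]

end

end RAM

/-! ### Preparations: the parameters, the layout of the memory, and the random numbers -/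

namespace RAM

open Cmd Ex BitExterior

/-- Bounds the number in register `2` by `k` times the greatest entry of the matrix. -/
def clipCmd : Cmd :=
  rep (var 0 * var 0) (set 3 (var 3 + (ld (var 27) - var 3))) >>
  set 2 (var 2 - (var 2 - var 1 * var 3))

/-- The least `b` with `n ≤ 2 ^ b` in register `6`, with `2 ^ b` in register `7`. -/
def bitsCmd : Cmd :=
  set 6 (cst 0) >> set 7 (cst 1) >>
  rep (var 0)
    (set 8 (cst 1 - (cst 1 - (var 0 - var 7))) >> set 6 (var 6 + var 8) >>
    set 7 (var 7 + var 7 * var 8))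

/-- Multiplies register `i` by a power of register `j`. -/
def powCmd (e : Ex) (i j : ℕ) : Cmd := rep e (set i (var i * var j))

/-- Computes the parameters, the modulus and the layout of the memory, and appends a row of ones to
the matrix. -/
def setupCmd (c : ℕ) : Cmd :=
  set 3 (var 2 + cst 1) >> bitsCmd >> set 6 (var 6 * cst (c + 1)) >>
  set 4 (cst 1) >> set 9 (cst 2) >> powCmd (var 1) 4 9 >>
  set 5 (var 0 * var 1) >> powCmd (var 1) 5 0 >> powCmd (cst (c + 1)) 5 7 >>
  set 8 (cst 1) >> powCmd (var 1) 8 5 >> set 5 (var 8 + cst 1) >>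
  set 7 (var 1 * ((var 0 + cst 1) * var 0)) >> set 8 (var 0 * var 0 + var 0) >>
  set 9 (var 8 + var 7) >>
  set 10 (var 9 + (var 1 + cst 1) * ((var 0 + cst 1) * (var 3 * var 4))) >>
  set 11 (var 10 + (var 1 + cst 1) * var 4) >>
  rep (var 0) (put (var 0 * var 0 + var 27) (cst 1))

/-- Draws the random numbers. -/
def drawCmd : Cmd :=
  rep (var 7)
    (set 20 (cst 0) >> rep (var 6) (flip 21 >> set 20 (cst 2 * var 20 + var 21)) >>
    put (var 8 + var 27) (var 20))

variable {coins : ℕ → Bool} {Q : St → Prop} {V : ℕ}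

/-- A `k`-path weighs at most `k` times the greatest entry, so lowering `B` to this value loses no
path and makes the later numbers independent of `B`. Maximum and minimum are computed by truncated
subtraction. -/
theorem wp_clipCmd {n k B M : ℕ} {mem : ℕ → ℕ} {dr tm : ℕ} (hmem : ∀ a, mem a ≤ M)
    (hM : M ≤ V) (hB : B ≤ V) (hn : n * n ≤ V)
    (hQ : ∀ M' tm', M' ≤ M → (∀ a < n * n, mem a ≤ M') → tm' ≤ tm + (2 * (n * n) + 2) →
      Q ⟨[n, k, min B (k * M'), M', 0, 0, 0, 0, 0, 0, 0, 0, 0, 0, 0, 0, 0, 0, 0, 0, 0, 0, 0, 0,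
        0, 0], mem, dr, tm'⟩) :
    clipCmd.wp coins V Q ⟨[n, k, B, 0, 0, 0, 0, 0, 0, 0, 0, 0, 0, 0, 0, 0, 0, 0, 0, 0, 0, 0, 0, 0,
      0, 0], mem, dr, tm⟩ := by
  simp only [clipCmd, wp_andThen, wp, eval_var, eval_add, eval_sub, eval_mul,
    eval_ld, List.getD_cons_zero]
  refine ⟨hn, fun t st => ∃ M', st.ρ = [n, k, B, M', 0, 0, 0, 0, 0, 0, 0, 0, 0, 0, 0, 0, 0, 0, 0, 0,
    0, 0, 0, 0, 0, 0] ∧ st.mem = mem ∧ st.dr = dr ∧ M' ≤ M ∧ (∀ a < t, mem a ≤ M') ∧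
    st.tm ≤ tm + 2 * t, ?_, ?_, ?_⟩
  · exact ⟨0, rfl, rfl, rfl, Nat.zero_le _, fun _ h => by omega, le_rfl⟩
  · rintro t ht ⟨ρ, mem', dr', tm'⟩ ⟨M', h1, h2, h3, h4, h5, htm⟩
    simp only at h1 h2 h3 htm
    subst h1 h2 h3
    simp only [List.cons_append, List.nil_append, List.getD_cons_succ, List.getD_cons_zero,
      List.set_cons_succ, List.set_cons_zero]
    have := hmem t
    refine ⟨by omega, _, rfl, _, rfl, trivial, trivial, by omega, fun a ha => ?_, by omega⟩
    rcases Nat.lt_succ_iff_lt_or_eq.1 ha with ha | rfl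
    · have := h5 a ha; omega
    · omega
  · rintro ⟨ρ, mem', dr', tm'⟩ ⟨M', h1, h2, h3, h4, h5, htm⟩
    simp only at h1 h2 h3 htm
    subst h1 h2 h3
    simp only [List.getD_cons_succ, List.getD_cons_zero, List.set_cons_succ, List.set_cons_zero]
    refine ⟨by omega, ?_⟩
    rw [show B - (B - k * M') = min B (k * M') by omega]
    exact hQ M' (tm' + 1 + 1) h4 h5 (by omega)

theorem wp_powCmd {e : Ex} {i j : ℕ} {ρ : List ℕ} {mem : ℕ → ℕ} {dr tm : ℕ} (hij : i ≠ j)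
    (hi : i < ρ.length) (hj : j < ρ.length) (he : e.eval ρ mem ≤ V)
    (hV : ∀ t ≤ e.eval ρ mem, ρ.getD i 0 * ρ.getD j 0 ^ t ≤ V)
    (hQ : ∀ tm', tm' ≤ tm + (2 * e.eval ρ mem + 1) →
      Q ⟨ρ.set i (ρ.getD i 0 * ρ.getD j 0 ^ e.eval ρ mem), mem, dr, tm'⟩) :
    (powCmd e i j).wp coins V Q ⟨ρ, mem, dr, tm⟩ := by
  simp only [powCmd, wp, eval_var, eval_mul]
  refine ⟨he, fun t st => st.ρ = ρ.set i (ρ.getD i 0 * ρ.getD j 0 ^ t) ∧ st.mem = mem ∧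
    st.dr = dr ∧ st.tm ≤ tm + 2 * t, ?_, ?_, ?_⟩
  · refine ⟨?_, rfl, rfl, le_rfl⟩
    rw [pow_zero, mul_one, List.getD_eq_getElem _ _ hi, List.set_getElem_self]
  · rintro t ht ⟨ρ', mem', dr', tm'⟩ ⟨h1, h2, h3, htm⟩
    simp only at h1 h2 h3 htm
    subst h1 h2 h3
    have e1 : ∀ x y, (ρ.set i x ++ [y, t]).getD i 0 = x := fun x y => by
      rw [List.getD_append _ _ _ _ (by simpa using hi)]; simp [hi]
    have e2 : ∀ x y, (ρ.set i x ++ [y, t]).getD j 0 = ρ.getD j 0 := fun x y => by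
      rw [List.getD_append _ _ _ _ (by simpa using hj)]
      simp [List.getElem?_set_ne hij]
    simp only [e1, e2]
    rw [mul_assoc, ← pow_succ]
    refine ⟨hV _ ht, _, List.set_append_left _ _ (by simpa using hi), ?_, trivial, trivial,
      by omega⟩
    rw [List.set_set]
  · rintro ⟨ρ', mem', dr', tm'⟩ ⟨h1, h2, h3, htm⟩
    simp only at h1 h2 h3 htm
    subst h1 h2 h3
    exact hQ (tm' + 1) (by omega)

theorem wp_bitsCmd {n k B D x b P y : ℕ} {l : List ℕ} {mem : ℕ → ℕ} {dr tm : ℕ} (hn : 1 ≤ n)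
    (hV : 2 * n ≤ V)
    (hQ : ∀ b' y' tm', n ≤ 2 ^ b' → 2 ^ b' < 2 * n → tm' ≤ tm + (4 * n + 3) →
      Q ⟨n :: k :: B :: D :: x :: 0 :: b' :: 2 ^ b' :: y' :: l, mem, dr, tm'⟩) :
    bitsCmd.wp coins V Q ⟨n :: k :: B :: D :: x :: 0 :: b :: P :: y :: l, mem, dr, tm⟩ := by
  simp only [bitsCmd, wp_andThen, wp, eval_var, eval_cst, eval_add, eval_sub, eval_mul,
    List.getD_cons_zero, List.set_cons_succ, List.set_cons_zero]
  refine ⟨by omega, by omega, by omega, fun t st => ∃ b' y', st.ρ =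
    n :: k :: B :: D :: x :: 0 :: b' :: 2 ^ b' :: y' :: l ∧ st.mem = mem ∧ st.dr = dr ∧
    2 ^ b' < 2 * n ∧ (n ≤ 2 ^ b' ∨ t + 1 ≤ 2 ^ b') ∧ st.tm ≤ tm + (4 * t + 2), ?_, ?_, ?_⟩
  · exact ⟨0, y, rfl, rfl, rfl, by omega, Or.inr le_rfl, le_rfl⟩
  · rintro t ht ⟨ρ, mem', dr', tm'⟩ ⟨b', y', h1, h2, h3, h4, h5, htm⟩
    simp only at h1 h2 h3 htm
    subst h1 h2 h3
    simp only [List.cons_append, List.getD_cons_succ, List.getD_cons_zero,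
      List.set_cons_succ, List.set_cons_zero]
    have hb : b' < 2 ^ b' := Nat.lt_two_pow_self
    by_cases hlt : 2 ^ b' < n
    -- The nested truncated subtraction is the indicator of `2 ^ b' < n`; the power is doubled only
    -- in this case, hence it stays below `2 * n`.
    · rw [show 1 - (1 - (n - 2 ^ b')) = 1 by omega, mul_one]
      have h6 : 2 ^ b' + 2 ^ b' = 2 ^ (b' + 1) := by rw [pow_succ]; omega
      rw [h6]
      refine ⟨by omega, by omega, by omega, _, by simp only [← List.cons_append], b' + 1, 1, rfl,
        trivial, trivial, by omega, by omega, by omega⟩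
    · rw [show 1 - (1 - (n - 2 ^ b')) = 0 by omega, mul_zero, add_zero, add_zero]
      refine ⟨by omega, by omega, by omega, _, by simp only [← List.cons_append], b', 0, rfl,
        trivial, trivial, by omega, by omega, by omega⟩
  · rintro ⟨ρ, mem', dr', tm'⟩ ⟨b', y', h1, h2, h3, h4, h5, htm⟩
    simp only at h1 h2 h3 htm
    subst h1 h2 h3
    exact hQ b' y' (tm' + 1) (by omega) h4 (by omega)

theorem wp_drawCmd {n k B D E m b N yb bs ph pt : ℕ}
    (L : Layout V n k B D E m b N yb bs ph pt)
    {u S src acc pj uj sg bit x a β v i res : ℕ} {mem : ℕ → ℕ} {tm : ℕ} (hmem : ∀ a, mem a ≤ V)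
    (hQ : ∀ x' a' mem' dr' tm', (∀ a, mem' a ≤ V) → (∀ a < yb, mem' a = mem a) →
      (∀ e < N, mem' (yb + e) = draw coins b e) → tm' ≤ tm + (N * (3 * b + 5) + 1) →
      Q ⟨[n, k, B, D, E, m, b, N, yb, bs, ph, pt, u, S, src, acc, pj, uj, sg, bit, x', a', β, v,
        i, res], mem', dr', tm'⟩) :
    drawCmd.wp coins V Q ⟨[n, k, B, D, E, m, b, N, yb, bs, ph, pt, u, S, src, acc, pj, uj, sg, bit,
      x, a, β, v, i, res], mem, 0, tm⟩ := by
  have hbV := L.b_le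
  have hpow := L.pow_le
  have hbs := L.bs_eq
  have hph := L.ph_eq
  have hphV := L.ph_le
  simp only [drawCmd, wp_andThen, wp, eval_var, eval_cst, eval_add, eval_mul,
    List.getD_cons_zero, List.getD_cons_succ]
  refine ⟨by omega, fun t st => ∃ x a, st.ρ = [n, k, B, D, E, m, b, N, yb, bs, ph, pt, u, S, src,
    acc, pj, uj, sg, bit, x, a, β, v, i, res] ∧ st.dr = t * b ∧ (∀ a, st.mem a ≤ V) ∧
    (∀ a < yb, st.mem a = mem a) ∧ (∀ e < t, st.mem (yb + e) = draw coins b e) ∧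
    st.tm ≤ tm + t * (3 * b + 5), ?_, ?_, ?_⟩
  · exact ⟨_, _, rfl, by simp, hmem, fun _ _ => rfl, fun _ h => by omega, by simp⟩
  · rintro t ht ⟨ρ, mem', dr', tm'⟩ ⟨x, a, h1, h2, hV', hlow, hdone, htm⟩
    simp only at h1 h2 hV' hlow hdone htm
    subst h1 h2
    simp only [List.cons_append, List.nil_append, List.getD_cons_succ, List.getD_cons_zero,
      List.set_cons_succ, List.set_cons_zero]
    -- The coin with index `t * b + t'` becomes the next binary digit, exactly as in `draw`.
    refine ⟨by omega, hbV, fun t' st => ∃ a, st.ρ = [n, k, B, D, E, m, b, N, yb, bs, ph, pt, u, S,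
      src, acc, pj, uj, sg, bit, ofBits (fun j => coins (t * b + j)) t', a, β, v, i, res,
      N - 1 - t, t] ∧ st.dr = t * b + t' ∧ st.mem = mem' ∧ st.tm ≤ tm' + (3 * t' + 1), ?_, ?_, ?_⟩
    · exact ⟨_, rfl, rfl, rfl, le_rfl⟩
    · rintro t' ht' ⟨ρ, mem2, dr2, tm2⟩ ⟨a, h1, h2, h3, htm2⟩
      simp only at h1 h2 h3 htm2
      subst h1 h2 h3
      simp only [List.cons_append, List.nil_append, List.getD_cons_succ, List.getD_cons_zero,
        List.set_cons_succ, List.set_cons_zero]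
      have h4 : 2 * ofBits (fun j => coins (t * b + j)) t' + (coins (t * b + t')).toNat =
        ofBits (fun j => coins (t * b + j)) (t' + 1) := rfl
      have h5 := ofBits_lt (fun j => coins (t * b + j)) (t' + 1)
      have h6 : 2 ^ (t' + 1) ≤ 2 ^ b := Nat.pow_le_pow_right (by norm_num) ht'
      rw [h4]
      exact ⟨by omega, _, rfl, _, rfl, by omega, trivial, by omega⟩
    · rintro ⟨ρ, mem2, dr2, tm2⟩ ⟨a, h1, h2, h3, htm2⟩
      simp only at h1 h2 h3 htm2
      subst h1 h2 h3
      simp only [List.getD_cons_succ, List.getD_cons_zero]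
      have h5 := ofBits_lt (fun j => coins (t * b + j)) b
      refine ⟨by omega, by omega, _, rfl, _, _, rfl, by rw [Nat.succ_mul], fun a => ?_,
        fun a ha => ?_, fun e he => ?_, by rw [Nat.succ_mul]; omega⟩
      · by_cases ha : a = yb + t
        · subst ha; rw [Function.update_self]; omega
        · rw [Function.update_of_ne ha]; exact hV' a
      · rw [Function.update_of_ne (by omega)]; exact hlow a ha
      · by_cases h : e = t
        · subst h; rw [Function.update_self]; rfl
        · rw [Function.update_of_ne (by omega)]; exact hdone e (by omega)
  · rintro ⟨ρ, mem', dr', tm'⟩ ⟨x, a, h1, h2, hV', hlow, hdone, htm⟩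
    simp only at h1 h2 hV' hlow hdone htm
    subst h1 h2
    exact hQ _ _ mem' _ (tm' + 1) hV' hlow hdone (by omega)

end RAM

/-! ### Bounds for the numbers, and the set-up of the parameters -/

namespace RAM

open Cmd Ex BitExterior

/-- The modulus, for random numbers below `q`. -/
def modulus (n k q : ℕ) : ℕ := (n * k * n ^ k * q) ^ k + 1

theorem modulus_mono {n k q q' : ℕ} (h : q ≤ q') : modulus n k q ≤ modulus n k q' := by
  unfold modulus; gcongr

/-- `V` bounds all numbers that the program computes. -/
structure Large (V n k B c : ℕ) : Prop where
  modulus_le : modulus n k ((2 * n) ^ (c + 1)) ≤ V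
  space_le : n * n + n + k * ((n + 1) * n) + (k + 1) * ((n + 1) * ((B + 1) * 2 ^ k)) +
    (k + 1) * 2 ^ k + k ≤ V
  bits_le : 2 * n * (c + 1) ≤ V

variable {coins : ℕ → Bool} {Q : St → Prop} {V n k B c : ℕ}

theorem Large.prod_le (h : Large V n k B c) (hk : 1 ≤ k) {q : ℕ}
    (hq : q ≤ (2 * n) ^ (c + 1)) : n * k * n ^ k * q ≤ V := by
  have h1 := (modulus_mono (n := n) (k := k) hq).trans h.modulus_le
  have h2 : n * k * n ^ k * q ≤ (n * k * n ^ k * q) ^ k := Nat.le_self_pow (by omega) _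
  rw [modulus] at h1
  omega

theorem Large.layout (h : Large V n k B c) (hn : 1 ≤ n) (hk : 1 ≤ k) {b' : ℕ}
    (hb : 2 ^ b' ≤ 2 * n) :
    Layout V n k B (B + 1) (2 ^ k) (modulus n k ((2 ^ b') ^ (c + 1))) (b' * (c + 1))
      (k * ((n + 1) * n)) (n * n + n) (n * n + n + k * ((n + 1) * n))
      (n * n + n + k * ((n + 1) * n) + (k + 1) * ((n + 1) * ((B + 1) * 2 ^ k)))
      (n * n + n + k * ((n + 1) * n) + (k + 1) * ((n + 1) * ((B + 1) * 2 ^ k)) +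
        (k + 1) * 2 ^ k) where
  n_pos := hn
  k_pos := hk
  D_eq := rfl
  E_eq := rfl
  two_le_m := by
    have : 0 < (n * k * n ^ k * (2 ^ b') ^ (c + 1)) ^ k := by positivity
    rw [modulus]; omega
  m_le := (modulus_mono (by gcongr)).trans h.modulus_le
  b_le := by
    have h1 : b' < 2 ^ b' := Nat.lt_two_pow_self
    exact (Nat.mul_le_mul_right _ (by omega)).trans h.bits_le
  pow_le := by
    have h1 : 0 < n * k * n ^ k := by positivity
    have h2 := h.prod_le hk (q := (2 ^ b') ^ (c + 1)) (by gcongr)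
    rw [pow_mul]
    exact (Nat.le_mul_of_pos_left _ h1).trans h2
  N_eq := rfl
  yb_eq := rfl
  bs_eq := rfl
  ph_eq := rfl
  pt_eq := rfl
  end_le := h.space_le
  npow_le := by
    have h1 : 0 < n * k := by positivity
    have h2 := h.prod_le hk (q := 1) (Nat.one_le_pow _ _ (by omega))
    rw [mul_one] at h2
    exact (Nat.le_mul_of_pos_left _ h1).trans h2

/-- The row of ones below the matrix encodes edges of weight zero from the source to all vertices.
-/
theorem wp_setupCmd {M : ℕ} {mem : ℕ → ℕ} {tm : ℕ} (hn : 1 ≤ n) (hk : 1 ≤ k)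
    (hL : Large V n k B c) (hmem : ∀ a, mem a ≤ V)
    (hQ : ∀ b' D E m N yb bs ph pt mem' tm', n ≤ 2 ^ b' → 2 ^ b' < 2 * n →
      m = modulus n k ((2 ^ b') ^ (c + 1)) →
      Layout V n k B D E m (b' * (c + 1)) N yb bs ph pt →
      (∀ a, mem' a ≤ V) → (∀ a < n * n, mem' a = mem a) → (∀ u < n, mem' (n * n + u) = 1) →
      tm' ≤ tm + (6 * n + 6 * k + 2 * c + 25) →
      Q ⟨[n, k, B, D, E, m, b' * (c + 1), N, yb, bs, ph, pt, 0, 0, 0, 0, 0, 0, 0, 0, 0, 0, 0, 0,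
        0, 0], mem', 0, tm'⟩) :
    (setupCmd c).wp coins V Q ⟨[n, k, B, M, 0, 0, 0, 0, 0, 0, 0, 0, 0, 0, 0, 0, 0, 0, 0, 0, 0, 0,
      0, 0, 0, 0], mem, 0, tm⟩ := by
  -- The number of bits is not known yet; a layout with `b' = 0` already yields the bounds that do
  -- not depend on it.
  have hL0 := hL.layout hn hk (b' := 0) (by omega)
  have hEV := hL0.E_le
  have hDV : B + 1 ≤ V := hL0.D_le
  have hend := hL0.end_le
  have h2n : 2 * n ≤ V := le_trans (Nat.le_mul_of_pos_right _ (by omega)) hL.bits_le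
  have hkV : k ≤ V := (Nat.lt_two_pow_self).le.trans hEV
  have hpos : 0 < n * k := by positivity
  simp only [setupCmd, wp_andThen, wp, eval_var, eval_cst, eval_add, List.getD_cons_zero,
    List.getD_cons_succ, List.set_cons_succ, List.set_cons_zero]
  refine ⟨hDV, wp_bitsCmd hn h2n fun b' y' t1 hb1 hb2 ht1 => ?_⟩
  have hL' := hL.layout hn hk hb2.le
  have hbV := hL'.b_le
  have hPV : ∀ t ≤ c + 1, n * k * n ^ k * (2 ^ b') ^ t ≤ V := fun t ht =>
    hL.prod_le hk (le_trans (Nat.pow_le_pow_left hb2.le t)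
      (Nat.pow_le_pow_right (by omega) ht))
  have hnV : ∀ t ≤ k, n * k * n ^ t ≤ V := fun t ht => by
    have h1 := hPV 0 (by omega)
    rw [pow_zero, mul_one] at h1
    exact (Nat.mul_le_mul_left _ (Nat.pow_le_pow_right hn ht)).trans h1
  have hmV := hL'.m_le
  have hm2 := hL'.two_le_m
  have hZV : ∀ t ≤ k, (n * k * n ^ k * (2 ^ b') ^ (c + 1)) ^ t < V := fun t ht => by
    have h1 : (n * k * n ^ k * (2 ^ b') ^ (c + 1)) ^ t ≤
        (n * k * n ^ k * (2 ^ b') ^ (c + 1)) ^ k :=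
      Nat.pow_le_pow_right (by positivity) ht
    rw [modulus] at hmV
    omega
  simp only [wp, wp_andThen, eval_var, eval_cst, eval_mul, List.getD_cons_zero,
    List.getD_cons_succ, List.set_cons_succ, List.set_cons_zero]
  refine ⟨hbV, by omega, by omega, wp_powCmd (by norm_num) (by simp) (by simp) (by simpa [eval_var])
    (fun t ht => ?_) fun t2 ht2 => ?_⟩
  · simp only [eval_var, List.getD_cons_zero, List.getD_cons_succ, one_mul] at ht ⊢
    exact (Nat.pow_le_pow_right (by norm_num) ht).trans hEV
  simp only [wp, wp_andThen, eval_var, eval_mul, List.getD_cons_zero,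
    List.getD_cons_succ, List.set_cons_succ, List.set_cons_zero, one_mul] at ht2 ⊢
  refine ⟨by simpa using hnV 0 (Nat.zero_le k), wp_powCmd (by norm_num) (by simp) (by simp)
    (by simpa [eval_var]) (fun t ht => ?_) fun t3 ht3 => ?_⟩
  · simp only [eval_var, List.getD_cons_zero, List.getD_cons_succ] at ht ⊢
    exact hnV t ht
  simp only [wp_andThen, eval_var,  List.getD_cons_zero,
    List.getD_cons_succ, List.set_cons_succ, List.set_cons_zero] at ht3 ⊢
  refine wp_powCmd (by norm_num) (by simp) (by simp) (by
    have : c + 1 ≤ 2 * n * (c + 1) := Nat.le_mul_of_pos_left _ (by omega)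
    simpa [eval_cst] using this.trans hL.bits_le) (fun t ht => ?_) fun t4 ht4 => ?_
  · simp only [eval_cst, List.getD_cons_zero, List.getD_cons_succ] at ht ⊢
    exact hPV t ht
  simp only [wp, wp_andThen, eval_cst, List.getD_cons_zero,
    List.getD_cons_succ, List.set_cons_succ, List.set_cons_zero] at ht4 ⊢
  refine ⟨by omega, wp_powCmd (by norm_num) (by simp) (by simp) (by simpa [eval_var])
    (fun t ht => ?_) fun t5 ht5 => ?_⟩
  · simp only [eval_var, List.getD_cons_zero, List.getD_cons_succ, one_mul] at ht ⊢
    exact (hZV t ht).le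
  simp only [wp, wp_andThen, eval_var, eval_cst, eval_add, eval_mul, List.getD_cons_zero,
    List.getD_cons_succ, List.set_cons_succ, List.set_cons_zero, one_mul] at ht5 ⊢
  refine ⟨hZV k le_rfl, by omega, by omega, by omega, by omega, by omega, by omega, fun t st =>
    st.ρ = [n, k, B, B + 1, 2 ^ k, modulus n k ((2 ^ b') ^ (c + 1)), b' * (c + 1),
      k * ((n + 1) * n), n * n + n, n * n + n + k * ((n + 1) * n),
      n * n + n + k * ((n + 1) * n) + (k + 1) * ((n + 1) * ((B + 1) * 2 ^ k)),
      n * n + n + k * ((n + 1) * n) + (k + 1) * ((n + 1) * ((B + 1) * 2 ^ k)) +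
        (k + 1) * 2 ^ k, 0, 0, 0, 0, 0, 0, 0, 0, 0, 0, 0, 0, 0, 0] ∧ st.dr = 0 ∧
      (∀ a, st.mem a ≤ V) ∧ (∀ a < n * n, st.mem a = mem a) ∧
      (∀ u < t, st.mem (n * n + u) = 1) ∧ st.tm ≤ t5 + 7 + 2 * t, ?_, ?_, ?_⟩
  · exact ⟨rfl, rfl, hmem, fun _ _ => rfl, fun _ h => by omega, by simp only; omega⟩
  · rintro t ht ⟨ρ, mem', dr', tm'⟩ ⟨h1, h2, h3, h4, h5, htm⟩
    simp only at h1 h2 h3 h4 h5 htm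
    subst h1 h2
    simp only [List.cons_append, List.nil_append, List.getD_cons_succ, List.getD_cons_zero]
    refine ⟨by omega, by omega, _, rfl, rfl, trivial, fun a => ?_, fun a ha => ?_, fun u hu => ?_,
      by omega⟩
    · by_cases ha : a = n * n + t
      · subst ha; rw [Function.update_self]; omega
      · rw [Function.update_of_ne ha]; exact h3 a
    · rw [Function.update_of_ne (by omega)]; exact h4 a ha
    · by_cases h : u = t
      · subst h; rw [Function.update_self]
      · rw [Function.update_of_ne (by omega)]; exact h5 u (by omega)
  · rintro ⟨ρ, mem', dr', tm'⟩ ⟨h1, h2, h3, h4, h5, htm⟩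
    simp only at h1 h2 h3 h4 h5 htm
    subst h1 h2
    exact hQ b' _ _ _ _ _ _ _ _ mem' (tm' + 1) hb1 hb2 rfl hL' h3 h4 h5 (by omega)

end RAM

/-! ### The complete second phase -/

namespace RAM

open Cmd Ex BitExterior

/-- The second phase of the program: everything that follows the bounding of `B`. -/
def mainCmd (c : ℕ) : Cmd :=
  setupCmd c >> drawCmd >> tableCmd >> detectCmd >> ite (var 25) traceCmd skip >> set 0 (var 25)

theorem wf_clipCmd {V : ℕ} : clipCmd.Wf V 100 26 := by
  simp only [clipCmd, wf_andThen, Cmd.Wf, wf_var, wf_add, wf_sub, wf_mul, wf_ld, sz_sub, Ex.sz]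
  omega

theorem wf_mainCmd {V c : ℕ} (hV : 2 ≤ V) (hc : c + 1 ≤ V) : (mainCmd c).Wf V 100 26 := by
  simp only [mainCmd, setupCmd, bitsCmd, powCmd, drawCmd, tableCmd, rowCmd, wedgeCmd, contractCmd,
    detectCmd, traceCmd, pickCmd, pairCmd, residualCmd, wf_andThen, Cmd.Wf, wf_var, wf_cst, wf_add,
    wf_sub, wf_mul, wf_div, wf_mod, wf_ld, sz_sub, sz_div, sz_mod, Ex.sz]
  simp [hV, hc, (by omega : 1 ≤ V)]

theorem clog_eq {n b : ℕ} (h1 : n ≤ 2 ^ b) (h2 : 2 ^ b < 2 * n) : b = Nat.clog 2 n := by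
  refine le_antisymm ?_ (Nat.clog_le_of_le_pow h1)
  have h3 : 2 ^ b < 2 ^ (Nat.clog 2 n + 1) :=
    h2.trans_le (by rw [pow_succ']; exact Nat.mul_le_mul_left 2 (Nat.le_pow_clog (by norm_num) n))
  have := (Nat.pow_lt_pow_iff_right (by norm_num)).1 h3
  omega

/-- The table dominates with `k ^ 2 * n ^ 2 * D * E`; the factor `(c + 1) * (b + 1)` covers the
drawing of the labels. -/
theorem mainCmd_time_le {n k D E b c : ℕ} (hn : 1 ≤ n) (hk : 1 ≤ k) (hD : 1 ≤ D) (hE : 1 ≤ E) :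
    6 * n + 6 * k + 2 * c + 25 + (k * ((n + 1) * n) * (3 * (b * (c + 1)) + 5) + 1) +
      ((k + 1) * ((n + 1) * (D * E)) * (n * (7 * k + 11) + 9) + 1) + (4 * D + 2) +
      (k * ((n + 1) * (E * (7 * k + 8) + 9) + 9) + 2 * E + 2 * k + 6) + 2 ≤
    240 * ((c + 1) * (b + 1) * k ^ 2 * n ^ 2 * (D * E)) := by
  set X := (c + 1) * (b + 1) * k ^ 2 * n ^ 2 * (D * E) with hX
  -- Every monomial that occurs divides `X`, so it is at most `X`.
  have key : ∀ x y, 0 < y → x * y = X → x ≤ X := fun x y hy h =>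
    h ▸ Nat.le_mul_of_pos_right x hy
  have h1 : 1 ≤ X := key 1 X (by positivity) (one_mul X)
  have h2 : n ≤ X := key n ((c + 1) * (b + 1) * k ^ 2 * n * (D * E)) (by positivity)
    (by rw [hX]; ring)
  have h3 : k ≤ X := key k ((c + 1) * (b + 1) * k * n ^ 2 * (D * E)) (by positivity)
    (by rw [hX]; ring)
  have h4 : c + 1 ≤ X := key (c + 1) ((b + 1) * k ^ 2 * n ^ 2 * (D * E)) (by positivity)
    (by rw [hX]; ring)
  have h5 : D ≤ X := key D ((c + 1) * (b + 1) * k ^ 2 * n ^ 2 * E) (by positivity)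
    (by rw [hX]; ring)
  have h6 : E ≤ X := key E ((c + 1) * (b + 1) * k ^ 2 * n ^ 2 * D) (by positivity)
    (by rw [hX]; ring)
  have hkE : 1 ≤ k * E := Nat.mul_pos hk hE
  have hnk : 1 ≤ n * k := Nat.mul_pos hn hk
  have hnn : n ≤ n * k := Nat.le_mul_of_pos_right n hk
  have hEE : E ≤ k * E := Nat.le_mul_of_pos_left E hk
  have h7 : k * ((n + 1) * n) * (3 * (b * (c + 1)) + 5) ≤ 10 * X := by
    calc k * ((n + 1) * n) * (3 * (b * (c + 1)) + 5)
        ≤ k * ((2 * n) * n) * (5 * ((b + 1) * (c + 1))) := by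
          gcongr
          · omega
          · nlinarith
      _ = 10 * (k * n ^ 2 * ((b + 1) * (c + 1))) := by ring
      _ ≤ 10 * X := Nat.mul_le_mul_left _ (key _ (k * (D * E)) (by positivity) (by rw [hX]; ring))
  have h8 : (k + 1) * ((n + 1) * (D * E)) * (n * (7 * k + 11) + 9) ≤ 108 * X := by
    calc (k + 1) * ((n + 1) * (D * E)) * (n * (7 * k + 11) + 9)
        ≤ (2 * k) * ((2 * n) * (D * E)) * (27 * (n * k)) := by
          gcongr
          · omega
          · omega
          · linarith
      _ = 108 * (k ^ 2 * n ^ 2 * (D * E)) := by ring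
      _ ≤ 108 * X := Nat.mul_le_mul_left _ (key _ ((c + 1) * (b + 1)) (by positivity)
          (by rw [hX]; ring))
  have h9 : k * ((n + 1) * (E * (7 * k + 8) + 9) + 9) ≤ 57 * X := by
    have h10 : E * (7 * k + 8) + 9 ≤ 24 * (k * E) := by linarith
    calc k * ((n + 1) * (E * (7 * k + 8) + 9) + 9)
        ≤ k * ((2 * n) * (24 * (k * E)) + 9 * (n * (k * E))) := by
          gcongr
          · omega
          · have : 1 ≤ n * (k * E) := Nat.mul_pos hn hkE
            omega
      _ = 57 * (k ^ 2 * n * E) := by ring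
      _ ≤ 57 * X := Nat.mul_le_mul_left _ (key _ ((c + 1) * (b + 1) * n * D) (by positivity)
          (by rw [hX]; ring))
  omega

theorem wp_mainCmd {coins : ℕ → Bool} {Q : St → Prop} {V n k B c M : ℕ} {mem : ℕ → ℕ} {tm : ℕ}
    (hn : 1 ≤ n) (hk : 1 ≤ k) (hL : Large V n k B c) (hmem : ∀ a, mem a ≤ V) (A : ℕ → ℕ → ℕ)
    (hA : ∀ v < n, ∀ u < n, mem (v * n + u) = A v u) (hA1 : ∀ u < n, A n u = 1)
    (hQ : ∀ res st,
      (res = 0 → ∀ β ≤ B, walkSum n k A (fun e => (draw coins (Nat.clog 2 n * (c + 1)) e :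
        ZMod (modulus n k ((2 ^ Nat.clog 2 n) ^ (c + 1))))) k n β (2 ^ k - 1) = 0) →
      (res ≠ 0 → res - 1 ≤ B ∧ (∀ β < res - 1, walkSum n k A
        (fun e => (draw coins (Nat.clog 2 n * (c + 1)) e :
        ZMod (modulus n k ((2 ^ Nat.clog 2 n) ^ (c + 1))))) k n β (2 ^ k - 1) = 0) ∧
        ∃ xs : List ℕ, xs.length = k ∧ xs.Nodup ∧ (∀ x ∈ xs, x < n) ∧ IsWalk A n xs (res - 1) ∧
          ∀ j < k, st.mem j = xs.getD j 0) →
      st.ρ.getD 0 0 = res →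
      st.tm ≤ tm + 240 * ((c + 1) * (Nat.clog 2 n + 1) * k ^ 2 * n ^ 2 * ((B + 1) * 2 ^ k)) →
      Q st) :
    (mainCmd c).wp coins V Q ⟨[n, k, B, M, 0, 0, 0, 0, 0, 0, 0, 0, 0, 0, 0, 0, 0, 0, 0, 0, 0, 0,
      0, 0, 0, 0], mem, 0, tm⟩ := by
  have htime := mainCmd_time_le (b := Nat.clog 2 n) (c := c) (D := B + 1) hn hk (by omega)
    (Nat.two_pow_pos k)
  simp only [mainCmd, wp_andThen]
  refine wp_setupCmd hn hk hL hmem fun b' D E m N yb bs ph pt mem1 t1 hb1 hb2 hm L hV1 hm1 hr1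
    ht1 => ?_
  obtain rfl := clog_eq hb1 hb2
  have hyb := L.yb_eq
  have hbs := L.bs_eq
  obtain rfl := L.D_eq
  obtain rfl := L.E_eq
  obtain rfl := L.N_eq
  have hcell : ∀ v < n, ∀ u < n, v * n + u < n * n := fun v hv u hu => by
    calc v * n + u < v * n + n := by omega
      _ = (v + 1) * n := by ring
      _ ≤ n * n := Nat.mul_le_mul_right n hv
  refine wp_drawCmd L hV1 fun x2 a2 mem2 dr2 t2 hV2 hm2 hd2 ht2 => ?_
  have hA2 : ∀ v ≤ n, ∀ u < n, mem2 (v * n + u) = A v u := fun v hv u hu => by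
    rcases hv.lt_or_eq with hv | rfl
    · have := hcell v hv u hu
      rw [hm2 _ (by omega), hm1 _ this, hA v hv u hu]
    · rw [hm2 _ (by omega), hr1 u hu, hA1 u hu]
  refine wp_tableCmd L hV2 A (fun e => (draw coins (Nat.clog 2 n * (c + 1)) e : ZMod m)) hA2
    (fun e he => by rw [hd2 e he]) fun u S src acc pj uj sg bit x a β v i mem3 t3 hG hV3 hm3 ht3 =>
    ?_
  have hA3 : ∀ v ≤ n, ∀ u < n, mem3 (v * n + u) = A v u := fun v hv u hu => by
    rw [hm3, hA2 v hv u hu]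
    have : v * n ≤ n * n := Nat.mul_le_mul_right n hv
    omega
  have hE1 : 2 ^ k - 1 < 2 ^ k := Nat.sub_lt (Nat.two_pow_pos k) one_pos
  have hzero : ∀ β < B + 1, mem3 (bs + code n (B + 1) (2 ^ k) k n β (2 ^ k - 1)) = 0 →
      walkSum n k A (fun e => (draw coins (Nat.clog 2 n * (c + 1)) e : ZMod m)) k n β
        (2 ^ k - 1) = 0 := fun β hβ h0 => by
    rw [← (hG k le_rfl n le_rfl β hβ _ hE1).2, h0, Nat.cast_zero]
  refine wp_detectCmd L (w := [u, S, src, acc, pj, uj, sg, bit, x, a, β, v, i]) rfl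
    fun res t4 hr0 hr1 ht4 => ?_
  refine ⟨fun h0 => ?_, fun h0 => ?_⟩
  · have hres : res ≠ 0 := h0
    obtain ⟨hlt, hne, hmin⟩ := hr1 hres
    obtain ⟨r, rfl⟩ := Nat.exists_eq_succ_of_ne_zero hres
    simp only [Nat.succ_eq_add_one, Nat.add_sub_cancel] at hlt hne hmin
    refine wp_traceCmd L hV3 A (fun e => (draw coins (Nat.clog 2 n * (c + 1)) e : ZMod m)) hA3
      (fun i hi v hv β hβ S hS => (hG i hi v hv β hβ S hS).2) hlt (fun h => hne ?_)
      fun w mem5 t5 xs hw hl hnd hxn hwalk hmem5 ht5 => ?_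
    -- The stored number is nonzero and below `m`, so its residue is nonzero.
    · have h2 := hG k le_rfl n le_rfl r hlt _ hE1
      rw [h, ZMod.natCast_eq_zero_iff] at h2
      exact Nat.eq_zero_of_dvd_of_lt h2.2 h2.1
    · have hget : ([n, k, B, B + 1, 2 ^ k, m, Nat.clog 2 n * (c + 1), k * ((n + 1) * n), yb, bs,
          ph, pt] ++ w ++ [r + 1]).getD 25 0 = r + 1 := by
        rw [List.getD_append_right _ _ _ _ (by simp [hw])]
        simp [hw]
      refine ⟨?_, ?_⟩
      · simp only [eval_var, hget]
        have := L.D_le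
        omega
      · subst hm
        refine hQ (r + 1) _ (fun h => absurd h (Nat.succ_ne_zero r)) (fun _ => ?_) ?_ ?_
        · rw [Nat.add_sub_cancel]
          exact ⟨by omega, fun β hβ => hzero β (by omega) (hmin β hβ),
            xs, hl, hnd, hxn, hwalk, hmem5⟩
        · simp only [eval_var, hget]
          rfl
        · simp only at ht1 ht2 ht3 ht4 ht5 ⊢
          omega
  · have hres : res = 0 := h0
    subst hres
    subst hm
    refine ⟨Nat.zero_le _, hQ 0 _ (fun _ β hβ => hzero β (by omega) (hr0 rfl β (by omega)))
      (fun h => absurd rfl h) rfl ?_⟩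
    simp only at ht1 ht2 ht3 ht4 ⊢
    omega

end RAM

/-! ### Correctness -/

namespace KPath

open BitExterior RAM

variable {n : ℕ} (G : Digraph (Fin n)) (w : Fin n → Fin n → ℕ) (k : ℕ) (B : ℝ)

open Classical in
theorem input_mem (i j : Fin n) :
    (input G w k B).mem (i * n + j) = if G.Adj i j then w i j + 1 else 0 := by
  have hn : 0 < n := i.pos
  have h1 : (i * n + j : ℕ) < n * n := by
    calc (i * n + j : ℕ) < i * n + n := by omega
      _ = (i + 1) * n := by ring
      _ ≤ n * n := Nat.mul_le_mul_right n i.isLt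
  have h2 : (⟨(i * n + j : ℕ) / n, Nat.div_lt_of_lt_mul h1⟩ : Fin n) = i :=
    Fin.ext (mul_add_div_self j.isLt)
  have h3 : (⟨(i * n + j : ℕ) % n, Nat.mod_lt _ hn⟩ : Fin n) = j :=
    Fin.ext (mul_add_mod_self j.isLt)
  simp only [input, dif_pos h1, h2, h3]

variable {G w k B}

theorem input_mem_le {M : ℕ} (hM : ∀ u v, G.Adj u v → w u v ≤ M) (a : ℕ) :
    (input G w k B).mem a ≤ M + 1 := by
  simp only [input]
  split
  · split
    · exact Nat.succ_le_succ (hM _ _ ‹_›)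
    · exact Nat.zero_le _
  · exact Nat.zero_le _

variable (G w k B)

/-- The weighted adjacency matrix in the memory, with a further row of ones for a source. -/
noncomputable def matrix (v u : ℕ) : ℕ := if v < n then (input G w k B).mem (v * n + u) else 1

variable {G w k B}

theorem weight_cons_cons (v u : Fin n) (p : List (Fin n)) :
    weight w (v :: u :: p) = w v u + weight w (u :: p) := by simp [weight]

theorem isWalk_cons_iff (p : List (Fin n)) (v : Fin n) (β : ℕ) :
    IsWalk (matrix G w k B) v (p.map Fin.val) β ↔
      (v :: p).IsChain G.Adj ∧ weight w (v :: p) = β := by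
  classical
  induction p generalizing v β with
  | nil => simp [IsWalk, weight, eq_comm]
  | cons u p ih =>
    rw [List.map_cons, IsWalk, ih, matrix, if_pos v.isLt, input_mem, List.isChain_cons_cons,
      weight_cons_cons]
    by_cases h : G.Adj v u
    · rw [if_pos h]
      simp only [h, true_and]
      constructor
      · rintro ⟨_, h2, h3, h4⟩; exact ⟨h3, by omega⟩
      · rintro ⟨h3, h4⟩; exact ⟨by omega, by omega, h3, by omega⟩
    · simp [h]

/-- The step from the source costs nothing, so walks with `k` edges from it correspond to walks
through `k` vertices with the same weight. -/
theorem isWalk_source_iff (p : List (Fin n)) (β : ℕ) :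
    IsWalk (matrix G w k B) n (p.map Fin.val) β ↔ p.IsChain G.Adj ∧ weight w p = β := by
  cases p with
  | nil => simp [IsWalk, weight, eq_comm]
  | cons u p =>
    rw [List.map_cons, IsWalk, matrix, if_neg (lt_irrefl n), Nat.add_sub_cancel, isWalk_cons_iff]
    simp

theorem weight_le {M : ℕ} (hM : ∀ a < n * n, (input G w k B).mem a ≤ M) (p : List (Fin n))
    (hp : p.IsChain G.Adj) : weight w p ≤ p.length * M := by
  classical
  induction p with
  | nil => simp [weight]
  | cons v p ih =>
    cases p with
    | nil => simp [weight]
    | cons u p =>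
      rw [List.isChain_cons_cons] at hp
      have h1 := hM (v * n + u) (by
        calc (v * n + u : ℕ) < v * n + n := by omega
          _ = (v + 1) * n := by ring
          _ ≤ n * n := Nat.mul_le_mul_right n v.isLt)
      rw [input_mem, if_pos hp.1] at h1
      have h2 := ih hp.2
      rw [weight_cons_cons, List.length_cons, Nat.succ_mul]
      omega

theorem exists_min_isKPath (h : ∃ p, IsKPath G k p) :
    ∃ p, IsKPath G k p ∧ ∀ q, IsKPath G k q → weight w p ≤ weight w q := by
  obtain ⟨p, hp, hmin⟩ := exists_minimalFor_of_wellFoundedLT (IsKPath G k) (weight w) h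
  exact ⟨p, hp, fun q hq => (le_total (weight w p) (weight w q)).elim id (hmin hq)⟩

/-- The error is one-sided. A reported path is real and every smaller weight has `f = 0`; so the
answer can be wrong only if `f` vanishes at the minimum weight, which `hf` excludes. Clipping does
no harm by `hclip`. -/
theorem isAnswer_output {R : Type*} [Zero R] {f : ℕ → R} {res B' : ℕ} {s : State} (hB : 0 ≤ B)
    (h0 : res = 0 → ∀ β ≤ B', f β = 0)
    (h1 : res ≠ 0 → res - 1 ≤ B' ∧ (∀ β < res - 1, f β = 0) ∧ ∃ xs : List ℕ, xs.length = k ∧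
      xs.Nodup ∧ (∀ x ∈ xs, x < n) ∧ IsWalk (matrix G w k B) n xs (res - 1) ∧
        ∀ j < k, s.mem j = xs.getD j 0)
    (hs : s.reg 0 = res) (hB' : B' ≤ ⌊B⌋₊)
    (hclip : ∀ p, IsKPath G k p → weight w p ≤ ⌊B⌋₊ → weight w p ≤ B')
    (hf : ∀ p, IsKPath G k p → (weight w p : ℝ) ≤ B →
      (∀ q, IsKPath G k q → weight w p ≤ weight w q) → f (weight w p) ≠ 0) :
    IsAnswer G w k B (output k s) := by
  rw [output, hs]
  by_cases hres : res = 0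
  · rw [if_pos hres]
    rintro ⟨p, hp, hpB⟩
    obtain ⟨q, hq, hmin⟩ := exists_min_isKPath (w := w) ⟨p, hp⟩
    have hqB : (weight w q : ℝ) ≤ B := le_trans (by exact_mod_cast hmin p hp) hpB
    exact hf q hq hqB hmin (h0 hres _ (hclip q hq (Nat.le_floor hqB)))
  · rw [if_neg hres]
    obtain ⟨hle, hz, xs, hl, hnd, hlt, hwalk, hmem⟩ := h1 hres
    obtain ⟨p, rfl⟩ : ∃ p : List (Fin n), p.map Fin.val = xs :=
      ⟨xs.pmap Fin.mk hlt, by rw [List.map_pmap]; simp⟩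
    rw [isWalk_source_iff] at hwalk
    have hk : IsKPath G k p := ⟨by simpa using hl, hnd.of_map _, hwalk.1⟩
    have hpB : (weight w p : ℝ) ≤ B := by
      rw [← Nat.le_floor_iff hB]; omega
    refine ⟨p, ?_, hk, hpB, fun q hq => ?_⟩
    · refine List.ext_getElem (by simpa using hl) fun j hj _ => ?_
      have hjk : j < k := hl ▸ hj
      simp only [List.getElem_map, List.getElem_range]
      rw [hmem j hjk, List.getD_eq_getElem _ _ hj, List.getElem_map]
    · obtain ⟨r, hr, hmin⟩ := exists_min_isKPath (w := w) ⟨p, hk⟩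
      refine le_trans ?_ (hmin q hq)
      by_contra! hlt'
      have hrB : (weight w r : ℝ) ≤ B := le_trans (by exact_mod_cast hmin p hk) hpB
      exact hf r hr hrB hmin (hz _ (by omega))

end KPath

/-! ### The probability of an error -/

namespace RAM

open BitExterior

/-- The modulus exceeds the bound of `abs_walkSum_le` by one, so an integer value divisible by it is
zero. Primality plays no role. -/
theorem walkSum_eq_zero_of_modulus {n k q : ℕ} {A : ℕ → ℕ → ℕ} {Y : ℕ → ℕ} {v β S : ℕ}
    (hY : ∀ e, Y e ≤ q)
    (h : walkSum n k A (fun e => (Y e : ZMod (modulus n k q))) k v β S = 0) :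
    walkSum n k A (fun e => (Y e : ℤ)) k v β S = 0 := by
  have h1 : ((walkSum n k A (fun e => (Y e : ℤ)) k v β S : ℤ) : ZMod (modulus n k q)) = 0 := by
    have h2 := map_walkSum (Int.castRingHom (ZMod (modulus n k q))) n k A (fun e => (Y e : ℤ)) k v
      β S
    rw [eq_intCast] at h2
    rw [h2, ← h]
    refine congrArg (fun Z => walkSum n k A Z k v β S) (funext fun e => ?_)
    simp
  rw [ZMod.intCast_zmod_eq_zero_iff_dvd] at h1
  refine Int.eq_zero_of_abs_lt_dvd h1 (lt_of_le_of_lt (abs_walkSum_le (y := q) (by positivity)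
    (fun e => ?_) k v β S) ?_)
  · rw [Nat.abs_cast]; exact_mod_cast hY e
  · rw [modulus]
    push_cast
    rw [show (n : ℤ) * q * (k * (n : ℤ) ^ k) = n * k * (n : ℤ) ^ k * q by ring]
    exact lt_add_one _

/-- Zero modulo `m` means zero over `ℤ`, that is, the random labels hit a zero of a nonzero
polynomial of degree at most `k`. -/
theorem coinMeasure_walkSum_eq_zero_le {n k c β : ℕ} {A : ℕ → ℕ → ℕ} {p : List ℕ} (hn : 1 ≤ n)
    (hl : p.length = k) (hnd : p.Nodup) (hp : ∀ x ∈ p, x < n) (hw : IsWalk A n p β) :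
    coinMeasure {coins | walkSum n k A (fun e => (draw coins (Nat.clog 2 n * (c + 1)) e :
      ZMod (modulus n k ((2 ^ Nat.clog 2 n) ^ (c + 1))))) k n β (2 ^ k - 1) = 0} ≤
      ENNReal.ofReal (1 / (n : ℝ) ^ c) := by
  have hne := walkSum_walkVar_ne_zero hl hnd hp le_rfl le_rfl hw
  refine le_trans (measure_mono fun coins hcoins => ?_) ((coinMeasure_eval_eq_zero_le
    (b := Nat.clog 2 n * (c + 1)) hne (totalDegree_walkSum_le n k A _ (totalDegree_walkVar_le _)
      k n β _)).trans (ENNReal.ofReal_le_ofReal ?_))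
  · rw [Set.mem_ofPred_eq] at hcoins ⊢
    rw [eval_walkSum le_rfl le_rfl fun e => (draw coins (Nat.clog 2 n * (c + 1)) e : ℤ)]
    refine walkSum_eq_zero_of_modulus (q := (2 ^ Nat.clog 2 n) ^ (c + 1)) (fun e => ?_) hcoins
    rw [← pow_mul]
    exact (ofBits_lt _ _).le
  -- A path has distinct vertices, so `k ≤ n` and the bound `k / 2 ^ b` is at most `n / n ^ (c +
  -- 1)`.
  · have hk : k ≤ n := by
      rw [← hl, ← List.toFinset_card_of_nodup hnd, ← Finset.card_range n]
      exact Finset.card_le_card fun x hx => Finset.mem_range.2 (hp x (List.mem_toFinset.1 hx))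
    have hn0 : (0 : ℝ) < n := by exact_mod_cast hn
    have h2 : (n : ℝ) ≤ 2 ^ Nat.clog 2 n := by
      exact_mod_cast Nat.le_pow_clog (by norm_num) n
    calc (k : ℝ) / 2 ^ (Nat.clog 2 n * (c + 1)) ≤ n / (n : ℝ) ^ (c + 1) := by
          rw [pow_mul]; gcongr
      _ = 1 / (n : ℝ) ^ c := by rw [pow_succ]; field_simp

end RAM

/-! ### Running time -/

namespace RAM

open Cmd Ex BitExterior

/-- A bound for the numbers in the second phase, with entries of the matrix at most `M + 1`. -/
def valueBound (n k M c : ℕ) : ℕ := (2 ^ k * (n + M + 2)) ^ (k * (k + c + 3) + 6)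

variable {n k M c : ℕ}

theorem pow_le_valueBound {j : ℕ} (hj : j ≤ k * (k + c + 3) + 6) :
    (2 ^ k * (n + M + 2)) ^ j ≤ valueBound n k M c :=
  Nat.pow_le_pow_right (Nat.mul_pos (Nat.two_pow_pos k) (by omega)) hj

theorem le_valueBound : 2 ^ k * (n + M + 2) ≤ valueBound n k M c := by
  simpa using pow_le_valueBound (n := n) (k := k) (M := M) (c := c) (j := 1) (by omega)

/-- Every parameter is at most `T = 2 ^ k * (n + M + 2)`, also `B + 1` because `B` has been clipped.
The exponent counts factors: `k + c + 3` in the base of the modulus, raised to the power `k`, with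
`6` to spare for the memory and the sums. -/
theorem large_valueBound {B : ℕ} (hk : 1 ≤ k) (hB : B ≤ k * (M + 1)) :
    Large (valueBound n k M c) n k B c := by
  set T := 2 ^ k * (n + M + 2) with hT
  have h2k : 2 ≤ 2 ^ k := Nat.le_self_pow (by omega) 2
  have hk2 : k + 1 ≤ 2 ^ k := Nat.lt_two_pow_self
  have hT1 : 2 * (n + M + 2) ≤ T := Nat.mul_le_mul_right _ h2k
  have hT2 : 2 ^ k ≤ T := Nat.le_mul_of_pos_right _ (by omega)
  have hB1 : B + 1 ≤ T := by
    calc B + 1 ≤ (k + 1) * (n + M + 2) := by nlinarith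
      _ ≤ T := Nat.mul_le_mul_right _ hk2
  have hkT : k ≤ T := by omega
  have hnT : n + 1 ≤ T := by omega
  refine ⟨?_, ?_, ?_⟩
  · have h1 : n * k * n ^ k * (2 * n) ^ (c + 1) ≤ T ^ (k + c + 3) := by
      calc n * k * n ^ k * (2 * n) ^ (c + 1) ≤ T * T * T ^ k * T ^ (c + 1) := by
            gcongr <;> omega
        _ = T ^ (k + c + 3) := by ring
    calc modulus n k ((2 * n) ^ (c + 1)) ≤ (T ^ (k + c + 3)) ^ k + 1 := by
          unfold modulus; gcongr
      _ = T ^ (k * (k + c + 3)) + 1 := by rw [← pow_mul, mul_comm k]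
      _ ≤ T ^ (k * (k + c + 3)) * T ^ 6 := by
          have h2 : 1 ≤ T ^ (k * (k + c + 3)) := Nat.one_le_pow _ _ (by omega)
          have h3 : 2 ≤ T ^ 6 := le_trans (by omega) (Nat.le_self_pow (n := 6) (by norm_num) T)
          nlinarith
      _ = valueBound n k M c := by rw [← pow_add]; rfl
  · refine le_trans ?_ (pow_le_valueBound (j := 6) (by omega))
    rw [← hT]
    calc n * n + n + k * ((n + 1) * n) + (k + 1) * ((n + 1) * ((B + 1) * 2 ^ k)) +
          (k + 1) * 2 ^ k + k
        ≤ T * T + T + T * (T * T) + T * (T * (T * T)) + T * T + T := by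
          gcongr <;> omega
      _ ≤ T ^ 6 := by
          have h4 : 4 ≤ T := by omega
          have h5 : T ≤ T * T := Nat.le_mul_of_pos_left _ (by omega)
          have h6 : T * T ≤ T * (T * T) := Nat.le_mul_of_pos_left _ (by omega)
          have h7 : T * (T * T) ≤ T * (T * (T * T)) := Nat.mul_le_mul_left _ h6
          have h8 : 16 ≤ T * T := Nat.mul_le_mul h4 h4
          calc _ ≤ 16 * (T * (T * (T * T))) := by omega
            _ ≤ (T * T) * (T * (T * (T * T))) := Nat.mul_le_mul_right _ h8
            _ = T ^ 6 := by ring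
  · refine le_trans ?_ (pow_le_valueBound (j := c + 1) (by nlinarith))
    rw [← hT, pow_succ']
    have h9 : c + 1 ≤ 2 ^ c := Nat.lt_two_pow_self
    have h10 : 2 ^ c ≤ T ^ c := Nat.pow_le_pow_left (by omega) c
    exact Nat.mul_le_mul (by omega) (h9.trans h10)

theorem size_mul_le (x y : ℕ) : (x * y).size ≤ x.size + y.size := by
  rw [Nat.size_le, pow_add]
  exact Nat.mul_lt_mul'' (Nat.lt_size_self x) (Nat.lt_size_self y)

/-- The base has about `k + log (n + M)` bits and the exponent is of order `k ^ 2`; hence the factor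
`k ^ 3`. -/
theorem size_valueBound_le (hk : 1 ≤ k) :
    (valueBound n k M c).size + 1 ≤ (2 * c + 22) * (k ^ 3 * (n + M + 2).size) := by
  set l := (n + M + 2).size with hl
  have hl1 : 1 ≤ l := Nat.size_pos.2 (by omega)
  have h1 : valueBound n k M c ≤ 2 ^ ((k + l) * (k * (k + c + 3) + 6)) := by
    rw [valueBound, pow_mul 2 (k + l), pow_add 2 k l]
    exact Nat.pow_le_pow_left (Nat.mul_le_mul_left _ (Nat.lt_size_self _).le) _
  have h2 : (valueBound n k M c).size ≤ (k + l) * (k * (k + c + 3) + 6) + 1 :=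
    Nat.size_le.2 (h1.trans_lt (Nat.pow_lt_pow_right (by norm_num) (Nat.lt_succ_self _)))
  have h3 : k + l ≤ 2 * (k * l) := by nlinarith
  have h4 : k * (k + c + 3) + 6 ≤ (c + 10) * k ^ 2 := by
    have h5 : k ≤ k ^ 2 := Nat.le_self_pow (by norm_num) k
    nlinarith
  have h6 : (k + l) * (k * (k + c + 3) + 6) ≤ (2 * c + 20) * (k ^ 3 * l) := by
    calc _ ≤ 2 * (k * l) * ((c + 10) * k ^ 2) := Nat.mul_le_mul h3 h4
      _ = _ := by ring
  have h7 : 1 ≤ k ^ 3 * l := Nat.mul_pos (by positivity) hl1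
  nlinarith

/-- The program: bounding `B`, then finding a path of minimum weight. -/
def program (c : ℕ) : Prog := .seq (clipCmd.comp 26) ((mainCmd c).comp 26)

/-- The running time up to a constant factor, with `D` in place of the bound for the weight. -/
def timeBound (n k M D : ℕ) : ℕ := 2 ^ k * (k ^ 5 * (D * (n ^ 2 * (n + M + 2).size ^ 2)))

/-- Why the time is linear in `B` without a factor `log B`: only the clipping handles numbers as
long as `B`, in `O(n ^ 2)` steps, where the length of `D` is simply bounded by `D`. The long second
phase works with clipped numbers. The constant `200000` is `20 * 100 ^ 2` from `stepCost`. -/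
theorem total_time_le {t₁ t₂ D B : ℕ} (hn : 1 ≤ n) (hk : 1 ≤ k) (hD : 1 ≤ D) (hB : B + 1 ≤ D)
    (h1 : t₁ ≤ stepCost (valueBound n k M c * D) 100 * (2 * (n * n) + 2))
    (h2 : t₂ ≤ stepCost (valueBound n k M c) 100 *
      (240 * ((c + 1) * (Nat.clog 2 n + 1) * k ^ 2 * n ^ 2 * ((B + 1) * 2 ^ k)))) :
    t₁ + t₂ ≤ 200000 * (2 * c + 23) * (480 * c + 484) * timeBound n k M D := by
  set l := (n + M + 2).size with hl
  have hl1 : 1 ≤ l := Nat.size_pos.2 (by omega)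
  have hsz := size_valueBound_le (n := n) (M := M) (c := c) hk
  rw [← hl] at hsz
  have hclog : Nat.clog 2 n + 1 ≤ 2 * l := by
    have : Nat.clog 2 n ≤ l := Nat.clog_le_of_le_pow
      (le_trans (by omega) (Nat.lt_size_self (n + M + 2)).le)
    omega
  have hDs : D.size ≤ D := Nat.size_le.2 Nat.lt_two_pow_self
  have hkl : 1 ≤ k ^ 3 * l := Nat.mul_pos (by positivity) hl1
  have hs0 : (valueBound n k M c * D).size + 1 ≤ (2 * c + 23) * (k ^ 3 * l * D) := by
    calc (valueBound n k M c * D).size + 1 ≤ (valueBound n k M c).size + 1 + D := by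
          have := size_mul_le (valueBound n k M c) D; omega
      _ ≤ (2 * c + 22) * (k ^ 3 * l) * D + k ^ 3 * l * D := by
          refine Nat.add_le_add (hsz.trans (Nat.le_mul_of_pos_right _ hD)) ?_
          exact Nat.le_mul_of_pos_left _ hkl
      _ = _ := by ring
  have hnn : 2 * (n * n) + 2 ≤ 4 * n ^ 2 := by nlinarith
  have e1 : t₁ ≤ 200000 * (2 * c + 23) * (4 * timeBound n k M D) := by
    calc t₁ ≤ 200000 * ((2 * c + 23) * (k ^ 3 * l * D)) * (4 * n ^ 2) := by
          refine h1.trans (Nat.mul_le_mul ?_ hnn)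
          rw [stepCost]
          exact Nat.mul_le_mul_left _ hs0
      _ = 200000 * (2 * c + 23) * (4 * (1 * (k ^ 3 * (D * (n ^ 2 * l ^ 1))))) := by ring
      _ ≤ 200000 * (2 * c + 23) * (4 * timeBound n k M D) := by
          unfold timeBound
          gcongr
          · exact Nat.one_le_two_pow
          · norm_num
          · norm_num
  have e2 : t₂ ≤ 200000 * (2 * c + 23) * ((480 * c + 480) * timeBound n k M D) := by
    calc t₂ ≤ 200000 * ((2 * c + 23) * (k ^ 3 * l)) *
          (240 * ((c + 1) * (2 * l) * k ^ 2 * n ^ 2 * (D * 2 ^ k))) := by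
          refine h2.trans (Nat.mul_le_mul ?_ (by gcongr))
          rw [stepCost]
          exact Nat.mul_le_mul_left _ (hsz.trans (Nat.mul_le_mul_right _ (by omega)))
      _ = 200000 * (2 * c + 23) * ((480 * c + 480) * timeBound n k M D) := by
          unfold timeBound; rw [← hl]; ring
  calc t₁ + t₂ ≤ _ := Nat.add_le_add e1 e2
    _ = _ := by ring

/-- For every outcome of the coins: the time bound, and the relation between the result and the walk
sums, which leaves only the nonvanishing at the minimum weight to chance. -/
theorem exec_program (coins : ℕ → Bool) {B : ℝ} {G : Digraph (Fin n)} {w : Fin n → Fin n → ℕ}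
    (hn : 1 ≤ n) (hk : 1 ≤ k) (hM : ∀ u v, G.Adj u v → w u v ≤ M) :
    ∃ (t : ℕ) (s : State) (B' res : ℕ), Exec coins (program c) (KPath.input G w k B) t s ∧
      t ≤ 200000 * (2 * c + 23) * (480 * c + 484) * timeBound n k M (⌊B⌋₊ + 1) ∧
      B' ≤ ⌊B⌋₊ ∧
      (∀ p, KPath.IsKPath G k p → KPath.weight w p ≤ ⌊B⌋₊ → KPath.weight w p ≤ B') ∧
      (res = 0 → ∀ β ≤ B', walkSum n k (KPath.matrix G w k B) (fun e =>
        (draw coins (Nat.clog 2 n * (c + 1)) e :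
        ZMod (modulus n k ((2 ^ Nat.clog 2 n) ^ (c + 1))))) k n β (2 ^ k - 1) = 0) ∧
      (res ≠ 0 → res - 1 ≤ B' ∧ (∀ β < res - 1, walkSum n k (KPath.matrix G w k B)
        (fun e => (draw coins (Nat.clog 2 n * (c + 1)) e :
        ZMod (modulus n k ((2 ^ Nat.clog 2 n) ^ (c + 1))))) k n β (2 ^ k - 1) = 0) ∧
        ∃ xs : List ℕ, xs.length = k ∧ xs.Nodup ∧ (∀ x ∈ xs, x < n) ∧
          IsWalk (KPath.matrix G w k B) n xs (res - 1) ∧ ∀ j < k, s.mem j = xs.getD j 0) ∧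
      s.reg 0 = res := by
  set V := valueBound n k M c with hV
  set s₀ := KPath.input G w k B with hs₀
  have hTV : 2 ^ k * (n + M + 2) ≤ V := le_valueBound
  have h2k : 2 ≤ 2 ^ k := Nat.le_self_pow (by omega) 2
  have hk2 : k < 2 ^ k := Nat.lt_two_pow_self
  have hV1 : 2 * (n + M + 2) ≤ V := (Nat.mul_le_mul_right _ h2k).trans hTV
  have hV2 : 2 ^ k ≤ V := (Nat.le_mul_of_pos_right _ (by omega)).trans hTV
  have hVD : V ≤ V * (⌊B⌋₊ + 1) := Nat.le_mul_of_pos_right _ (by omega)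
  have hDV : ⌊B⌋₊ + 1 ≤ V * (⌊B⌋₊ + 1) := Nat.le_mul_of_pos_left _ (by omega)
  have hL0 : Large V n k 0 c := large_valueBound hk (Nat.zero_le _)
  have hnn : n * n ≤ V := by have := hL0.space_le; omega
  have hcV : c + 1 ≤ V := (Nat.le_mul_of_pos_left _ (by omega)).trans hL0.bits_le
  have hmem : ∀ a, s₀.mem a ≤ M + 1 := KPath.input_mem_le hM
  -- The clipping runs under the larger bound `V * (⌊B⌋₊ + 1)`, since register `2` still holds
  -- `⌊B⌋`.
  obtain ⟨t₁, s₁, ⟨ρ, mem₁, dr₁, tm₁⟩, e₁, r₁, l₁, -, ⟨M', hρ, hm₁, hdr, hM1, hM2, htm⟩, c₁⟩ :=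
    Cmd.exec_comp coins (V := V * (⌊B⌋₊ + 1)) (W := 100) (by omega) (by norm_num) clipCmd
    (fun st => ∃ M', st.ρ = [n, k, min ⌊B⌋₊ (k * M'), M', 0, 0, 0, 0, 0, 0, 0, 0, 0, 0, 0, 0, 0, 0,
      0, 0, 0, 0, 0, 0, 0, 0] ∧ st.mem = s₀.mem ∧ st.dr = 0 ∧ M' ≤ M + 1 ∧
      (∀ a < n * n, s₀.mem a ≤ M') ∧ st.tm ≤ 2 * (n * n) + 2)
    ⟨[n, k, ⌊B⌋₊, 0, 0, 0, 0, 0, 0, 0, 0, 0, 0, 0, 0, 0, 0, 0, 0, 0, 0, 0, 0, 0, 0, 0], s₀.mem, 0,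
        0⟩
    s₀ wf_clipCmd
    ⟨fun x hx => by
      simp only [List.mem_cons, List.not_mem_nil, or_false, or_self] at hx; omega,
      fun a => by have := hmem a; simp only; omega⟩
    ⟨fun i hi => by
      simp only [List.length_cons, List.length_nil] at hi
      interval_cases i <;> simp [hs₀, KPath.input], rfl, rfl⟩
    (wp_clipCmd hmem (by omega) (by omega) (by omega) fun M' tm' h1 h2 h3 =>
      ⟨M', rfl, rfl, rfl, h1, h2, by simpa using h3⟩)
  simp only at hρ hm₁ hdr htm
  subst hρ hm₁ hdr
  have hBk : min ⌊B⌋₊ (k * M') ≤ k * (M + 1) :=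
    (min_le_right _ _).trans (Nat.mul_le_mul_left _ hM1)
  have hL : Large V n k (min ⌊B⌋₊ (k * M')) c := large_valueBound hk hBk
  have hBV : min ⌊B⌋₊ (k * M') + 1 ≤ V := (hL.layout (b' := 0) hn hk (by omega)).D_le
  -- The same machine state, now with all numbers at most `V`, starts the second phase with a fresh
  -- step counter.
  obtain ⟨t₂, s₂, st₂, e₂, r₂, l₂, -, ⟨res, hr0, hr1, hres, htm₂⟩, c₂⟩ :=
    Cmd.exec_comp coins (V := V) (W := 100) (by omega) (by norm_num) (mainCmd c)
    (fun st => ∃ res, (res = 0 → ∀ β ≤ min ⌊B⌋₊ (k * M'), walkSum n k (KPath.matrix G w k B)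
        (fun e => (draw coins (Nat.clog 2 n * (c + 1)) e :
        ZMod (modulus n k ((2 ^ Nat.clog 2 n) ^ (c + 1))))) k n β (2 ^ k - 1) = 0) ∧
      (res ≠ 0 → res - 1 ≤ min ⌊B⌋₊ (k * M') ∧ (∀ β < res - 1,
        walkSum n k (KPath.matrix G w k B) (fun e => (draw coins (Nat.clog 2 n * (c + 1)) e :
        ZMod (modulus n k ((2 ^ Nat.clog 2 n) ^ (c + 1))))) k n β (2 ^ k - 1) = 0) ∧
        ∃ xs : List ℕ, xs.length = k ∧ xs.Nodup ∧ (∀ x ∈ xs, x < n) ∧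
          IsWalk (KPath.matrix G w k B) n xs (res - 1) ∧ ∀ j < k, st.mem j = xs.getD j 0) ∧
      st.ρ.getD 0 0 = res ∧ st.tm ≤ 240 * ((c + 1) * (Nat.clog 2 n + 1) * k ^ 2 * n ^ 2 *
        ((min ⌊B⌋₊ (k * M') + 1) * 2 ^ k)))
    ⟨[n, k, min ⌊B⌋₊ (k * M'), M', 0, 0, 0, 0, 0, 0, 0, 0, 0, 0, 0, 0, 0, 0, 0, 0, 0, 0, 0, 0, 0,
        0],
      s₀.mem, 0, 0⟩
    s₁ (wf_mainCmd (by omega) hcV)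
    ⟨fun x hx => by
      simp only [List.mem_cons, List.not_mem_nil, or_false, or_self] at hx; omega,
      fun a => by have := hmem a; simp only; omega⟩
    (r₁.tm 0)
    (wp_mainCmd hn hk hL (fun a => by have := hmem a; omega) (KPath.matrix G w k B)
      (fun v hv u _ => by rw [KPath.matrix, if_pos hv])
      (fun u _ => by rw [KPath.matrix, if_neg (lt_irrefl n)])
      fun res st h1 h2 h3 h4 => ⟨res, h1, h2, h3, by simpa using h4⟩)
  refine ⟨t₁ + t₂, s₂, min ⌊B⌋₊ (k * M'), res, .seq e₁ e₂, ?_, min_le_left _ _, fun p hp hpB => ?_,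
    hr0, fun h => ?_, ?_⟩
  · refine total_time_le (B := min ⌊B⌋₊ (k * M')) hn hk (by omega)
      (Nat.succ_le_succ (min_le_left _ _)) ?_ ?_
    · simp only [mul_zero, add_zero] at c₁
      exact c₁.trans (Nat.mul_le_mul_left _ htm)
    · simp only [mul_zero, add_zero] at c₂
      exact c₂.trans (Nat.mul_le_mul_left _ htm₂)
  · refine le_min hpB ?_
    rw [← hp.1]
    exact KPath.weight_le hM2 p hp.2.2
  · rw [r₂.mem]
    exact hr1 h
  · rw [← hres]
    exact r₂.reg 0 (by rw [l₂]; simp)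

end RAM

/-! ### From bit lengths to real logarithms -/

namespace RAM

/-- One bit is at most `log (n + M + 2)` since `n + M + 2 ≥ 3 > e`, and the others number at most
twice the logarithm since `log 2 > 1 / 2`. -/
theorem size_le_log (n M : ℕ) (hn : 1 ≤ n) :
    ((n + M + 2).size : ℝ) ≤ 3 * Real.log (n + M + 2) := by
  have hX : (3 : ℝ) ≤ n + M + 2 := by
    have : (1 : ℝ) ≤ n := by exact_mod_cast hn
    have : (0 : ℝ) ≤ M := by positivity
    linarith
  have h1 : 1 ≤ Real.log (n + M + 2) := by
    rw [Real.le_log_iff_exp_le (by linarith)]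
    exact (Real.exp_one_lt_three.le).trans hX
  obtain ⟨j, hj⟩ := Nat.exists_eq_succ_of_ne_zero
    (Nat.size_pos.2 (by omega : 0 < n + M + 2)).ne'
  have h2 : 2 ^ j ≤ n + M + 2 := Nat.lt_size.1 (by omega)
  have h3 : (j : ℝ) * Real.log 2 ≤ Real.log (n + M + 2) := by
    rw [← Real.log_pow]
    exact Real.log_le_log (by positivity) (by exact_mod_cast h2)
  have h4 := Real.log_two_gt_d9
  have h5 : (j : ℝ) ≤ 2 * Real.log (n + M + 2) := by
    have : (0 : ℝ) ≤ j := by positivity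
    nlinarith
  rw [hj]
  push_cast
  linarith

/-- Trades `log n` for a factor `n`, as the second time bound contains only `log (M + 2)`. -/
theorem log_add_le (n M : ℕ) (hn : 1 ≤ n) :
    Real.log (n + M + 2) ≤ 3 * (n * Real.log (M + 2)) := by
  have hn1 : (1 : ℝ) ≤ n := by exact_mod_cast hn
  have hM0 : (0 : ℝ) ≤ M := by positivity
  have h1 : Real.log 2 ≤ Real.log (M + 2) := Real.log_le_log (by norm_num) (by linarith)
  have h2 := Real.log_two_gt_d9
  calc Real.log (n + M + 2) ≤ Real.log ((n + 1) * (M + 2)) :=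
        Real.log_le_log (by positivity) (by nlinarith)
    _ = Real.log (n + 1) + Real.log (M + 2) := Real.log_mul (by positivity) (by positivity)
    _ ≤ n + Real.log (M + 2) := by
        have := Real.log_le_sub_one_of_pos (show (0 : ℝ) < n + 1 by positivity)
        linarith
    _ ≤ 3 * (n * Real.log (M + 2)) := by nlinarith

theorem timeBound_le {n k M : ℕ} {B : ℝ} (hn : 1 ≤ n) (hk : 1 ≤ k) (hB : 0 ≤ B) :
    (timeBound n k M (⌊B⌋₊ + 1) : ℝ) ≤
      18 * (2 ^ k * k ^ 5 * max 1 B * n ^ 2 * Real.log (n + M + 2) ^ 2) := by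
  have h1 : (⌊B⌋₊ : ℝ) + 1 ≤ 2 * max 1 B := by
    have := Nat.floor_le hB
    have := le_max_left 1 B
    have := le_max_right 1 B
    linarith
  have h2 := size_le_log n M hn
  calc (timeBound n k M (⌊B⌋₊ + 1) : ℝ)
      = 2 ^ k * (k ^ 5 * ((⌊B⌋₊ + 1) * (n ^ 2 * ((n + M + 2).size : ℝ) ^ 2))) := by
        rw [timeBound]; push_cast; ring
    _ ≤ 2 ^ k * (k ^ 5 * ((2 * max 1 B) * (n ^ 2 * (3 * Real.log (n + M + 2)) ^ 2))) := by
        gcongr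
    _ = _ := by ring

end RAM
-- The theorem
theorem mainTheorem5 (K : Type*) [Field K] :
    ∃ a : ℕ, ∀ c : ℕ, ∃ (P : RAM.Prog) (C : ℝ),
      ∀ (n k M : ℕ) (B : ℝ) (G : Digraph (Fin n)) (w : Fin n → Fin n → ℕ),
        1 ≤ n → 1 ≤ k → 0 ≤ B → (∀ u v, G.Adj u v → w u v ≤ M) →
        (∀ coins : ℕ → Bool, ∃ (t : ℕ) (s : RAM.State),
          RAM.Exec coins P (KPath.input G w k B) t s ∧
          (t : ℝ) ≤ C * 2 ^ k * (k : ℝ) ^ a * max 1 B * (n : ℝ) ^ matMulExponent K *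
            Real.log (n + M + 2) ^ a ∧
          (t : ℝ) ≤ C * 2 ^ k * max 1 B * (n * k * Real.log (M + 2)) ^ a) ∧
        RAM.coinMeasure {coins : ℕ → Bool | ¬ ∃ (t : ℕ) (s : RAM.State),
          RAM.Exec coins P (KPath.input G w k B) t s ∧
          KPath.IsAnswer G w k B (KPath.output k s)} ≤ ENNReal.ofReal (1 / (n : ℝ) ^ c) := by
  -- The time carries `k ^ 5`, and after `log_add_le` also `n ^ 4`; the exponent `6` covers both.
  refine ⟨6, fun c => ?_⟩
  obtain ⟨T, hT⟩ : ∃ T : ℕ, T = 200000 * (2 * c + 23) * (480 * c + 484) := ⟨_, rfl⟩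
  -- `2592 = 18 * 9 * 16`: from `timeBound_le`, from the square in `log_add_le`, and from padding
  -- with `(2 * log (M + 2)) ^ 4 ≥ 1`.
  refine ⟨RAM.program c, 2592 * T, fun n k M B G w hn hk hB hM => ⟨fun coins => ?_, ?_⟩⟩
  · obtain ⟨t, s, -, -, he, ht, -⟩ := RAM.exec_program (c := c) coins (B := B) hn hk hM
    rw [← hT] at ht
    have hn1 : (1 : ℝ) ≤ n := by exact_mod_cast hn
    have hk1 : (1 : ℝ) ≤ k := by exact_mod_cast hk
    have hB1 : 1 ≤ max 1 B := le_max_left 1 B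
    have hM0 : (0 : ℝ) ≤ M := by positivity
    have hL1 : 1 ≤ Real.log (n + M + 2) := by
      rw [Real.le_log_iff_exp_le (by linarith)]
      exact (Real.exp_one_lt_three.le).trans (by linarith)
    have hL2 : 1 ≤ 2 * Real.log (M + 2) := by
      have h1 : Real.log 2 ≤ Real.log (M + 2) := Real.log_le_log (by norm_num) (by linarith)
      have h2 := Real.log_two_gt_d9
      linarith
    have htr : (t : ℝ) ≤
        T * (18 * (2 ^ k * k ^ 5 * max 1 B * n ^ 2 * Real.log (n + M + 2) ^ 2)) := by
      refine le_trans (by exact_mod_cast ht) (mul_le_mul_of_nonneg_left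
        (RAM.timeBound_le hn hk hB) (Nat.cast_nonneg T))
    refine ⟨t, s, he, htr.trans ?_, htr.trans ?_⟩
    · calc (T : ℝ) * (18 * (2 ^ k * k ^ 5 * max 1 B * n ^ 2 * Real.log (n + M + 2) ^ 2))
          = (18 * T) * 2 ^ k * k ^ 5 * max 1 B * n ^ 2 * Real.log (n + M + 2) ^ 2 := by ring
        _ ≤ (2592 * T) * 2 ^ k * k ^ 6 * max 1 B * (n : ℝ) ^ matMulExponent K *
            Real.log (n + M + 2) ^ 6 := by
          have := sq_le_rpow_matMulExponent K hn
          gcongr <;> norm_num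
    · calc (T : ℝ) * (18 * (2 ^ k * k ^ 5 * max 1 B * n ^ 2 * Real.log (n + M + 2) ^ 2))
          ≤ T * (18 * (2 ^ k * k ^ 5 * max 1 B * n ^ 2 * (3 * (n * Real.log (M + 2))) ^ 2)) := by
            have := RAM.log_add_le n M hn
            gcongr
        _ = 162 * T * 2 ^ k * max 1 B * (k ^ 5 * n ^ 4 * Real.log (M + 2) ^ 2 * 1) := by ring
        _ ≤ 162 * T * 2 ^ k * max 1 B *
            (k ^ 6 * n ^ 6 * Real.log (M + 2) ^ 2 * (2 * Real.log (M + 2)) ^ 4) := by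
          have h3 : 1 ≤ (2 * Real.log (M + 2)) ^ 4 := one_le_pow₀ hL2
          gcongr <;> norm_num
        _ = 2592 * T * 2 ^ k * max 1 B * (n * k * Real.log (M + 2)) ^ 6 := by ring
  -- If there is a `k`-path, the bad event lies in the vanishing of one coefficient, that of the
  -- minimum weight. If there is none, the answer is right for all coins.
  · by_cases hex : ∃ p, KPath.IsKPath G k p
    · obtain ⟨p, hp, hmin⟩ := KPath.exists_min_isKPath (w := w) hex
      refine le_trans (measure_mono fun coins hcoins => ?_)
        (RAM.coinMeasure_walkSum_eq_zero_le (c := c) (k := k) (p := p.map Fin.val) hn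
          (by rw [List.length_map, hp.1]) (hp.2.1.map Fin.val_injective) (by simp)
          ((KPath.isWalk_source_iff (G := G) (w := w) (k := k) (B := B) p _).2 ⟨hp.2.2, rfl⟩))
      by_contra hne
      obtain ⟨t, s, B', res, he, -, hB', hclip, h0, h1, hs⟩ :=
        RAM.exec_program (c := c) coins (B := B) hn hk hM
      refine hcoins ⟨t, s, he, KPath.isAnswer_output hB h0 h1 hs hB' hclip
        fun q hq _ hq' => ?_⟩
      rw [le_antisymm (hq' p hp) (hmin q hq)]
      exact hne
    · refine le_trans (measure_mono (t := ∅) fun coins hcoins => ?_) (by simp)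
      obtain ⟨t, s, B', res, he, -, hB', hclip, h0, h1, hs⟩ :=
        RAM.exec_program (c := c) coins (B := B) hn hk hM
      exact hcoins ⟨t, s, he, KPath.isAnswer_output hB h0 h1 hs hB' hclip
        fun q hq => absurd ⟨q, hq⟩ hex⟩
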